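/- Let $k$ be a field and let $A$ and $B$ be finite-dimensional $k$-algebras with unit; modules are finitely generated left modules, and $k$ acts centrally on bimodules. A module is Gorenstein projective if it is isomorphic to a module of cycles of a totally acyclic complex, that is, of an acyclic complex of finitely generated projective modules that remains acyclic under $\mathrm{Hom}(-,Q)$ for every finitely generated projective $Q$. Let $\mathcal{GP}(A)$ be the category of Gorenstein projective $A$-modules, $\underline{\mathcal{GP}}(A)$ its stable category (morphisms modulo those factoring through projective modules), and $\mathcal{GP}^{<\infty}(A)$ the category of $A$-modules $X$ of finite Gorenstein projective dimension (there is an exact sequence $0\to G_n\to\cdots\to G_0\to X\to 0$ with all $G_i$ Gorenstein projective). The Gorenstein projective model structure on $\mathcal{GP}^{<\infty}(A)$ has as cofibrations the monomorphisms with Gorenstein projective cokernel, as fibrations the epimorphisms of modules, and as weak equivalences the morphisms that factor as a monomorphism with projective cokernel followed by an epimorphism whose kernel has finite projective dimension; these classes satisfy the usual axioms of a model structure (two out of three, retracts, lifting, factorization). Let $\mathrm{Ho}(\mathcal{GP}^{<\infty}(A))$ be its homotopy category, the localization at the weak equivalences. Suppose that bimodules ${}_BM_A$ and ${}_AN_B$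 define a stable equivalence of Morita type: $M$ and $N$ are finitely generated and projective as left and as right modules, $N\otimes_BM\cong A\oplus P$ as $A$-$A$-bimodules for a projective $A$-$A$-bimodule $P$, and $M\otimes_AN\cong B\oplus Q$ as $B$-$B$-bimodules for a projective $B$-$B$-bimodule $Q$. Suppose moreover that both $(M\otimes_A-,\,N\otimes_B-)$ and $(N\otimes_B-,\,M\otimes_A-)$ are adjoint pairs between the categories of finitely generated modules. Then the first adjunction restricts to $$T_M=M\otimes_A-:\ \mathcal{GP}^{<\infty}(A)\rightleftarrows\mathcal{GP}^{<\infty}(B)\ :T_N=N\otimes_B-,$$ and this is a Quillen equivalence between the Gorenstein projective model structures. Furthermore, for the standard triangulated structures on these categories, there are equivalences of triangulated categories $$\underline{\mathcal{GP}}(A)\simeq\mathrm{Ho}(\mathcal{GP}^{<\infty}(A))\simeq\mathrm{Ho}(\mathcal{GP}^{<\infty}(B))\simeq\underline{\mathcal{GP}}(B),$$ where the outer ones are induced by the inclusions $\mathcal{GP}\subseteq\mathcal{GP}^{<\infty}$ and the middle one is given by the total left derived functor of $T_M$, with inverse the total right derived functor of $T_N$. Here the suspension of $X$ is $S$ for any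 exact sequence $0\to X\to W\to S\to 0$ with $S$ Gorenstein projective and $W$ projective (in $\underline{\mathcal{GP}}$), respectively of finite projective dimension (in $\mathrm{Ho}$), and the distinguished triangles are, up to isomorphism, the triangles $X\to Y\to C\to S$ obtained from such a sequence by pushout along a morphism $X\to Y$. -/

import Mathlib

open CategoryTheory CategoryTheory.Limits CategoryTheory.Pretriangulated TensorProduct MulOpposite

universe v u

noncomputable section

/-! ### Tensor product over a noncommutative ring -/

/-- The relations `m a ⊗ x = m ⊗ a x` defining `M ⊗_A X` as a quotient of `M ⊗_ℤ X`. -/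
def balancedRel (A M X : Type u) [Ring A] [AddCommGroup M] [Module Aᵐᵒᵖ M]
    [AddCommGroup X] [Module A X] : AddSubgroup (M ⊗[ℤ] X) :=
  AddSubgroup.closure {z | ∃ (m : M) (a : A) (x : X), z = (op a • m) ⊗ₜ[ℤ] x - m ⊗ₜ[ℤ] (a • x)}

/-- The tensor product `M ⊗_A X` of a right `A`-module `M` and a left `A`-module `X`. -/
def BalancedTensor (A M X : Type u) [Ring A] [AddCommGroup M] [Module Aᵐᵒᵖ M]
    [AddCommGroup X] [Module A X] : Type u :=
  (M ⊗[ℤ] X) ⧸ balancedRel A M X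

namespace BalancedTensor

section

variable (A M X : Type u) [Ring A] [AddCommGroup M] [Module Aᵐᵒᵖ M] [AddCommGroup X] [Module A X]

instance : AddCommGroup (BalancedTensor A M X) :=
  inferInstanceAs (AddCommGroup ((M ⊗[ℤ] X) ⧸ balancedRel A M X))

variable {M X}

/-- The class of the elementary tensor `m ⊗ x` in `M ⊗_A X`. -/
def tmul (m : M) (x : X) : BalancedTensor A M X :=
  QuotientAddGroup.mk' (balancedRel A M X) (m ⊗ₜ[ℤ] x)

variable {A}

@[elab_as_elim]
theorem induction_on {p : BalancedTensor A M X → Prop} (z : BalancedTensor A M X)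
    (tmul : ∀ m x, p (tmul A m x)) (zero : p 0) (add : ∀ y z, p y → p z → p (y + z)) : p z := by
  obtain ⟨t, rfl⟩ := QuotientAddGroup.mk'_surjective (balancedRel A M X) z
  induction t using TensorProduct.induction_on with
  | zero =>
    rw [map_zero]
    exact zero
  | tmul m x => exact tmul m x
  | add s t hs ht => rw [map_add]; exact add _ _ hs ht

theorem add_tmul (m m' : M) (x : X) : tmul A (m + m') x = tmul A m x + tmul A m' x := by
  simp only [tmul, TensorProduct.add_tmul, map_add]; rfl

theorem tmul_add (m : M) (x x' : X) : tmul A m (x + x') = tmul A m x + tmul A m x' := by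
  simp only [tmul, TensorProduct.tmul_add, map_add]; rfl

theorem zero_tmul (x : X) : tmul A (0 : M) x = 0 := by
  simp only [tmul, TensorProduct.zero_tmul, map_zero]; rfl

theorem tmul_zero (m : M) : tmul A m (0 : X) = 0 := by
  simp only [tmul, TensorProduct.tmul_zero, map_zero]; rfl

/-- In `M ⊗_A X` one has `m a ⊗ x = m ⊗ a x`. -/
theorem smul_tmul (m : M) (a : A) (x : X) : tmul A (op a • m) x = tmul A m (a • x) := by
  refine (QuotientAddGroup.eq_iff_sub_mem).2 (AddSubgroup.subset_closure ⟨m, a, x, rfl⟩)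

end

section

variable {A M X M' X' : Type u} [Ring A] [AddCommGroup M] [Module Aᵐᵒᵖ M] [AddCommGroup X]
  [Module A X] [AddCommGroup M'] [Module Aᵐᵒᵖ M'] [AddCommGroup X'] [Module A X']

/-- The additive map `f ⊗ g : M ⊗_A X → M' ⊗_A X'`. -/
def map (f : M →ₗ[Aᵐᵒᵖ] M') (g : X →ₗ[A] X') : BalancedTensor A M X →+ BalancedTensor A M' X' :=
  QuotientAddGroup.map (balancedRel A M X) (balancedRel A M' X')
    (TensorProduct.map f.toAddMonoidHom.toIntLinearMap
      g.toAddMonoidHom.toIntLinearMap).toAddMonoidHom (by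
      refine (AddSubgroup.closure_le _).2 ?_
      rintro _ ⟨m, a, x, rfl⟩
      refine AddSubgroup.subset_closure ⟨f m, a, g x, ?_⟩
      refine (map_sub (TensorProduct.map f.toAddMonoidHom.toIntLinearMap
        g.toAddMonoidHom.toIntLinearMap).toAddMonoidHom _ _).trans ?_
      exact congrArg₂ (fun p q => p ⊗ₜ[ℤ] g x - f m ⊗ₜ[ℤ] q) (f.map_smul (op a) m)
        (g.map_smul a x))

@[simp]
theorem map_tmul (f : M →ₗ[Aᵐᵒᵖ] M') (g : X →ₗ[A] X') (m : M) (x : X) :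
    map f g (tmul A m x) = tmul A (f m) (g x) := rfl

end

section

variable {A M X : Type u} [Ring A] [AddCommGroup M] [Module Aᵐᵒᵖ M] [AddCommGroup X] [Module A X]

/-- The left action `b (m ⊗ x) = (b m) ⊗ x` on `M ⊗_A X` for a `B`-`A`-bimodule `M`. -/
instance leftModule {B : Type u} [Ring B] [Module B M] [SMulCommClass B Aᵐᵒᵖ M] :
    Module B (BalancedTensor A M X) where
  smul b z := map (Module.toModuleEnd Aᵐᵒᵖ M b) (LinearMap.id : X →ₗ[A] X) z
  smul_zero b := map_zero _
  smul_add b := map_add _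
  one_smul z := by
    refine induction_on z (fun m x => ?_) (map_zero _) fun y z hy hz => ?_
    · exact congrArg (fun n => tmul A n x) (one_smul B m)
    · exact (map_add _ y z).trans (congrArg₂ (· + ·) hy hz)
  mul_smul b c z := by
    refine induction_on z (fun m x => ?_) ?_ fun y z hy hz => ?_
    · exact congrArg (fun n => tmul A n x) (mul_smul b c m)
    · exact (map_zero _).trans ((congrArg _ (map_zero _)).trans (map_zero _)).symm
    · exact (map_add _ y z).trans ((congrArg₂ (· + ·) hy hz).trans
        ((congrArg _ (map_add _ y z)).trans (map_add _ _ _)).symm)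
  add_smul b c z := by
    refine induction_on z (fun m x => ?_) ?_ fun y z hy hz => ?_
    · exact (congrArg (fun n => tmul A n x) (add_smul b c m)).trans (add_tmul _ _ _)
    · exact (map_zero _).trans ((congrArg₂ (· + ·) (map_zero _) (map_zero _)).trans
        (add_zero 0)).symm
    · refine (map_add _ y z).trans ((congrArg₂ (· + ·) hy hz).trans ?_)
      refine Eq.trans ?_ (congrArg₂ (· + ·) (map_add _ y z) (map_add _ y z)).symm
      exact add_add_add_comm _ _ _ _
  zero_smul z := by
    refine induction_on z (fun m x => ?_) (map_zero _) fun y z hy hz => ?_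
    · exact (congrArg (fun n => tmul A n x) (zero_smul B m)).trans (zero_tmul _)
    · exact (map_add _ y z).trans ((congrArg₂ (· + ·) hy hz).trans (add_zero 0))

theorem left_smul_tmul {B : Type u} [Ring B] [Module B M] [SMulCommClass B Aᵐᵒᵖ M]
    (b : B) (m : M) (x : X) : b • tmul A m x = tmul A (b • m) x := rfl

/-- The right action `(m ⊗ x) c = m ⊗ (x c)` on `M ⊗_A X` for an `A`-`C`-bimodule `X`. -/
instance rightModule {C : Type u} [Ring C] [Module Cᵐᵒᵖ X] [SMulCommClass A Cᵐᵒᵖ X] :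
    Module Cᵐᵒᵖ (BalancedTensor A M X) :=
  haveI : SMulCommClass Cᵐᵒᵖ A X := SMulCommClass.symm _ _ _
  { smul := fun c z => map (LinearMap.id : M →ₗ[Aᵐᵒᵖ] M) (Module.toModuleEnd A X c) z
    smul_zero := fun b => map_zero _
    smul_add := fun b => map_add _
    one_smul := fun z => by
      refine induction_on z (fun m x => ?_) (map_zero _) fun y z hy hz => ?_
      · exact congrArg (fun n => tmul A m n) (one_smul Cᵐᵒᵖ x)
      · exact (map_add _ y z).trans (congrArg₂ (· + ·) hy hz)
    mul_smul := fun b c z => by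
      refine induction_on z (fun m x => ?_) ?_ fun y z hy hz => ?_
      · exact congrArg (fun n => tmul A m n) (mul_smul b c x)
      · exact (map_zero _).trans ((congrArg _ (map_zero _)).trans (map_zero _)).symm
      · exact (map_add _ y z).trans ((congrArg₂ (· + ·) hy hz).trans
          ((congrArg _ (map_add _ y z)).trans (map_add _ _ _)).symm)
    add_smul := fun b c z => by
      refine induction_on z (fun m x => ?_) ?_ fun y z hy hz => ?_
      · exact (congrArg (fun n => tmul A m n) (add_smul b c x)).trans (tmul_add _ _ _)
      · exact (map_zero _).trans ((congrArg₂ (· + ·) (map_zero _) (map_zero _)).trans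
          (add_zero 0)).symm
      · refine (map_add _ y z).trans ((congrArg₂ (· + ·) hy hz).trans ?_)
        refine Eq.trans ?_ (congrArg₂ (· + ·) (map_add _ y z) (map_add _ y z)).symm
        exact add_add_add_comm _ _ _ _
    zero_smul := fun z => by
      refine induction_on z (fun m x => ?_) (map_zero _) fun y z hy hz => ?_
      · exact (congrArg (fun n => tmul A m n) (zero_smul Cᵐᵒᵖ x)).trans (tmul_zero _)
      · exact (map_add _ y z).trans ((congrArg₂ (· + ·) hy hz).trans (add_zero 0)) }

theorem right_smul_tmul {C : Type u} [Ring C] [Module Cᵐᵒᵖ X] [SMulCommClass A Cᵐᵒᵖ X]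
    (c : Cᵐᵒᵖ) (m : M) (x : X) : c • tmul A m x = tmul A m (c • x) := rfl

end

section

variable {A B M X X' : Type u} [Ring A] [Ring B] [AddCommGroup M] [Module B M] [Module Aᵐᵒᵖ M]
  [SMulCommClass B Aᵐᵒᵖ M] [AddCommGroup X] [Module A X] [AddCommGroup X'] [Module A X']

variable (B M) in
/-- The `B`-linear map `M ⊗ g : M ⊗_A X → M ⊗_A X'`. -/
def lmap (g : X →ₗ[A] X') : BalancedTensor A M X →ₗ[B] BalancedTensor A M X' where
  toFun := map LinearMap.id g
  map_add' := map_add _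
  map_smul' b z := by
    refine induction_on z (fun m x => rfl) ?_ fun y z hy hz => ?_
    · simp
    · simp only [smul_add, map_add, hy, hz]

@[simp]
theorem lmap_tmul (g : X →ₗ[A] X') (m : M) (x : X) :
    lmap B M g (tmul A m x) = tmul A m (g x) := rfl

instance finite [Module.Finite B M] [Module.Finite A X] :
    Module.Finite B (BalancedTensor A M X) := by
  classical
  obtain ⟨s, hs⟩ := Module.Finite.fg_top (R := B) (M := M)
  obtain ⟨t, ht⟩ := Module.Finite.fg_top (R := A) (M := X)
  refine ⟨⟨Finset.image₂ (tmul A) s t, ?_⟩⟩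
  rw [eq_top_iff]
  rintro z -
  refine induction_on z (fun m x => ?_) (zero_mem _) fun y z hy hz => add_mem hy hz
  have hx : x ∈ Submodule.span A (t : Set X) := ht ▸ Submodule.mem_top
  induction hx using Submodule.span_induction generalizing m with
  | mem x hx =>
    have hm : m ∈ Submodule.span B (s : Set M) := hs ▸ Submodule.mem_top
    induction hm using Submodule.span_induction with
    | mem m hm =>
      exact Submodule.subset_span (Finset.mem_coe.2 (Finset.mem_image₂_of_mem hm hx))
    | zero => rw [zero_tmul]; exact zero_mem _
    | add m m' _ _ h h' => rw [add_tmul]; exact add_mem h h'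
    | smul b m _ h => rw [← left_smul_tmul]; exact Submodule.smul_mem _ b h
  | zero => rw [tmul_zero]; exact zero_mem _
  | add x x' _ _ h h' => rw [tmul_add]; exact add_mem (h m) (h' m)
  | smul a x _ h => rw [← smul_tmul]; exact h _

end

end BalancedTensor

/-- The functor `T_M = M ⊗_A - : A-mod ⥤ B-mod` of a `B`-`A`-bimodule `M` that is finitely
generated as a left `B`-module. -/
def tensorFunctor (A B M : Type u) [Ring A] [Ring B] [AddCommGroup M] [Module B M] [Module Aᵐᵒᵖ M]
    [SMulCommClass B Aᵐᵒᵖ M] [Module.Finite B M] : FGModuleCat.{u} A ⥤ FGModuleCat.{u} B where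
  obj X := FGModuleCat.of B (BalancedTensor A M X)
  map f := FGModuleCat.ofHom (BalancedTensor.lmap B M f.hom.hom)
  map_id X := by
    ext z
    refine BalancedTensor.induction_on z (fun m x => rfl) (map_zero _) fun y z hy hz => ?_
    exact (map_add _ y z).trans (congrArg₂ (· + ·) hy hz)
  map_comp f g := by
    ext z
    refine BalancedTensor.induction_on z (fun m x => rfl) ?_ fun y z hy hz => ?_
    · exact (map_zero _).trans (map_zero _).symm
    · exact (map_add _ y z).trans ((congrArg₂ (· + ·) hy hz).trans (map_add _ y z).symm)

/-! ### Stable equivalences of Morita type -/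

/-- For an `A`-`A`-bimodule `T`: there is an isomorphism `T ≅ A ⊕ P` of `A`-`A`-bimodules for some
projective `A`-`A`-bimodule `P`, that is, a projective module over `A ⊗ₖ Aᵒᵖ`. -/
def IsRegularPlusProjective (k : Type v) (A T : Type u) [Field k] [Ring A] [Algebra k A] [AddCommGroup T]
    [Module A T] [Module Aᵐᵒᵖ T] : Prop :=
  ∃ (P : Type u) (_ : AddCommGroup P) (_ : Module (A ⊗[k] Aᵐᵒᵖ) P),
    Module.Projective (A ⊗[k] Aᵐᵒᵖ) P ∧
    ∃ e : T ≃+ A × P, ∀ (a b : A) (t : T),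
      e (a • op b • t) = (a * (e t).1 * b, (a ⊗ₜ[k] op b) • (e t).2)

/-- The bimodules `_B M _A` and `_A N _B` define a stable equivalence of Morita type
between `A` and `B`. -/
structure IsStableEquivalenceOfMoritaType (k : Type v) (A B M N : Type u) [Field k] [Ring A] [Ring B]
    [Algebra k A] [Algebra k B]
    [AddCommGroup M] [Module B M] [Module Aᵐᵒᵖ M] [SMulCommClass B Aᵐᵒᵖ M]
    [AddCommGroup N] [Module A N] [Module Bᵐᵒᵖ N] [SMulCommClass A Bᵐᵒᵖ N] : Prop where
  projective_left_M : Module.Projective B M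
  projective_right_M : Module.Projective Aᵐᵒᵖ M
  projective_left_N : Module.Projective A N
  projective_right_N : Module.Projective Bᵐᵒᵖ N
  tensor_NM : IsRegularPlusProjective k A (BalancedTensor B N M)
  tensor_MN : IsRegularPlusProjective k B (BalancedTensor A M N)

/-! ### Gorenstein projective modules -/

section Gorenstein

variable (A : Type u) [Ring A]

/-- A totally acyclic complex of finitely generated projective modules: an acyclic complex `K` of
such modules which stays acyclic under `Hom(-, Q)` for every such module `Q`. -/
structure IsTotallyAcyclic (K : ChainComplex (ModuleCat.{u} A) ℤ) : Prop where
  finite : ∀ i, Module.Finite A (K.X i)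
  projective : ∀ i, Module.Projective A (K.X i)
  acyclic : K.Acyclic
  hom_acyclic : ∀ (Q : ModuleCat.{u} A), Module.Finite A Q → Module.Projective A Q →
    ∀ (i : ℤ) (f : K.X i ⟶ Q), K.d (i + 1) i ≫ f = 0 →
      ∃ g : K.X (i - 1) ⟶ Q, K.d i (i - 1) ≫ g = f

/-- Finitely generated Gorenstein projective modules: those isomorphic to a module of cycles of
a totally acyclic complex. -/
def gorensteinProjective : ObjectProperty (FGModuleCat.{u} A) := fun X =>
  ∃ K : ChainComplex (ModuleCat.{u} A) ℤ, IsTotallyAcyclic A K ∧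
    ∃ i : ℤ, Nonempty (X.obj ≅ K.cycles i)

/-- Finitely generated projective modules. -/
def fgProjective : ObjectProperty (FGModuleCat.{u} A) := fun X => Module.Projective A X

/-- Finitely generated modules of finite projective dimension. -/
def finiteProjDim : ObjectProperty (FGModuleCat.{u} A) := fun X =>
  ∃ n : ℕ, HasProjectiveDimensionLT X.obj n

variable {A}

/-- The sequence `0 → X → Y → Z → 0` of modules is exact. -/
structure IsShortExact {X Y Z : FGModuleCat.{u} A} (f : X ⟶ Y) (g : Y ⟶ Z) : Prop where
  injective : Function.Injective f.hom.hom
  exact : Function.Exact f.hom.hom g.hom.hom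
  surjective : Function.Surjective g.hom.hom

variable (A)

/-- `X` has Gorenstein projective dimension at most `n`: there is an exact sequence
`0 → Gₙ → ⋯ → G₀ → X → 0` with all `Gᵢ` Gorenstein projective. -/
def gorensteinProjDimLE : ℕ → ObjectProperty (FGModuleCat.{u} A)
  | 0 => gorensteinProjective A
  | n + 1 => fun X => ∃ (K G : FGModuleCat.{u} A) (i : K ⟶ G) (p : G ⟶ X),
      IsShortExact i p ∧ gorensteinProjective A G ∧ gorensteinProjDimLE n K

/-- Finitely generated modules of finite Gorenstein projective dimension. -/
def finiteGorensteinProjDim : ObjectProperty (FGModuleCat.{u} A) := fun X =>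
  ∃ n : ℕ, gorensteinProjDimLE A n X

theorem gorensteinProjective_le : gorensteinProjective A ≤ finiteGorensteinProjDim A :=
  fun _ hX => ⟨0, hX⟩

/-- The category `𝒢𝒫(A)` of finitely generated Gorenstein projective modules. -/
abbrev GP := (gorensteinProjective A).FullSubcategory

/-- The category `𝒢𝒫^{<∞}(A)` of finitely generated modules of finite Gorenstein projective
dimension. -/
abbrev GPFin := (finiteGorensteinProjDim A).FullSubcategory

/-- The inclusion `𝒢𝒫(A) ⥤ 𝒢𝒫^{<∞}(A)`. -/
abbrev GP.incl : GP A ⥤ GPFin A := ObjectProperty.ιOfLE (gorensteinProjective_le A)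

/-- Two morphisms are stably equal if their difference factors through a projective. -/
def stableRel : HomRel (GP A) := fun X Y f g =>
  ∃ (Q : FGModuleCat.{u} A) (a : X.obj ⟶ Q) (b : Q ⟶ Y.obj),
    fgProjective A Q ∧ f.hom - g.hom = a ≫ b

/-- The stable category of finitely generated Gorenstein projective modules. -/
abbrev StableGP := CategoryTheory.Quotient (stableRel A)

/-- The projection `𝒢𝒫(A) ⥤ StableGP A`. -/
abbrev StableGP.proj : GP A ⥤ StableGP A := CategoryTheory.Quotient.functor (stableRel A)

end Gorenstein

/-! ### Model structures and Quillen equivalences -/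

/-- Three classes of morphisms in a category. -/
structure ModelClasses (C : Type*) [Category C] where
  weq : MorphismProperty C
  cof : MorphismProperty C
  fib : MorphismProperty C

namespace ModelClasses

variable {C D : Type*} [Category C] [Category D]

/-- The axioms of a model structure. (No limits or colimits are required of `C`.) -/
structure IsModelStructure (𝓜 : ModelClasses C) : Prop where
  two_of_three : 𝓜.weq.HasTwoOutOfThreeProperty
  retract_weq : 𝓜.weq.IsStableUnderRetracts
  retract_cof : 𝓜.cof.IsStableUnderRetracts
  retract_fib : 𝓜.fib.IsStableUnderRetracts
  lift_tcof : ∀ {X Y Z W : C} (i : X ⟶ Y) (p : Z ⟶ W), 𝓜.cof i → 𝓜.weq i → 𝓜.fib p →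
    HasLiftingProperty i p
  lift_tfib : ∀ {X Y Z W : C} (i : X ⟶ Y) (p : Z ⟶ W), 𝓜.cof i → 𝓜.fib p → 𝓜.weq p →
    HasLiftingProperty i p
  factor_tfib : MorphismProperty.HasFactorization 𝓜.cof (𝓜.fib ⊓ 𝓜.weq)
  factor_tcof : MorphismProperty.HasFactorization (𝓜.cof ⊓ 𝓜.weq) 𝓜.fib

/-- `X` is cofibrant: the morphism from the initial object is a cofibration. -/
def IsCofibrant (𝓜 : ModelClasses C) (X : C) : Prop :=
  ∃ (Z : C) (hZ : IsInitial Z), 𝓜.cof (hZ.to X)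

/-- `X` is fibrant: the morphism to the terminal object is a fibration. -/
def IsFibrant (𝓜 : ModelClasses C) (X : C) : Prop :=
  ∃ (Z : C) (hZ : IsTerminal Z), 𝓜.fib (hZ.from X)

/-- The homotopy category: the localization at the weak equivalences. -/
abbrev Ho (𝓜 : ModelClasses C) := 𝓜.weq.Localization

/-- The localization functor `C ⥤ Ho(C)`. -/
abbrev toHo (𝓜 : ModelClasses C) : C ⥤ 𝓜.Ho := 𝓜.weq.Q

/-- An adjunction `F ⊣ H` between categories with model structures is a Quillen adjunction if `F`
preserves cofibrations and trivial cofibrations, and a Quillen equivalence if, moreover, for `X`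
cofibrant and `Y` fibrant, `F X ⟶ Y` is a weak equivalence if and only if its adjunct `X ⟶ H Y`
is one. -/
structure IsQuillenEquivalence (𝓜 : ModelClasses C) (𝓝 : ModelClasses D) {F : C ⥤ D} {H : D ⥤ C}
    (adj : F ⊣ H) : Prop where
  map_cof : ∀ {X Y : C} (f : X ⟶ Y), 𝓜.cof f → 𝓝.cof (F.map f)
  map_tcof : ∀ {X Y : C} (f : X ⟶ Y), 𝓜.cof f → 𝓜.weq f →
    𝓝.cof (F.map f) ∧ 𝓝.weq (F.map f)
  weq_iff : ∀ (X : C) (Y : D), 𝓜.IsCofibrant X → 𝓝.IsFibrant Y →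
    ∀ f : F.obj X ⟶ Y, 𝓝.weq f ↔ 𝓜.weq (adj.homEquiv X Y f)

end ModelClasses

section GorensteinModel

variable (A : Type u) [Ring A]

/-- Monomorphisms of modules whose cokernel has the property `𝒳`. -/
def monoWithCoker (𝒳 : ObjectProperty (FGModuleCat.{u} A)) : MorphismProperty (FGModuleCat.{u} A) :=
  fun _ Y f => ∃ (Z : FGModuleCat.{u} A) (g : Y ⟶ Z), IsShortExact f g ∧ 𝒳 Z

/-- Epimorphisms of modules whose kernel has the property `𝒳`. -/
def epiWithKer (𝒳 : ObjectProperty (FGModuleCat.{u} A)) : MorphismProperty (FGModuleCat.{u} A) :=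
  fun X _ f => ∃ (K : FGModuleCat.{u} A) (g : K ⟶ X), IsShortExact g f ∧ 𝒳 K

/-- The Gorenstein projective model structure on `𝒢𝒫^{<∞}(A)`: cofibrations are the monomorphisms
with Gorenstein projective cokernel, fibrations are the epimorphisms, and weak equivalences are the
composites of a monomorphism with projective cokernel followed by an epimorphism whose kernel has
finite projective dimension. -/
def gpModel : ModelClasses (GPFin A) where
  cof := fun _ _ f => monoWithCoker A (gorensteinProjective A) f.hom
  fib := fun _ _ f => Function.Surjective f.hom.hom.hom
  weq := fun X Y f => ∃ (Z : GPFin A) (i : X ⟶ Z) (p : Z ⟶ Y),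
    monoWithCoker A (fgProjective A) i.hom ∧ epiWithKer A (finiteProjDim A) p.hom ∧ i ≫ p = f

/-- The homotopy category `Ho(𝒢𝒫^{<∞}(A))`. -/
abbrev HoGP := (gpModel A).Ho

end GorensteinModel

/-! ### Triangulated structures -/

/-- A structure of triangulated category on `C` (additive, with a shift, distinguished triangles,
and the octahedral axiom). -/
class TriangulatedStructure (C : Type*) [Category C] where
  preadditive : Preadditive C
  hasZeroObject : HasZeroObject C
  hasShift : HasShift C ℤ
  additive_shift : ∀ n : ℤ, (shiftFunctor C n).Additive
  pretriangulated : Pretriangulated C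
  isTriangulated : IsTriangulated C

attribute [reducible] TriangulatedStructure.preadditive TriangulatedStructure.hasShift
  TriangulatedStructure.pretriangulated

attribute [instance] TriangulatedStructure.preadditive TriangulatedStructure.hasZeroObject
  TriangulatedStructure.hasShift TriangulatedStructure.additive_shift
  TriangulatedStructure.pretriangulated TriangulatedStructure.isTriangulated

section StandardTriangles

variable {A : Type u} [Ring A] {𝓔 : ObjectProperty (FGModuleCat.{u} A)}
  (𝒲 : ObjectProperty (FGModuleCat.{u} A))

/-- A short exact sequence `0 → X → W → S → 0` in `𝓔` with `W` in the class `𝒲` of trivial objects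
and `S` Gorenstein projective; the object `S` is then a model of the suspension of `X`. -/
structure SuspensionSequence (X : 𝓔.FullSubcategory) where
  W : 𝓔.FullSubcategory
  S : 𝓔.FullSubcategory
  j : X ⟶ W
  q : W ⟶ S
  shortExact : IsShortExact j.hom q.hom
  trivial : 𝒲 W.obj
  gorenstein : gorensteinProjective A S.obj

/-- A standard triangle on `u : X ⟶ Y`: the short exact sequence `0 → Y → C → S → 0` obtained from
a suspension sequence `0 → X → W → S → 0` by pushout along `u`. -/
structure StandardTriangle where
  X : 𝓔.FullSubcategory
  Y : 𝓔.FullSubcategory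
  C : 𝓔.FullSubcategory
  susp : SuspensionSequence 𝒲 X
  u : X ⟶ Y
  v : Y ⟶ C
  w : C ⟶ susp.S
  t : susp.W ⟶ C
  shortExact : IsShortExact v.hom w.hom
  comm_left : susp.j ≫ t = u ≫ v
  comm_right : t ≫ w = susp.q

/-- The triangulated structure on `T` is the standard one with respect to an additive functor
`L : 𝓔 ⥤ T` (the projection to the stable category, or to the homotopy category): the shift of `L X`
is `L S` for any suspension sequence `0 → X → W → S → 0`, naturally in the sequence, and the
distinguished triangles are exactly those isomorphic to the image of a standard triangle. -/
structure StandardTriangulation {T : Type*} [Category T] [TriangulatedStructure T]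
    (L : 𝓔.FullSubcategory ⥤ T) where
  additive : L.Additive
  σ : ∀ {X : 𝓔.FullSubcategory} (s : SuspensionSequence 𝒲 X), L.obj s.S ≅ (L.obj X)⟦(1 : ℤ)⟧
  σ_naturality : ∀ {X X' : 𝓔.FullSubcategory} (s : SuspensionSequence 𝒲 X)
    (s' : SuspensionSequence 𝒲 X') (a : X ⟶ X') (b : s.W ⟶ s'.W) (c : s.S ⟶ s'.S),
    s.j ≫ b = a ≫ s'.j → s.q ≫ c = b ≫ s'.q →
      L.map c ≫ (σ s').hom = (σ s).hom ≫ (L.map a)⟦(1 : ℤ)⟧'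
  distinguished_iff : ∀ D : Triangle T, D ∈ distTriang T ↔
    ∃ Δ : StandardTriangle (𝓔 := 𝓔) 𝒲, Nonempty (D ≅
      Triangle.mk (L.map Δ.u) (L.map Δ.v) (L.map Δ.w ≫ (σ Δ.susp).hom))

end StandardTriangles

/-- The equivalence `e` is an equivalence of triangulated categories: it commutes with the shift
and preserves distinguished triangles. -/
def IsTriangleEquivalence {C D : Type*} [Category C] [Category D] [TriangulatedStructure C]
    [TriangulatedStructure D] (e : C ≌ D) : Prop :=
  ∃ _ : e.functor.CommShift ℤ, e.functor.IsTriangulated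

/-! ### Restriction to subcategories -/

section Restrict

variable {C D : Type*} [Category C] [Category D] {P : ObjectProperty C} {Q : ObjectProperty D}

/-- The restriction of a functor to full subcategories which it respects. -/
abbrev restrictFunctor (F : C ⥤ D) (hF : ∀ X, P X → Q (F.obj X)) :
    P.FullSubcategory ⥤ Q.FullSubcategory :=
  Q.lift (P.ι ⋙ F) fun X => hF _ X.property

/-- The restriction of an adjunction to full subcategories which both functors respect. -/
def restrictAdjunction {F : C ⥤ D} {H : D ⥤ C} (adj : F ⊣ H) (hF : ∀ X, P X → Q (F.obj X))
    (hH : ∀ Y, Q Y → P (H.obj Y)) :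
    restrictFunctor (P := P) (Q := Q) F hF ⊣ restrictFunctor (P := Q) (Q := P) H hH :=
  adj.restrictFullyFaithful P.fullyFaithfulι Q.fullyFaithfulι (Iso.refl _) (Iso.refl _)

end Restrict

end

noncomputable section

/-! ### Diagram chases in categories of finitely generated modules -/

section Toolkit

variable {A : Type u} [Ring A]

namespace FGModuleCat

/-! Gorenstein projective modules and modules of finite projective dimension are orthogonal for the
first extension group, and every `X` of finite Gorenstein projective dimension has approximations `0
→ W → G → X → 0` and `0 → X → W → G → 0` with `G` Gorenstein projective and `W` of finite projective
dimension (`exists_approximations`). The precover `G` is unique and functorial up to maps through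
projectives, which gives `GPFin.stableFunctor`. The weak equivalences turn out to be exactly the
morphisms inverted by this functor (`GPFin.weq_iff`). Two out of three and retracts follow at once,
lifting is orthogonality, factorization comes from the approximations, and the homotopy category is
identified with the stable category (`GPFin.stableEquiv`).

The triangulations come from complexes. Taking cycles is an equivalence from totally acyclic
complexes up to homotopy to the stable category: maps of cycles extend to chain maps, and a chain
map is null-homotopic precisely when its map on cycles factors through a projective. Totally acyclic
complexes form a triangulated subcategory of the homotopy category of complexes, and the structure
is carried to `HoGP A` along `TACHo.hoEquiv`. It is the standard one because the cone of a chain map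
yields a standard triangle on cycles, and every standard triangle is weakly equivalent to one of
this kind (`standardTriangulation_of_isTriangulated`).

For the bimodules, a functor with the same left and right adjoint is exact and preserves
projectives, hence also Gorenstein projectives, both kinds of finite dimension, cofibrations and
weak equivalences. Projecting `N ⊗ M ≅ A ⊕ P` to `A` gives a natural epimorphism `N ⊗ M ⊗ X → X`
whose kernel `P ⊗ X` is projective, so a natural weak equivalence. The same holds on the other side,
so the two tensor functors become mutually inverse on homotopy categories, whatever the given
adjunction is. The localized left adjoint being an equivalence, the unit of that adjunction is
inverted too, which is the Quillen equivalence. The triangulation of `HoGP B` is the one carried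
over from `HoGP A`, and it is standard because `N ⊗ -` is exact
(`IsBiadjoint.standardTriangulation`). -/

@[simp] theorem add_apply' {X Y : FGModuleCat.{u} A} (f g : X ⟶ Y) (x : X) :
    (f + g).hom.hom x = f.hom.hom x + g.hom.hom x := rfl
@[simp] theorem sub_apply' {X Y : FGModuleCat.{u} A} (f g : X ⟶ Y) (x : X) :
    (f - g).hom.hom x = f.hom.hom x - g.hom.hom x := rfl
@[simp] theorem neg_apply' {X Y : FGModuleCat.{u} A} (f : X ⟶ Y) (x : X) :
    (-f).hom.hom x = - f.hom.hom x := rfl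
@[simp] theorem zero_apply' {X Y : FGModuleCat.{u} A} (x : X) :
    (0 : X ⟶ Y).hom.hom x = 0 := rfl
theorem comp_app {X Y Z : FGModuleCat.{u} A} (f : X ⟶ Y) (g : Y ⟶ Z) (x : X) :
    (f ≫ g).hom.hom x = g.hom.hom (f.hom.hom x) := rfl

theorem ext' {X Y : FGModuleCat.{u} A} {f g : X ⟶ Y} (h : ∀ x, f.hom.hom x = g.hom.hom x) :
    f = g := hom_ext (LinearMap.ext h)

theorem congr_apply {X Y : FGModuleCat.{u} A} {f g : X ⟶ Y} (h : f = g) (x : X) :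
    f.hom.hom x = g.hom.hom x := by rw [h]

/-- The morphism of `FGModuleCat A` given by a linear map. -/
def mkHom {X Y : FGModuleCat.{u} A} (f : X →ₗ[A] Y) : X ⟶ Y := ⟨ModuleCat.ofHom f⟩

@[simp] theorem mkHom_apply {X Y : FGModuleCat.{u} A} (f : X →ₗ[A] Y) (x : X) :
    (mkHom f).hom.hom x = f x := rfl

theorem exists_desc {X Y Z : FGModuleCat.{u} A} (q : X ⟶ Y)
    (hq : Function.Surjective q.hom.hom) (h : X ⟶ Z)
    (hh : ∀ x, q.hom.hom x = 0 → h.hom.hom x = 0) : ∃ h' : Y ⟶ Z, q ≫ h' = h := by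
  have hk : LinearMap.ker q.hom.hom ≤ LinearMap.ker h.hom.hom := fun x hx => hh x hx
  refine ⟨mkHom ((Submodule.liftQ _ h.hom.hom hk).comp
    (q.hom.hom.quotKerEquivOfSurjective hq).symm.toLinearMap), ext' fun x => ?_⟩
  have : (q.hom.hom.quotKerEquivOfSurjective hq).symm (q.hom.hom x) =
      Submodule.Quotient.mk x := by
    rw [LinearEquiv.symm_apply_eq]; rfl
  rw [comp_app, mkHom_apply, LinearMap.comp_apply]
  exact (congrArg _ this).trans rfl

theorem exists_lift {X Y Z : FGModuleCat.{u} A} (i : X ⟶ Y)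
    (hi : Function.Injective i.hom.hom) (h : Z ⟶ Y)
    (hh : ∀ z, ∃ x, i.hom.hom x = h.hom.hom z) : ∃ h' : Z ⟶ X, h' ≫ i = h := by
  let e := LinearEquiv.ofInjective i.hom.hom hi
  refine ⟨mkHom (e.symm.toLinearMap.comp
    (LinearMap.codRestrict (LinearMap.range i.hom.hom) h.hom.hom fun z => hh z)),
    ext' fun z => ?_⟩
  have : ∀ y, i.hom.hom (e.symm y) = y.1 := fun y =>
    congrArg Subtype.val (e.apply_symm_apply y)
  exact this _

theorem epi_cancel {X Y Z : FGModuleCat.{u} A} {q : X ⟶ Y}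
    (hq : Function.Surjective q.hom.hom) {f g : Y ⟶ Z} (h : q ≫ f = q ≫ g) : f = g :=
  ext' fun y => by obtain ⟨x, rfl⟩ := hq y; exact congr_apply h x

theorem mono_cancel {X Y Z : FGModuleCat.{u} A} {i : Y ⟶ Z}
    (hi : Function.Injective i.hom.hom) {f g : X ⟶ Y} (h : f ≫ i = g ≫ i) : f = g :=
  ext' fun x => hi (congr_apply h x)

/-- The direct sum of two finitely generated modules. -/
def sum (X Y : FGModuleCat.{u} A) : FGModuleCat.{u} A := of A (X × Y)

/-- The first inclusion. -/
def inl (X Y : FGModuleCat.{u} A) : X ⟶ sum X Y := mkHom (Y := of A (X × Y)) (LinearMap.inl A X Y)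
/-- The second inclusion. -/
def inr (X Y : FGModuleCat.{u} A) : Y ⟶ sum X Y := mkHom (Y := of A (X × Y)) (LinearMap.inr A X Y)
/-- The first projection. -/
def fst (X Y : FGModuleCat.{u} A) : sum X Y ⟶ X := mkHom (X := of A (X × Y)) (LinearMap.fst A X Y)
/-- The second projection. -/
def snd (X Y : FGModuleCat.{u} A) : sum X Y ⟶ Y := mkHom (X := of A (X × Y)) (LinearMap.snd A X Y)
/-- The morphism from a direct sum. -/
def desc {X Y Z : FGModuleCat.{u} A} (f : X ⟶ Z) (g : Y ⟶ Z) : sum X Y ⟶ Z :=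
  fst X Y ≫ f + snd X Y ≫ g
/-- The morphism to a direct sum. -/
def lift {X Y Z : FGModuleCat.{u} A} (f : Z ⟶ X) (g : Z ⟶ Y) : Z ⟶ sum X Y :=
  f ≫ inl X Y + g ≫ inr X Y

section
variable {X Y Z : FGModuleCat.{u} A}
@[simp] theorem inl_fst : inl X Y ≫ fst X Y = 𝟙 X := rfl
@[simp] theorem inr_snd : inr X Y ≫ snd X Y = 𝟙 Y := rfl
@[simp] theorem inl_snd : inl X Y ≫ snd X Y = 0 := rfl
@[simp] theorem inr_fst : inr X Y ≫ fst X Y = 0 := rfl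
@[simp] theorem fst_inl_app (x : X) : (fst X Y).hom.hom ((inl X Y).hom.hom x) = x := rfl
@[simp] theorem snd_inl_app (x : X) : (snd X Y).hom.hom ((inl X Y).hom.hom x) = 0 := rfl
@[simp] theorem fst_inr_app (y : Y) : (fst X Y).hom.hom ((inr X Y).hom.hom y) = 0 := rfl
@[simp] theorem snd_inr_app (y : Y) : (snd X Y).hom.hom ((inr X Y).hom.hom y) = y := rfl
@[simp] theorem inl_desc (f : X ⟶ Z) (g : Y ⟶ Z) : inl X Y ≫ desc f g = f := by
  simp [desc, ← Category.assoc]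
@[simp] theorem inr_desc (f : X ⟶ Z) (g : Y ⟶ Z) : inr X Y ≫ desc f g = g := by
  simp [desc, ← Category.assoc]
@[simp] theorem lift_fst (f : Z ⟶ X) (g : Z ⟶ Y) : lift f g ≫ fst X Y = f := by
  simp [lift]
@[simp] theorem lift_snd (f : Z ⟶ X) (g : Z ⟶ Y) : lift f g ≫ snd X Y = g := by
  simp [lift]
theorem desc_app (f : X ⟶ Z) (g : Y ⟶ Z) (x : sum X Y) : (desc f g).hom.hom x =
    f.hom.hom ((fst X Y).hom.hom x) + g.hom.hom ((snd X Y).hom.hom x) := rfl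
@[simp] theorem fst_lift_app (f : Z ⟶ X) (g : Z ⟶ Y) (x : Z) :
    (fst X Y).hom.hom ((lift f g).hom.hom x) = f.hom.hom x := congr_apply (lift_fst f g) x
@[simp] theorem snd_lift_app (f : Z ⟶ X) (g : Z ⟶ Y) (x : Z) :
    (snd X Y).hom.hom ((lift f g).hom.hom x) = g.hom.hom x := congr_apply (lift_snd f g) x
theorem sum_ext {x y : sum X Y} (h₁ : (fst X Y).hom.hom x = (fst X Y).hom.hom y)
    (h₂ : (snd X Y).hom.hom x = (snd X Y).hom.hom y) : x = y := Prod.ext h₁ h₂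
theorem hom_sum_ext {f g : Z ⟶ sum X Y} (h₁ : f ≫ fst X Y = g ≫ fst X Y)
    (h₂ : f ≫ snd X Y = g ≫ snd X Y) : f = g :=
  ext' fun z => sum_ext (congr_apply h₁ z) (congr_apply h₂ z)
theorem sum_eq (x : sum X Y) : x = (inl X Y).hom.hom ((fst X Y).hom.hom x) +
    (inr X Y).hom.hom ((snd X Y).hom.hom x) :=
  sum_ext (by rw [map_add]; simp) (by rw [map_add]; simp)
theorem sum_hom_ext {f g : sum X Y ⟶ Z} (h₁ : inl X Y ≫ f = inl X Y ≫ g)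
    (h₂ : inr X Y ≫ f = inr X Y ≫ g) : f = g :=
  ext' fun z => by
    have e₁ := congr_apply h₁ ((fst X Y).hom.hom z)
    have e₂ := congr_apply h₂ ((snd X Y).hom.hom z)
    rw [comp_app, comp_app] at e₁ e₂
    rw [sum_eq z, map_add, map_add, e₁, e₂]
end

theorem isShortExact_sum (X Y : FGModuleCat.{u} A) : IsShortExact (inl X Y) (snd X Y) where
  injective := Function.LeftInverse.injective (g := (fst X Y).hom.hom) fun x => rfl
  exact x := ⟨fun h => ⟨(fst X Y).hom.hom x, sum_ext rfl h.symm⟩, by rintro ⟨y, rfl⟩; rfl⟩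
  surjective y := ⟨(inr X Y).hom.hom y, rfl⟩

theorem isShortExact_sum' (X Y : FGModuleCat.{u} A) : IsShortExact (inr X Y) (fst X Y) where
  injective := Function.LeftInverse.injective (g := (snd X Y).hom.hom) fun x => rfl
  exact x := ⟨fun h => ⟨(snd X Y).hom.hom x, sum_ext h.symm rfl⟩, by rintro ⟨y, rfl⟩; rfl⟩
  surjective y := ⟨(inl X Y).hom.hom y, rfl⟩

theorem exists_cokernel {X Y : FGModuleCat.{u} A} (f : X ⟶ Y)
    (hf : Function.Injective f.hom.hom) : ∃ (Z : FGModuleCat.{u} A) (g : Y ⟶ Z),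
    IsShortExact f g :=
  ⟨of A (Y ⧸ LinearMap.range f.hom.hom), mkHom (Submodule.mkQ _), hf,
    LinearMap.exact_iff.2 (Submodule.ker_mkQ _), Submodule.mkQ_surjective _⟩

/-- Noetherianity enters here: it keeps the kernel finitely generated. -/
theorem exists_kernel [IsNoetherianRing A] {X Y : FGModuleCat.{u} A} (f : X ⟶ Y)
    (hf : Function.Surjective f.hom.hom) : ∃ (Z : FGModuleCat.{u} A) (g : Z ⟶ X),
    IsShortExact g f :=
  ⟨of A (LinearMap.ker f.hom.hom), mkHom (Submodule.subtype _), Subtype.val_injective,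
    LinearMap.exact_iff.2 (Submodule.range_subtype _).symm, hf⟩

/-- The zero module. -/
abbrev zeroObj (A : Type u) [Ring A] : FGModuleCat.{u} A := of A PUnit

theorem isShortExact_id_zero (X : FGModuleCat.{u} A) :
    IsShortExact (𝟙 X) (0 : X ⟶ zeroObj A) where
  injective _ _ h := h
  exact x := ⟨fun _ => ⟨x, rfl⟩, fun _ => rfl⟩
  surjective y := ⟨0, rfl⟩

theorem isShortExact_zero_id (X : FGModuleCat.{u} A) :
    IsShortExact (0 : zeroObj A ⟶ X) (𝟙 X) where
  injective _ _ _ := rfl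
  exact x := ⟨fun h => ⟨0, h.symm⟩, by rintro ⟨y, rfl⟩; rfl⟩
  surjective y := ⟨y, rfl⟩

end FGModuleCat

open FGModuleCat

/-! ### Short exact sequences: kernels, cokernels, pushouts and pullbacks. -/

namespace IsShortExact

variable {X Y Z : FGModuleCat.{u} A} {f : X ⟶ Y} {g : Y ⟶ Z}

theorem comp_zero (h : IsShortExact f g) : f ≫ g = 0 :=
  ext' fun x => (h.exact _).2 ⟨x, rfl⟩

theorem apply_apply (h : IsShortExact f g) (x : X) : g.hom.hom (f.hom.hom x) = 0 :=
  (h.exact _).2 ⟨x, rfl⟩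

theorem exists_of_zero (h : IsShortExact f g) {y : Y} (hy : g.hom.hom y = 0) :
    ∃ x, f.hom.hom x = y := (h.exact _).1 hy

theorem exists_lift (h : IsShortExact f g) {T : FGModuleCat.{u} A} (t : T ⟶ Y)
    (ht : t ≫ g = 0) : ∃ t' : T ⟶ X, t' ≫ f = t :=
  FGModuleCat.exists_lift f h.injective t fun z => h.exists_of_zero (congr_apply ht z)

theorem exists_desc (h : IsShortExact f g) {T : FGModuleCat.{u} A} (t : Y ⟶ T)
    (ht : f ≫ t = 0) : ∃ t' : Z ⟶ T, g ≫ t' = t :=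
  FGModuleCat.exists_desc g h.surjective t fun y hy => by
    obtain ⟨x, rfl⟩ := h.exists_of_zero hy
    exact congr_apply ht x

theorem of_iso_left (h : IsShortExact f g) {X' : FGModuleCat.{u} A} (e : X' ≅ X) :
    IsShortExact (e.hom ≫ f) g where
  injective := h.injective.comp fun x y hxy => by
    have := congrArg e.inv.hom.hom hxy
    have e' := congr_apply e.hom_inv_id
    exact (e' x).symm.trans (this.trans (e' y))
  exact y := by
    rw [h.exact y]
    constructor
    · rintro ⟨x, rfl⟩
      refine ⟨e.inv.hom.hom x, ?_⟩
      rw [← comp_app, e.inv_hom_id_assoc]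
    · rintro ⟨x, rfl⟩; exact ⟨e.hom.hom.hom x, rfl⟩
  surjective := h.surjective

/-- A split short exact sequence: a section of the epimorphism gives a retraction. -/
theorem exists_retraction (h : IsShortExact f g) (s : Z ⟶ Y) (hs : s ≫ g = 𝟙 Z) :
    ∃ r : Y ⟶ X, f ≫ r = 𝟙 X ∧ r ≫ f = 𝟙 Y - g ≫ s := by
  obtain ⟨r, hr⟩ := h.exists_lift (𝟙 Y - g ≫ s) (by simp [hs])
  refine ⟨r, mono_cancel h.injective ?_, hr⟩
  rw [Category.assoc, hr]
  simp [reassoc_of% h.comp_zero]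

/-- The kernel of an epimorphism of short exact sequences. -/
theorem kernels {X' Y' Z' K₁ K₂ K₃ : FGModuleCat.{u} A} {f' : X' ⟶ Y'} {g' : Y' ⟶ Z'}
    (h : IsShortExact f g) (h' : IsShortExact f' g') {a : X ⟶ X'} {b : Y ⟶ Y'} {c : Z ⟶ Z'}
    (h₁ : f ≫ b = a ≫ f') (h₂ : g ≫ c = b ≫ g') {k₁ : K₁ ⟶ X} {k₂ : K₂ ⟶ Y} {k₃ : K₃ ⟶ Z}
    (ha : IsShortExact k₁ a) (hb : IsShortExact k₂ b) (hc : IsShortExact k₃ c) :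
    ∃ (i : K₁ ⟶ K₂) (p : K₂ ⟶ K₃), IsShortExact i p ∧ i ≫ k₂ = k₁ ≫ f ∧ p ≫ k₃ = k₂ ≫ g := by
  obtain ⟨i, hi⟩ := hb.exists_lift (k₁ ≫ f) (by
    rw [Category.assoc, h₁, reassoc_of% ha.comp_zero, zero_comp])
  obtain ⟨p, hp⟩ := hc.exists_lift (k₂ ≫ g) (by
    rw [Category.assoc, h₂, reassoc_of% hb.comp_zero, zero_comp])
  refine ⟨i, p, ⟨fun x y hxy => ?_, fun y => ⟨fun hy => ?_, ?_⟩, fun z => ?_⟩, hi, hp⟩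
  · refine ha.injective (h.injective ?_)
    have e := congrArg k₂.hom.hom hxy
    rwa [← comp_app, ← comp_app, hi] at e
  · have e : g.hom.hom (k₂.hom.hom y) = 0 := by
      rw [← comp_app, ← hp, comp_app, hy, map_zero]
    obtain ⟨x, hx⟩ := h.exists_of_zero e
    have : a.hom.hom x = 0 := h'.injective (by
      rw [← comp_app, ← h₁, comp_app, hx, map_zero, hb.apply_apply])
    obtain ⟨w, rfl⟩ := ha.exists_of_zero this
    refine ⟨w, hb.injective ?_⟩
    rw [← comp_app, hi, comp_app, hx]
  · rintro ⟨x, rfl⟩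
    refine hc.injective ?_
    rw [map_zero, ← comp_app, hp, comp_app, ← comp_app i, hi, comp_app, h.apply_apply]
  · obtain ⟨y, hy⟩ := h.surjective (k₃.hom.hom z)
    have e : g'.hom.hom (b.hom.hom y) = 0 := by
      rw [← comp_app, ← h₂, comp_app, hy, hc.apply_apply]
    obtain ⟨x', hx'⟩ := h'.exists_of_zero e
    obtain ⟨x, rfl⟩ := ha.surjective x'
    have e2 : b.hom.hom (y - f.hom.hom x) = 0 := by
      rw [map_sub, ← hx', ← comp_app, ← comp_app, h₁, sub_self]
    obtain ⟨w, hw⟩ := hb.exists_of_zero e2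
    refine ⟨w, hc.injective ?_⟩
    rw [← comp_app, hp, comp_app, hw, map_sub, hy, h.apply_apply, sub_zero]

/-- The cokernel of a monomorphism of short exact sequences. -/
theorem cokernels {X' Y' Z' C₁ C₂ C₃ : FGModuleCat.{u} A} {f' : X' ⟶ Y'} {g' : Y' ⟶ Z'}
    (h : IsShortExact f g) (h' : IsShortExact f' g') {a : X ⟶ X'} {b : Y ⟶ Y'} {c : Z ⟶ Z'}
    (h₁ : f ≫ b = a ≫ f') (h₂ : g ≫ c = b ≫ g') {k₁ : X' ⟶ C₁} {k₂ : Y' ⟶ C₂} {k₃ : Z' ⟶ C₃}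
    (ha : IsShortExact a k₁) (hb : IsShortExact b k₂) (hc : IsShortExact c k₃) :
    ∃ (i : C₁ ⟶ C₂) (p : C₂ ⟶ C₃), IsShortExact i p ∧ k₁ ≫ i = f' ≫ k₂ ∧ k₂ ≫ p = g' ≫ k₃ := by
  obtain ⟨i, hi⟩ := ha.exists_desc (f' ≫ k₂) (by
    rw [← Category.assoc, ← h₁, Category.assoc, hb.comp_zero, CategoryTheory.Limits.comp_zero])
  obtain ⟨p, hp⟩ := hb.exists_desc (g' ≫ k₃) (by
    rw [← Category.assoc, ← h₂, Category.assoc, hc.comp_zero, CategoryTheory.Limits.comp_zero])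
  refine ⟨i, p, ⟨?_, fun y => ⟨fun hy => ?_, ?_⟩, fun z => ?_⟩, hi, hp⟩
  · rw [injective_iff_map_eq_zero]
    intro x hx
    obtain ⟨x', rfl⟩ := ha.surjective x
    have e : k₂.hom.hom (f'.hom.hom x') = 0 := by rw [← comp_app, ← hi]; exact hx
    obtain ⟨y, hy⟩ := hb.exists_of_zero e
    have e2 : c.hom.hom (g.hom.hom y) = 0 := by
      rw [← comp_app, h₂, comp_app, hy, h'.apply_apply]
    obtain ⟨w, rfl⟩ := h.exists_of_zero (hc.injective (e2.trans (map_zero _).symm))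
    have : a.hom.hom w = x' := h'.injective (by rw [← hy, ← comp_app, ← comp_app, h₁])
    rw [← this, ha.apply_apply]
  · obtain ⟨y', rfl⟩ := hb.surjective y
    have e : k₃.hom.hom (g'.hom.hom y') = 0 := by rw [← comp_app, ← hp]; exact hy
    obtain ⟨z, hz⟩ := hc.exists_of_zero e
    obtain ⟨y, rfl⟩ := h.surjective z
    have e2 : g'.hom.hom (y' - b.hom.hom y) = 0 := by
      rw [map_sub, ← hz, ← comp_app, ← comp_app, h₂, sub_self]
    obtain ⟨x', hx'⟩ := h'.exists_of_zero e2
    refine ⟨k₁.hom.hom x', ?_⟩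
    rw [← comp_app, hi, comp_app, hx', map_sub, hb.apply_apply, sub_zero]
  · rintro ⟨x, rfl⟩
    obtain ⟨x', rfl⟩ := ha.surjective x
    rw [← comp_app, ← comp_app, reassoc_of% hi, hp, reassoc_of% h'.comp_zero]
    simp
  · obtain ⟨z', rfl⟩ := hc.surjective z
    obtain ⟨y', rfl⟩ := h'.surjective z'
    exact ⟨k₂.hom.hom y', by rw [← comp_app, hp]; rfl⟩

/-- The pushout of a short exact sequence. -/
theorem exists_pushout (h : IsShortExact f g) {X' : FGModuleCat.{u} A} (u : X ⟶ X') :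
    ∃ (Y' : FGModuleCat.{u} A) (f' : X' ⟶ Y') (g' : Y' ⟶ Z) (u' : Y ⟶ Y'),
      IsShortExact f' g' ∧ f ≫ u' = u ≫ f' ∧ u' ≫ g' = g ∧
      IsShortExact (FGModuleCat.lift f (-u)) (FGModuleCat.desc u' f') := by
  -- The pushout is the cokernel of `(f, -u) : X ⟶ Y ⊕ X'`. This presentation is returned as a
  -- fourth exact sequence, because maps out of the pushout are built from it later.
  have hinj : Function.Injective (FGModuleCat.lift f (-u)).hom.hom := fun x y hxy =>
    h.injective (by simpa using congrArg (FGModuleCat.fst Y X').hom.hom hxy)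
  obtain ⟨Y', q, hq⟩ := exists_cokernel _ hinj
  obtain ⟨g', hg'⟩ := hq.exists_desc (FGModuleCat.fst _ _ ≫ g)
    (by rw [← Category.assoc, lift_fst, h.comp_zero])
  have hq' : FGModuleCat.desc (FGModuleCat.inl _ _ ≫ q) (FGModuleCat.inr _ _ ≫ q) = q :=
    sum_hom_ext (by simp) (by simp)
  refine ⟨Y', FGModuleCat.inr _ _ ≫ q, g', FGModuleCat.inl _ _ ≫ q,
    ⟨?_, fun y => ⟨fun hy => ?_, ?_⟩, fun z => ?_⟩, ?_, ?_, by rwa [hq']⟩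
  · rw [injective_iff_map_eq_zero]
    intro x hx
    obtain ⟨w, hw⟩ := hq.exists_of_zero (show q.hom.hom ((FGModuleCat.inr Y X').hom.hom x) = 0 from hx)
    have h1 : w = 0 := h.injective
      (by simpa using congrArg (FGModuleCat.fst Y X').hom.hom hw)
    have h2 := congrArg (FGModuleCat.snd Y X').hom.hom hw
    simpa [h1] using h2.symm
  · obtain ⟨y, rfl⟩ := hq.surjective y
    have e : g.hom.hom ((FGModuleCat.fst Y X').hom.hom y) = 0 := (congr_apply hg' y).symm.trans hy
    obtain ⟨w, hw⟩ := h.exists_of_zero e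
    refine ⟨(FGModuleCat.snd Y X').hom.hom y + u.hom.hom w, ?_⟩
    rw [comp_app, ← sub_eq_zero, ← map_sub]
    rw [← hq.apply_apply (-w)]
    congr 1
    refine sum_ext ?_ ?_
    · rw [map_sub, map_neg, map_neg, ← hw]; simp
    · rw [map_sub, map_neg, map_neg]; simp
  · rintro ⟨x, rfl⟩
    rw [comp_app, ← comp_app, hg']
    simp [comp_app]
  · obtain ⟨y, rfl⟩ := h.surjective z
    exact ⟨q.hom.hom ((FGModuleCat.inl Y X').hom.hom y), congr_apply hg' _⟩
  · have := hq.comp_zero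
    rw [FGModuleCat.lift, Preadditive.add_comp, Preadditive.neg_comp, Category.assoc,
      Preadditive.neg_comp, Category.assoc] at this
    exact eq_of_sub_eq_zero (by rw [sub_eq_add_neg]; exact this)
  · rw [Category.assoc, hg', ← Category.assoc, inl_fst, Category.id_comp]

/-- The pullback of a short exact sequence. -/
theorem exists_pullback [IsNoetherianRing A] (h : IsShortExact f g) {Z' : FGModuleCat.{u} A}
    (u : Z' ⟶ Z) :
    ∃ (Y' : FGModuleCat.{u} A) (f' : X ⟶ Y') (g' : Y' ⟶ Z') (u' : Y' ⟶ Y),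
      IsShortExact f' g' ∧ f' ≫ u' = f ∧ u' ≫ g = g' ≫ u ∧
      IsShortExact (FGModuleCat.lift u' g') (FGModuleCat.desc g (-u)) := by
  have hsurj : Function.Surjective (FGModuleCat.desc g (-u)).hom.hom := fun z => by
    obtain ⟨y, rfl⟩ := h.surjective z
    exact ⟨(FGModuleCat.inl Y Z').hom.hom y, by simp [desc_app]⟩
  obtain ⟨Y', k, hk⟩ := exists_kernel _ hsurj
  obtain ⟨f', hf'⟩ := hk.exists_lift (f ≫ FGModuleCat.inl _ _)
    (by rw [Category.assoc, inl_desc, h.comp_zero])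
  have hk' : FGModuleCat.lift (k ≫ FGModuleCat.fst _ _) (k ≫ FGModuleCat.snd _ _) = k :=
    hom_sum_ext (by simp) (by simp)
  refine ⟨Y', f', k ≫ FGModuleCat.snd _ _, k ≫ FGModuleCat.fst _ _,
    ⟨?_, fun y => ⟨fun hy => ?_, ?_⟩, fun z => ?_⟩, ?_, ?_, by rwa [hk']⟩
  · intro x y hxy
    have := congrArg (k ≫ FGModuleCat.fst Y Z').hom.hom hxy
    rw [← comp_app, ← comp_app, reassoc_of% hf', inl_fst] at this
    exact h.injective this
  · have e := hk.apply_apply y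
    rw [comp_app] at hy
    rw [desc_app, hy, map_zero, add_zero] at e
    obtain ⟨x, hx⟩ := h.exists_of_zero e
    refine ⟨x, hk.injective ?_⟩
    rw [← comp_app, hf']
    refine sum_ext ?_ ?_
    · rw [comp_app, fst_inl_app, hx]
    · rw [comp_app, snd_inl_app, hy]
  · rintro ⟨x, rfl⟩
    rw [← comp_app, reassoc_of% hf', inl_snd]
    simp
  · obtain ⟨y, hy⟩ := h.surjective (u.hom.hom z)
    obtain ⟨w, hw⟩ := hk.exists_of_zero
      (y := (FGModuleCat.inl Y Z').hom.hom y + (FGModuleCat.inr Y Z').hom.hom z)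
      (by rw [desc_app, map_add, map_add]; simp [hy])
    exact ⟨w, by rw [comp_app, hw, map_add]; simp⟩
  · rw [reassoc_of% hf']; simp
  · refine ext' fun y => ?_
    have e := hk.apply_apply y
    simp only [desc_app, neg_apply'] at e
    simp only [comp_app]
    exact eq_of_sub_eq_zero (by rw [sub_eq_add_neg]; exact e)

/-- The pushout of two short exact sequences with the same first term. -/
theorem exists_pushout_mono (h : IsShortExact f g) {X' Z' : FGModuleCat.{u} A} {u : X ⟶ X'}
    {v : X' ⟶ Z'} (h' : IsShortExact u v) :
    ∃ (Y' : FGModuleCat.{u} A) (f' : X' ⟶ Y') (g' : Y' ⟶ Z) (u' : Y ⟶ Y') (v' : Y' ⟶ Z'),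
      IsShortExact f' g' ∧ IsShortExact u' v' ∧ f ≫ u' = u ≫ f' ∧ u' ≫ g' = g := by
  obtain ⟨Y', f', g', u', h₁, h₂, h₃, h₄⟩ := h.exists_pushout u
  obtain ⟨v', hv'⟩ := h₄.exists_desc (FGModuleCat.snd Y X' ≫ v) (by
    rw [← Category.assoc, lift_snd, Preadditive.neg_comp, h'.comp_zero, neg_zero])
  have e₁ : u' ≫ v' = 0 := by
    have := congrArg (FGModuleCat.inl Y X' ≫ ·) hv'
    simpa only [← Category.assoc, inl_desc, inl_snd, zero_comp] using this
  have e₂ : f' ≫ v' = v := by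
    have := congrArg (FGModuleCat.inr Y X' ≫ ·) hv'
    simpa only [← Category.assoc, inr_desc, inr_snd, Category.id_comp] using this
  refine ⟨Y', f', g', u', v', h₁, ⟨?_, fun y => ⟨fun hy => ?_, ?_⟩, fun z => ?_⟩, h₂, h₃⟩
  · rw [injective_iff_map_eq_zero]
    intro y hy
    obtain ⟨x, hx⟩ := h₄.exists_of_zero (y := (FGModuleCat.inl Y X').hom.hom y)
      (by rw [desc_app]; simp [hy])
    have e₃ := congrArg (FGModuleCat.snd Y X').hom.hom hx
    have e₄ := congrArg (FGModuleCat.fst Y X').hom.hom hx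
    rw [snd_lift_app, snd_inl_app, neg_apply', neg_eq_zero] at e₃
    rw [fst_lift_app, fst_inl_app, h'.injective (e₃.trans (map_zero _).symm), map_zero] at e₄
    exact e₄.symm
  · obtain ⟨w, rfl⟩ := h₄.surjective y
    rw [desc_app, map_add, ← comp_app u', ← comp_app f', e₁, e₂, zero_apply', zero_add] at hy
    obtain ⟨x, hx⟩ := h'.exists_of_zero hy
    refine ⟨(FGModuleCat.fst Y X').hom.hom w + f.hom.hom x, ?_⟩
    rw [map_add, desc_app, ← comp_app f, h₂, comp_app, hx]
  · rintro ⟨y, rfl⟩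
    exact congr_apply e₁ y
  · obtain ⟨x, rfl⟩ := h'.surjective z
    exact ⟨f'.hom.hom x, congr_apply e₂ x⟩

/-- The pushout of a short exact sequence along an epimorphism. -/
theorem exists_pushout_epi (h : IsShortExact f g) {K X' : FGModuleCat.{u} A} {k : K ⟶ X}
    {u : X ⟶ X'} (h' : IsShortExact k u) :
    ∃ (Y' : FGModuleCat.{u} A) (f' : X' ⟶ Y') (g' : Y' ⟶ Z) (u' : Y ⟶ Y'),
      IsShortExact f' g' ∧ IsShortExact (k ≫ f) u' ∧ f ≫ u' = u ≫ f' ∧ u' ≫ g' = g := by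
  obtain ⟨Y', f', g', u', h₁, h₂, h₃, h₄⟩ := h.exists_pushout u
  refine ⟨Y', f', g', u', h₁, ⟨?_, fun y => ⟨fun hy => ?_, ?_⟩, fun z => ?_⟩, h₂, h₃⟩
  · exact fun x y hxy => h'.injective (h.injective hxy)
  · obtain ⟨x, hx⟩ := h₄.exists_of_zero (y := (FGModuleCat.inl Y X').hom.hom y)
      (by rw [desc_app]; simp [hy])
    have e₃ := congrArg (FGModuleCat.snd Y X').hom.hom hx
    have e₄ := congrArg (FGModuleCat.fst Y X').hom.hom hx
    rw [snd_lift_app, snd_inl_app, neg_apply', neg_eq_zero] at e₃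
    rw [fst_lift_app, fst_inl_app] at e₄
    obtain ⟨w, rfl⟩ := h'.exists_of_zero e₃
    exact ⟨w, e₄⟩
  · rintro ⟨x, rfl⟩
    rw [comp_app, ← comp_app f, h₂, comp_app, h'.apply_apply, map_zero]
  · obtain ⟨w, rfl⟩ := h₄.surjective z
    obtain ⟨x, hx⟩ := h'.surjective ((FGModuleCat.snd Y X').hom.hom w)
    refine ⟨(FGModuleCat.fst Y X').hom.hom w + f.hom.hom x, ?_⟩
    rw [map_add, desc_app, ← comp_app f, h₂, comp_app, hx]

/-- The pullback of two short exact sequences with the same last term. -/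
theorem exists_pullback_epi [IsNoetherianRing A] (h : IsShortExact f g)
    {K Z' : FGModuleCat.{u} A} {k : K ⟶ Z'} {u : Z' ⟶ Z} (h' : IsShortExact k u) :
    ∃ (Y' : FGModuleCat.{u} A) (f' : X ⟶ Y') (g' : Y' ⟶ Z') (k' : K ⟶ Y') (u' : Y' ⟶ Y),
      IsShortExact f' g' ∧ IsShortExact k' u' ∧ f' ≫ u' = f ∧ u' ≫ g = g' ≫ u := by
  obtain ⟨Y', f', g', u', h₁, h₂, h₃, h₄⟩ := h.exists_pullback u
  obtain ⟨k', hk'⟩ := h₄.exists_lift (k ≫ FGModuleCat.inr Y Z') (by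
    rw [Category.assoc, inr_desc, Preadditive.comp_neg, h'.comp_zero, neg_zero])
  have e₁ : k' ≫ u' = 0 := by simpa using congrArg (· ≫ FGModuleCat.fst Y Z') hk'
  have e₂ : k' ≫ g' = k := by simpa using congrArg (· ≫ FGModuleCat.snd Y Z') hk'
  refine ⟨Y', f', g', k', u', h₁, ⟨fun x y hxy => ?_, fun y => ⟨fun hy => ?_, ?_⟩, fun y => ?_⟩,
    h₂, h₃⟩
  · refine h'.injective ?_
    rw [← e₂, comp_app, comp_app, hxy]
  · have e₃ : u.hom.hom (g'.hom.hom y) = 0 := by rw [← comp_app, ← h₃, comp_app, hy, map_zero]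
    obtain ⟨x, hx⟩ := h'.exists_of_zero e₃
    refine ⟨x, h₄.injective (sum_ext ?_ ?_)⟩
    · rw [fst_lift_app, fst_lift_app, hy]; exact congr_apply e₁ x
    · rw [snd_lift_app, snd_lift_app, ← hx]; exact congr_apply e₂ x
  · rintro ⟨x, rfl⟩; exact congr_apply e₁ x
  · obtain ⟨w, hw⟩ := h'.surjective (g.hom.hom y)
    obtain ⟨e, he⟩ := h₄.exists_of_zero
      (y := (FGModuleCat.inl Y Z').hom.hom y + (FGModuleCat.inr Y Z').hom.hom w)
      (by rw [desc_app, map_add, map_add]; simp [hw])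
    have := congrArg (FGModuleCat.fst Y Z').hom.hom he
    rw [map_add] at this
    exact ⟨e, by simpa using this⟩

/-- The pullback of a short exact sequence along a monomorphism. -/
theorem exists_pullback_mono [IsNoetherianRing A] (h : IsShortExact f g)
    {Z' C : FGModuleCat.{u} A} {i : Z' ⟶ Z} {p : Z ⟶ C} (h' : IsShortExact i p) :
    ∃ (Y' : FGModuleCat.{u} A) (f' : X ⟶ Y') (g' : Y' ⟶ Z') (i' : Y' ⟶ Y),
      IsShortExact f' g' ∧ IsShortExact i' (g ≫ p) ∧ f' ≫ i' = f ∧ g' ≫ i = i' ≫ g := by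
  -- Along a monomorphism the pullback is the kernel of `g ≫ p`, which makes the second exact
  -- sequence hold by construction.
  obtain ⟨Y₁, k, hk⟩ := exists_kernel (g ≫ p) (h'.surjective.comp h.surjective)
  obtain ⟨f', hf'⟩ := hk.exists_lift f (by rw [reassoc_of% h.comp_zero, zero_comp])
  obtain ⟨g', hg'⟩ := h'.exists_lift (k ≫ g) (by rw [Category.assoc, hk.comp_zero])
  refine ⟨Y₁, f', g', k, ⟨fun x y hxy => h.injective ?_, fun y => ⟨fun hy => ?_, ?_⟩,
    fun z => ?_⟩, hk, hf', hg'⟩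
  · rw [← hf', comp_app, comp_app, hxy]
  · have e : g.hom.hom (k.hom.hom y) = 0 := by
      rw [← comp_app, ← hg', comp_app, hy, map_zero]
    obtain ⟨x, hx⟩ := h.exists_of_zero e
    exact ⟨x, hk.injective (by rw [← comp_app, hf', hx])⟩
  · rintro ⟨x, rfl⟩
    refine h'.injective ?_
    rw [← comp_app, hg', comp_app, ← comp_app f', hf', h.apply_apply, map_zero]
  · obtain ⟨y, hy⟩ := h.surjective (i.hom.hom z)
    obtain ⟨w, hw⟩ := hk.exists_of_zero (y := y) (by
      rw [comp_app, hy, h'.apply_apply])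
    exact ⟨w, h'.injective (by rw [← comp_app, hg', comp_app, hw, hy])⟩

end IsShortExact

/-! ### Finitely generated projective modules -/

theorem fgProjective.exists_lift {P X Y : FGModuleCat.{u} A} (hP : fgProjective A P)
    (f : P ⟶ Y) (g : X ⟶ Y) (hg : Function.Surjective g.hom.hom) : ∃ h : P ⟶ X, h ≫ g = f := by
  have : Module.Projective A P := hP
  obtain ⟨h, hh⟩ := Module.projective_lifting_property g.hom.hom f.hom.hom hg
  exact ⟨mkHom h, hom_ext hh⟩

theorem fgProjective.of_lift {P : FGModuleCat.{u} A}
    (h : ∀ (X : FGModuleCat.{u} A) (g : X ⟶ P), Function.Surjective g.hom.hom →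
      ∃ s : P ⟶ X, s ≫ g = 𝟙 P) : fgProjective A P := by
  obtain ⟨n, f, hf⟩ := Module.Finite.exists_fin' A P
  obtain ⟨s, hs⟩ := h (of A (Fin n → A)) (mkHom f) hf
  exact Module.Projective.of_split s.hom.hom f (congrArg (fun φ => φ.hom.hom) hs)

theorem exists_projective_cover (X : FGModuleCat.{u} A) :
    ∃ (P : FGModuleCat.{u} A) (p : P ⟶ X), fgProjective A P ∧ Function.Surjective p.hom.hom := by
  obtain ⟨n, f, hf⟩ := Module.Finite.exists_fin' A X
  exact ⟨of A (Fin n → A), mkHom f, inferInstanceAs (Module.Projective A (Fin n → A)), hf⟩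

theorem exists_projective_ses [IsNoetherianRing A] (X : FGModuleCat.{u} A) :
    ∃ (K P : FGModuleCat.{u} A) (i : K ⟶ P) (p : P ⟶ X), fgProjective A P ∧ IsShortExact i p := by
  obtain ⟨P, p, hP, hp⟩ := exists_projective_cover X
  obtain ⟨K, i, hi⟩ := exists_kernel p hp
  exact ⟨K, P, i, p, hP, hi⟩

theorem fgProjective.sum {P Q : FGModuleCat.{u} A} (hP : fgProjective A P)
    (hQ : fgProjective A Q) : fgProjective A (FGModuleCat.sum P Q) := by
  have : Module.Projective A P := hP
  have : Module.Projective A Q := hQ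
  exact inferInstanceAs (Module.Projective A (P.obj × Q.obj))

theorem fgProjective.of_retract {P Q : FGModuleCat.{u} A} (hP : fgProjective A P)
    (i : Q ⟶ P) (r : P ⟶ Q) (h : i ≫ r = 𝟙 Q) : fgProjective A Q := by
  have : Module.Projective A P := hP
  exact Module.Projective.of_split i.hom.hom r.hom.hom (congrArg (fun φ => φ.hom.hom) h)

theorem fgProjective_zero : fgProjective A (zeroObj A) :=
  inferInstanceAs (Module.Projective A PUnit.{u + 1})

theorem fgProjective.exists_section {X Y P : FGModuleCat.{u} A} {f : X ⟶ Y} {g : Y ⟶ P}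
    (hP : fgProjective A P) (h : IsShortExact f g) : ∃ s : P ⟶ Y, s ≫ g = 𝟙 P :=
  hP.exists_lift (𝟙 P) g h.surjective

/-! ### Vanishing of the first extension group -/

/-- Every morphism `X ⟶ W` extends along every short exact sequence `0 → X → Y → G → 0`, that is,
the first extension group of `G` and `W` vanishes. -/
def ExtVanish (G W : FGModuleCat.{u} A) : Prop :=
  ∀ ⦃X Y : FGModuleCat.{u} A⦄ (f : X ⟶ Y) (g : Y ⟶ G), IsShortExact f g →
    ∀ u : X ⟶ W, ∃ v : Y ⟶ W, f ≫ v = u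

/-- If all morphisms `K ⟶ W` extend along one projective presentation `0 → K → P → G → 0`, then
monomorphisms with cokernel `G` have the left lifting property with respect to epimorphisms with
kernel `W`. -/
theorem exists_diagonal {K P G W : FGModuleCat.{u} A} {k : K ⟶ P} {q : P ⟶ G}
    (hP : fgProjective A P) (hkq : IsShortExact k q)
    (hW : ∀ u : K ⟶ W, ∃ v : P ⟶ W, k ≫ v = u)
    {X Y E F : FGModuleCat.{u} A} {i : X ⟶ Y} {g : Y ⟶ G} (hig : IsShortExact i g)
    {j : W ⟶ E} {p : E ⟶ F} (hjp : IsShortExact j p) (a : X ⟶ E) (b : Y ⟶ F)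
    (h : i ≫ b = a ≫ p) : ∃ l : Y ⟶ E, i ≫ l = a ∧ l ≫ p = b := by
  obtain ⟨s, hs⟩ := hP.exists_lift q g hig.surjective
  obtain ⟨κ, hκ⟩ := hig.exists_lift (k ≫ s) (by rw [Category.assoc, hs, hkq.comp_zero])
  obtain ⟨l₀, hl₀⟩ := hP.exists_lift (s ≫ b) p hjp.surjective
  -- On `K` the two candidates `k ≫ l₀` and `κ ≫ a` for the diagonal agree after `p`, so they differ
  -- by a map `d` into `W`. Extending `d` to `v` on `P` gives the correction of `l₀`.
  obtain ⟨d, hd⟩ := hjp.exists_lift (k ≫ l₀ - κ ≫ a) (by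
    rw [Preadditive.sub_comp, Category.assoc, Category.assoc, hl₀, ← h, reassoc_of% hκ, sub_self])
  obtain ⟨v, hv⟩ := hW d
  -- `Y` is the quotient of `X ⊕ P` by a copy of `K`, so the diagonal is defined on `X ⊕ P` and
  -- descends.
  have hsurj : Function.Surjective (FGModuleCat.desc i s).hom.hom := fun y => by
    obtain ⟨t, ht⟩ := hkq.surjective (g.hom.hom y)
    have : g.hom.hom (y - s.hom.hom t) = 0 := by
      rw [map_sub, ← comp_app, hs, ht, sub_self]
    obtain ⟨x, hx⟩ := hig.exists_of_zero this
    exact ⟨(FGModuleCat.inl X P).hom.hom x + (FGModuleCat.inr X P).hom.hom t, by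
      rw [desc_app, map_add, map_add]; simp [hx]⟩
  obtain ⟨l, hl⟩ := exists_desc _ hsurj (FGModuleCat.desc a (l₀ - v ≫ j)) (by
    intro z hxt
    rw [desc_app] at hxt
    have ht : q.hom.hom ((FGModuleCat.snd X P).hom.hom z) = 0 := by
      have := congrArg g.hom.hom hxt
      rwa [map_add, hig.apply_apply, zero_add, map_zero, ← comp_app, hs] at this
    obtain ⟨y, hy⟩ := hkq.exists_of_zero ht
    have hx : (FGModuleCat.fst X P).hom.hom z = - κ.hom.hom y := by
      refine hig.injective ?_
      rw [map_neg, ← comp_app κ, hκ, comp_app, hy]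
      exact eq_neg_of_add_eq_zero_left hxt
    have e1 := congr_apply hv y
    have e2 := congr_apply hd y
    simp only [comp_app, sub_apply', hy] at e1 e2
    rw [desc_app, hx, sub_apply', comp_app, e1, e2, map_neg]
    abel)
  refine ⟨l, ?_, epi_cancel hsurj ?_⟩
  · rw [← inl_desc i s, Category.assoc, hl, inl_desc]
  · rw [reassoc_of% hl]
    refine sum_hom_ext ?_ ?_
    · rw [← Category.assoc, inl_desc, ← Category.assoc, inl_desc, h]
    · rw [← Category.assoc, inr_desc, ← Category.assoc, inr_desc, Preadditive.sub_comp,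
        Category.assoc, hjp.comp_zero, comp_zero, sub_zero, hl₀]

/-- An extension of `u` is a diagonal in the lifting problem against `W ⟶ 0`, so one projective
presentation of `G` suffices to test the vanishing. -/
theorem ExtVanish.of_presentation {K P G W : FGModuleCat.{u} A} {k : K ⟶ P} {q : P ⟶ G}
    (hP : fgProjective A P) (hkq : IsShortExact k q)
    (hW : ∀ u : K ⟶ W, ∃ v : P ⟶ W, k ≫ v = u) : ExtVanish G W := fun X Y f g hfg u => by
  obtain ⟨l, hl, -⟩ := exists_diagonal hP hkq hW hfg (isShortExact_id_zero W) u 0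
    (by rw [comp_zero, comp_zero])
  exact ⟨l, hl⟩

namespace ExtVanish

variable {G W : FGModuleCat.{u} A}

theorem exists_diagonal [IsNoetherianRing A] (hGW : ExtVanish G W) {X Y E F : FGModuleCat.{u} A} {i : X ⟶ Y}
    {g : Y ⟶ G} (hig : IsShortExact i g)
    {j : W ⟶ E} {p : E ⟶ F} (hjp : IsShortExact j p) (a : X ⟶ E) (b : Y ⟶ F)
    (h : i ≫ b = a ≫ p) : ∃ l : Y ⟶ E, i ≫ l = a ∧ l ≫ p = b := by
  obtain ⟨K, P, k, q, hP, hkq⟩ := exists_projective_ses G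
  exact _root_.exists_diagonal hP hkq (hGW k q hkq) hig hjp a b h

theorem exists_lift [IsNoetherianRing A] (hGW : ExtVanish G W) {E F : FGModuleCat.{u} A}
    {j : W ⟶ E} {p : E ⟶ F} (hjp : IsShortExact j p) (b : G ⟶ F) : ∃ l : G ⟶ E, l ≫ p = b := by
  obtain ⟨l, -, hl⟩ := hGW.exists_diagonal (isShortExact_zero_id G) hjp 0 b (by simp)
  exact ⟨l, hl⟩

/-- Dimension shifting. -/
theorem shift [IsNoetherianRing A] {W' P K P' : FGModuleCat.{u} A} {j : W' ⟶ P} {p : P ⟶ W} (hjp : IsShortExact j p)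
    {k : K ⟶ P'} {q : P' ⟶ G} (hkq : IsShortExact k q) (hP' : fgProjective A P')
    (hGP : ExtVanish G P) (hK : ExtVanish K W') : ExtVanish G W :=
  of_presentation hP' hkq fun u => by
    obtain ⟨l, rfl⟩ := hK.exists_lift hjp u
    obtain ⟨v, rfl⟩ := hGP k q hkq l
    exact ⟨v ≫ p, by simp⟩

theorem of_extension [IsNoetherianRing A] {G₁ G₂ G₃ : FGModuleCat.{u} A} {i : G₁ ⟶ G₂} {p : G₂ ⟶ G₃}
    (hip : IsShortExact i p) (h₁ : ExtVanish G₁ W) (h₃ : ExtVanish G₃ W) : ExtVanish G₂ W :=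
  fun X Y f g hfg u => by
    obtain ⟨Y₁, f', g', k, h', hk, hf', -⟩ := hfg.exists_pullback_mono hip
    obtain ⟨v', rfl⟩ := h₁ f' g' h' u
    obtain ⟨v, rfl⟩ := h₃ k _ hk v'
    exact ⟨v, by rw [reassoc_of% hf']⟩

theorem of_retract [IsNoetherianRing A] {G' : FGModuleCat.{u} A} (h : ExtVanish G' W) (i : G ⟶ G') (r : G' ⟶ G)
    (hir : i ≫ r = 𝟙 G) : ExtVanish G W := fun X Y f g hfg u => by
  obtain ⟨Y', f', g', r', hfg', hf', hr', hY'⟩ := hfg.exists_pullback r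
  obtain ⟨v, rfl⟩ := h f' g' hfg' u
  -- Since `i ≫ r = 𝟙`, the map `(𝟙, g ≫ i)` lands in the pullback. The resulting section `t` of
  -- `r'` restricts to `f'` on `X`.
  obtain ⟨t, ht⟩ := hY'.exists_lift (FGModuleCat.lift (𝟙 Y) (g ≫ i)) (by
    simp [FGModuleCat.desc, hir, ← Category.assoc]
    simp [hir])
  refine ⟨t ≫ v, ?_⟩
  rw [← Category.assoc]
  congr 1
  refine mono_cancel hY'.injective ?_
  rw [Category.assoc, ht]
  refine hom_sum_ext ?_ ?_
  · simp [hf']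
  · simp [hfg'.comp_zero, reassoc_of% hfg.comp_zero]

theorem of_projective {P : FGModuleCat.{u} A} (hP : fgProjective A P) : ExtVanish P W :=
  of_presentation hP (isShortExact_zero_id P) fun u => ⟨0, by
    refine ext' fun x => ?_
    rw [show x = 0 from rfl, map_zero, map_zero]⟩

end ExtVanish

end Toolkit

end

noncomputable section

/-! ### Gorenstein projective modules -/

/-- Dependent choice in both directions along the integers. -/
theorem exists_int_chain {α : ℤ → Type*} (R : ∀ n, α n → α (n + 1) → Prop)
    (hr : ∀ n a, ∃ b, R n a b) (hl : ∀ n b, ∃ a, R n a b) (a₀ : α 0) :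
    ∃ s : ∀ n, α n, s 0 = a₀ ∧ ∀ n, R n (s n) (s (n + 1)) := by
  choose nx hnx using hr
  choose pv hpv using hl
  let f : ∀ n : ℕ, α (Int.ofNat n) := fun n => Nat.rec a₀ (fun n a => nx (Int.ofNat n) a) n
  let g : ∀ n : ℕ, α (Int.negSucc n) := fun n =>
    Nat.rec (pv (Int.negSucc 0) a₀) (fun n a => pv (Int.negSucc (n + 1)) a) n
  refine ⟨fun n => match n with | .ofNat n => f n | .negSucc n => g n, rfl, ?_⟩
  -- `Int.negSucc 0 + 1` reduces to `0`, so the seam between the two halves is a case of its own.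
  rintro (n | n)
  · exact hnx (Int.ofNat n) (f n)
  · cases n with
    | zero => exact hpv (Int.negSucc 0) a₀
    | succ n => exact hpv (Int.negSucc (n + 1)) (g n)

section GorensteinClosure

open FGModuleCat

variable {A : Type u} [Ring A]

namespace IsTotallyAcyclic

variable {K : ChainComplex (ModuleCat.{u} A) ℤ} (hK : IsTotallyAcyclic A K)
include hK

theorem exists_of_d_eq_zero {i j k : ℤ} (hij : j + 1 = i) (hjk : k + 1 = j) (x : K.X j)
    (hx : (K.d j k).hom x = 0) : ∃ y : K.X i, (K.d i j).hom y = x := by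
  have h := (hK.acyclic j)
  rw [HomologicalComplex.exactAt_iff' _ i j k (by simp [hij])
    (by simp [← hjk]), ShortComplex.moduleCat_exact_iff] at h
  exact h x hx

theorem exists_extension {i j k : ℤ} (hij : j + 1 = i) (hjk : k + 1 = j) (Q : ModuleCat.{u} A)
    (h₁ : Module.Finite A Q) (h₂ : Module.Projective A Q) (f : K.X j ⟶ Q)
    (hf : K.d i j ≫ f = 0) : ∃ g : K.X k ⟶ Q, K.d j k ≫ g = f := by
  subst hij hjk
  have := hK.hom_acyclic Q h₁ h₂ (k + 1) f hf
  rwa [add_sub_cancel_right] at this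

end IsTotallyAcyclic

/-- The cycles of a complex of finitely generated modules. -/
def cyclesFG [IsNoetherianRing A] (K : ChainComplex (ModuleCat.{u} A) ℤ)
    (hK : ∀ i, Module.Finite A (K.X i)) (i : ℤ) : FGModuleCat.{u} A :=
  ⟨K.cycles i, by
    have := hK i
    exact Module.Finite.of_injective (K.iCycles i).hom
      ((ModuleCat.mono_iff_injective _).1 inferInstance)⟩

theorem gorensteinProjective.of_iso {X Y : FGModuleCat.{u} A} (hX : gorensteinProjective A X)
    (e : X ≅ Y) : gorensteinProjective A Y := by
  obtain ⟨K, hK, i, ⟨f⟩⟩ := hX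
  exact ⟨K, hK, i, ⟨((ModuleCat.isFG A).ι.mapIso e).symm ≪≫ f⟩⟩

/-- The complex is cut into the sequences of which it is spliced; acyclicity is what makes the map
onto the next cycles surjective. -/
theorem cyclesFG_isShortExact [IsNoetherianRing A] {K : ChainComplex (ModuleCat.{u} A) ℤ}
    (hK : IsTotallyAcyclic A K) {i j k : ℤ} (hij : j + 1 = i) (hjk : k + 1 = j) :
    IsShortExact (X := cyclesFG K hK.finite i) (Y := ⟨K.X i, hK.finite i⟩)
      (Z := cyclesFG K hK.finite j)
      ⟨K.iCycles i⟩ ⟨K.toCycles i j⟩ where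
  injective := (ModuleCat.mono_iff_injective (K.iCycles i)).1 inferInstance
  exact x := by
    have hinj : Function.Injective (K.iCycles j).hom :=
      (ModuleCat.mono_iff_injective (K.iCycles j)).1 inferInstance
    have e : ∀ x, (K.iCycles j).hom ((K.toCycles i j).hom x) = (K.d i j).hom x := fun x =>
      congrArg (fun φ => φ.hom x) (K.toCycles_i i j)
    constructor
    · intro hx
      have hd : (K.d i j).hom x = 0 := by
        rw [← e]
        exact (congrArg _ hx).trans (map_zero _)
      -- A cycle is produced from the universal property of `cycles`, applied to the map `A ⟶ K.X i`
      -- with value `x` at `1`.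
      have hz : ModuleCat.ofHom (LinearMap.toSpanSingleton A _ x) ≫ K.d i j = 0 := by
        refine ModuleCat.hom_ext (LinearMap.ext_ring ?_)
        simpa using hd
      refine ⟨(K.liftCycles (ModuleCat.ofHom (LinearMap.toSpanSingleton A _ x)) j
        (by simp [← hij]) hz).hom (1 : A), ?_⟩
      refine (congrArg (fun φ => φ.hom (1 : A)) (K.liftCycles_i
        (ModuleCat.ofHom (LinearMap.toSpanSingleton A _ x)) j (by simp [← hij]) hz)).trans ?_
      simp
    · rintro ⟨y, rfl⟩
      refine hinj ((e _).trans ?_)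
      refine (congrArg (fun φ => φ.hom y) (K.iCycles_d i j)).trans ?_
      exact (map_zero (K.iCycles j).hom).symm
  surjective z := by
    have hinj : Function.Injective (K.iCycles j).hom :=
      (ModuleCat.mono_iff_injective (K.iCycles j)).1 inferInstance
    obtain ⟨y, hy⟩ := hK.exists_of_d_eq_zero hij hjk ((K.iCycles j).hom z)
      (congrArg (fun φ => φ.hom z) (K.iCycles_d j k))
    exact ⟨y, hinj (Eq.trans (congrArg (fun φ => φ.hom y) (K.toCycles_i i j)) hy)⟩

theorem cyclesFG_gorensteinProjective [IsNoetherianRing A] {K : ChainComplex (ModuleCat.{u} A) ℤ}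
    (hK : IsTotallyAcyclic A K) (i : ℤ) : gorensteinProjective A (cyclesFG K hK.finite i) :=
  ⟨K, hK, i, ⟨Iso.refl _⟩⟩

/-- A map from the cycles in degree `i + 1` to `Q` is a map from degree `i + 2` killed by the
differential. Acyclicity under `Hom(-, Q)` extends it to degree `i + 1`, the middle term of a
projective presentation of the cycles in degree `i`. -/
theorem cyclesFG_extVanish [IsNoetherianRing A] {K : ChainComplex (ModuleCat.{u} A) ℤ}
    (hK : IsTotallyAcyclic A K) (i : ℤ) {Q : FGModuleCat.{u} A} (hQ : fgProjective A Q) :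
    ExtVanish (cyclesFG K hK.finite i) Q := by
  refine ExtVanish.of_presentation (P := ⟨K.X (i + 1), hK.finite _⟩) (hK.projective (i + 1))
    (cyclesFG_isShortExact hK rfl (show i - 1 + 1 = i by ring)) fun u => ?_
  obtain ⟨g, hg⟩ := hK.exists_extension (i := i + 1 + 1 + 1) (j := i + 1 + 1) (k := i + 1) rfl rfl
    Q.obj Q.2 hQ (K.toCycles (i + 1 + 1) (i + 1) ≫ u.hom)
    ((Category.assoc _ _ _).symm.trans ((congrArg (· ≫ u.hom)
      (K.d_toCycles (i + 1 + 1 + 1) (i + 1 + 1) (i + 1))).trans zero_comp))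
  refine ⟨⟨g⟩, epi_cancel
    (cyclesFG_isShortExact hK (i := i + 1 + 1) (j := i + 1) rfl rfl).surjective ?_⟩
  refine ObjectProperty.hom_ext _ ?_
  change K.toCycles (i + 1 + 1) (i + 1) ≫ K.iCycles (i + 1) ≫ g = _
  rw [K.toCycles_i_assoc, hg]
  rfl

namespace gorensteinProjective

theorem iff_exists_cycles [IsNoetherianRing A] {X : FGModuleCat.{u} A} :
    gorensteinProjective A X ↔ ∃ (K : ChainComplex (ModuleCat.{u} A) ℤ)
      (hK : IsTotallyAcyclic A K) (i : ℤ), Nonempty (X ≅ cyclesFG K hK.finite i) := by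
  constructor
  · rintro ⟨K, hK, i, ⟨e⟩⟩
    exact ⟨K, hK, i, ⟨(ModuleCat.isFG A).fullyFaithfulι.preimageIso e⟩⟩
  · rintro ⟨K, hK, i, ⟨e⟩⟩
    exact (cyclesFG_gorensteinProjective hK i).of_iso e.symm

variable [IsNoetherianRing A]

theorem extVanish {X Q : FGModuleCat.{u} A} (hX : gorensteinProjective A X)
    (hQ : fgProjective A Q) : ExtVanish X Q := by
  obtain ⟨K, hK, i, ⟨e⟩⟩ := iff_exists_cycles.1 hX
  exact (cyclesFG_extVanish hK i hQ).of_retract e.hom e.inv e.hom_inv_id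

theorem exists_cosyzygy {X : FGModuleCat.{u} A} (hX : gorensteinProjective A X) :
    ∃ (P X' : FGModuleCat.{u} A) (i : X ⟶ P) (p : P ⟶ X'),
      fgProjective A P ∧ gorensteinProjective A X' ∧ IsShortExact i p := by
  obtain ⟨K, hK, i, ⟨e⟩⟩ := iff_exists_cycles.1 hX
  exact ⟨⟨K.X i, hK.finite i⟩, _, _, _, hK.projective i, cyclesFG_gorensteinProjective hK (i - 1),
    (cyclesFG_isShortExact hK (show i - 1 + 1 = i by ring)
      (show i - 1 - 1 + 1 = i - 1 by ring)).of_iso_left e⟩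

end gorensteinProjective

theorem IsShortExact.of_iso_right {X Y Z Z' : FGModuleCat.{u} A} {f : X ⟶ Y} {g : Y ⟶ Z}
    (h : IsShortExact f g) (e : Z ≅ Z') : IsShortExact f (g ≫ e.hom) where
  injective := h.injective
  exact y := by
    rw [← h.exact y]
    constructor
    · intro hy
      have e' := congr_apply e.hom_inv_id (g.hom.hom y)
      exact e'.symm.trans ((congrArg e.inv.hom.hom hy).trans (map_zero _))
    · intro hy; rw [comp_app, hy, map_zero]
  surjective z := by
    obtain ⟨y, hy⟩ := h.surjective (e.inv.hom.hom z)
    exact ⟨y, by rw [comp_app, hy]; exact congr_apply e.inv_hom_id z⟩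

namespace gorensteinProjective

variable [IsNoetherianRing A]

theorem exists_syzygy {X : FGModuleCat.{u} A} (hX : gorensteinProjective A X) :
    ∃ (P X' : FGModuleCat.{u} A) (i : X' ⟶ P) (p : P ⟶ X),
      fgProjective A P ∧ gorensteinProjective A X' ∧ IsShortExact i p := by
  obtain ⟨K, hK, i, ⟨e⟩⟩ := iff_exists_cycles.1 hX
  exact ⟨⟨K.X (i + 1), hK.finite _⟩, _, _, _, hK.projective (i + 1), cyclesFG_gorensteinProjective hK (i + 1),
    (cyclesFG_isShortExact hK (show i + 1 = i + 1 from rfl)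
      (show i - 1 + 1 = i by ring)).of_iso_right e.symm⟩

/-- A property of finitely generated modules implies Gorenstein projectivity if the modules which
have it have syzygies and cosyzygies with the same property, and no extensions by projectives. -/
theorem coinduction (S : ObjectProperty (FGModuleCat.{u} A))
    (hc : ∀ X, S X → ∃ (P X' : FGModuleCat.{u} A) (i : X ⟶ P) (p : P ⟶ X'),
      fgProjective A P ∧ S X' ∧ IsShortExact i p)
    (hs : ∀ X, S X → ∃ (P X' : FGModuleCat.{u} A) (i : X' ⟶ P) (p : P ⟶ X),
      fgProjective A P ∧ S X' ∧ IsShortExact i p)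
    (he : ∀ X Q, S X → fgProjective A Q → ExtVanish X Q) : S ≤ gorensteinProjective A := by
  intro X hX
  obtain ⟨s, hs0, hs⟩ := exists_int_chain (α := fun _ => {X : FGModuleCat.{u} A // S X})
    (fun _ a b => ∃ (P : FGModuleCat.{u} A) (i : b.1 ⟶ P) (p : P ⟶ a.1),
      fgProjective A P ∧ IsShortExact i p)
    (fun _ a => by
      obtain ⟨P, X', i, p, hP, hX', h⟩ := hs a.1 a.2
      exact ⟨⟨X', hX'⟩, P, i, p, hP, h⟩)
    (fun _ b => by
      obtain ⟨P, X', i, p, hP, hX', h⟩ := hc b.1 b.2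
      exact ⟨⟨X', hX'⟩, P, i, p, hP, h⟩) ⟨X, hX⟩
  choose P i p hP hip using hs
  -- The index grows towards syzygies: the chosen sequences are `0 → s (n + 1) → P n → s n → 0`, and
  -- the differential passes through `s (n + 1)`.
  let K : ChainComplex (ModuleCat.{u} A) ℤ := ChainComplex.of (fun n => (P n).obj)
    (fun n => (p (n + 1) ≫ i n).hom) fun n => by
      have h := (hip (n + 1)).comp_zero
      change (p (n + 1 + 1) ≫ i (n + 1)).hom ≫ (p (n + 1) ≫ i n).hom = 0
      rw [← ObjectProperty.FullSubcategory.comp_hom]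
      simp only [Category.assoc]
      rw [reassoc_of% h]
      simp
  have hd : ∀ n, K.d (n + 1) n = (p (n + 1) ≫ i n).hom := fun n =>
    ChainComplex.of_d (fun n => (P n).obj) (fun n => (p (n + 1) ≫ i n).hom) n
  have hd' : ∀ n (x : K.X (n + 1)), (K.d (n + 1) n).hom x =
      (i n).hom.hom ((p (n + 1)).hom.hom x) := fun n x => by rw [hd]; rfl
  have hfun : ∀ n (x : K.X (n + 1)), (K.d (n + 1) n).hom x = 0 →
      ∃ y : K.X (n + 1 + 1), (K.d (n + 1 + 1) (n + 1)).hom y = x := fun n x hx => by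
    rw [hd'] at hx
    have hx' : (p (n + 1)).hom.hom x = 0 := (hip n).injective (hx.trans (map_zero _).symm)
    obtain ⟨z, hz⟩ := (hip (n + 1)).exists_of_zero hx'
    obtain ⟨y, hy⟩ := (hip (n + 1 + 1)).surjective z
    exact ⟨y, by rw [hd', hy]; exact hz⟩
  have hK : IsTotallyAcyclic A K := by
    refine ⟨fun n => (P n).2, fun n => hP n, fun n => ?_, fun Q hQ hQ' n f hf => ?_⟩
    · obtain ⟨m, rfl⟩ : ∃ m, n = m + 1 := ⟨n - 1, by ring⟩
      rw [HomologicalComplex.exactAt_iff' _ (m + 1 + 1) (m + 1) m (by simp) (by simp),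
        ShortComplex.moduleCat_exact_iff]
      exact hfun m
    · obtain ⟨m, rfl⟩ : ∃ m, n = m + 1 := ⟨n - 1, by ring⟩
      suffices h : ∃ g : K.X m ⟶ Q, K.d (m + 1) m ≫ g = f by
        rwa [add_sub_cancel_right]
      let Q' : FGModuleCat.{u} A := ⟨Q, hQ⟩
      let f' : P (m + 1) ⟶ Q' := ⟨f⟩
      have hz : i (m + 1) ≫ f' = 0 := by
        refine epi_cancel (hip (m + 1 + 1)).surjective ?_
        refine ObjectProperty.hom_ext _ ?_
        rw [hd] at hf
        rw [comp_zero]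
        exact hf
      obtain ⟨g₁, hg₁⟩ := (hip (m + 1)).exists_desc f' hz
      -- A map killed by the preceding differential lives on `s (m + 1)`, and extends to `P m`
      -- because `s m` has no extensions by `Q`.
      obtain ⟨g, hg⟩ := he (s m).1 Q' (s m).2 hQ' (i m) (p m) (hip m) g₁
      refine ⟨g.hom, ?_⟩
      rw [hd]
      change (p (m + 1) ≫ i m ≫ g).hom = _
      rw [hg, hg₁]
  -- The cycles in degree `m + 1` are the copy of `s (m + 1 + 1)` inside `P (m + 1)`. Hence `X`,
  -- placed at index `0`, is found in degree `-1`, that is for `m = -2`.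
  obtain ⟨m, hm⟩ : ∃ m : ℤ, m + 1 + 1 = 0 := ⟨-2, by norm_num⟩
  have e₂ := cyclesFG_isShortExact hK (i := m + 1) (j := m) (k := m - 1) rfl (by ring)
  obtain ⟨a, ha⟩ := e₂.exists_lift (i (m + 1)) (by
    refine mono_cancel (i := (⟨K.iCycles m⟩ : cyclesFG K hK.finite m ⟶ P m))
      ((ModuleCat.mono_iff_injective (K.iCycles m)).1 inferInstance) ?_
    rw [zero_comp, Category.assoc]
    have : (⟨K.toCycles (m + 1) m⟩ : P (m + 1) ⟶ cyclesFG K hK.finite m) ≫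
        (⟨K.iCycles m⟩ : cyclesFG K hK.finite m ⟶ P m) = p (m + 1) ≫ i m :=
      ObjectProperty.hom_ext _ ((K.toCycles_i (m + 1) m).trans (hd m))
    exact (congrArg (i (m + 1) ≫ ·) this).trans (by
      rw [← Category.assoc, (hip (m + 1)).comp_zero, zero_comp]))
  obtain ⟨b, hb⟩ := (hip (m + 1)).exists_lift
    (⟨K.iCycles (m + 1)⟩ : cyclesFG K hK.finite (m + 1) ⟶ P (m + 1)) (by
      refine mono_cancel (hip m).injective ?_
      rw [zero_comp, Category.assoc]
      refine ObjectProperty.hom_ext _ ?_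
      refine Eq.trans ?_ (K.iCycles_d (m + 1) m)
      rw [hd]
      rfl)
  have eX : (s (m + 1 + 1)).1 = X := by rw [hm, hs0]
  rw [iff_exists_cycles, ← eX]
  exact ⟨K, hK, m + 1, ⟨⟨a, b,
    mono_cancel (hip (m + 1)).injective (by rw [Category.assoc, hb, ha, Category.id_comp]),
    mono_cancel e₂.injective (by rw [Category.assoc, ha, Category.id_comp]; exact hb)⟩⟩⟩

/-- The sequences `0 → P → P → 0 → 0` and `0 → 0 → P → P → 0` make the projectives themselves a
class to which `coinduction` applies. -/
theorem of_projective {P : FGModuleCat.{u} A} (hP : fgProjective A P) :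
    gorensteinProjective A P :=
  coinduction (fgProjective A)
    (fun X hX => ⟨X, zeroObj A, _, _, hX, fgProjective_zero, isShortExact_id_zero X⟩)
    (fun X hX => ⟨X, zeroObj A, _, _, hX, fgProjective_zero, isShortExact_zero_id X⟩)
    (fun _ _ hX _ => ExtVanish.of_projective hX) P hP

end gorensteinProjective

/-! ### The horseshoe lemmas. -/

namespace IsShortExact

variable {X Y Z : FGModuleCat.{u} A} {f : X ⟶ Y} {g : Y ⟶ Z}

theorem surjective_of_ends {X' Y' Z' : FGModuleCat.{u} A} {f' : X' ⟶ Y'} {g' : Y' ⟶ Z'}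
    (h : IsShortExact f g) (h' : IsShortExact f' g') {a : X ⟶ X'} {b : Y ⟶ Y'} {c : Z ⟶ Z'}
    (h₁ : f ≫ b = a ≫ f') (h₂ : g ≫ c = b ≫ g') (ha : Function.Surjective a.hom.hom)
    (hc : Function.Surjective c.hom.hom) : Function.Surjective b.hom.hom := fun y' => by
  obtain ⟨z, hz⟩ := hc (g'.hom.hom y')
  obtain ⟨y, rfl⟩ := h.surjective z
  have : g'.hom.hom (y' - b.hom.hom y) = 0 := by
    rw [map_sub, ← hz, ← comp_app, ← comp_app, h₂, sub_self]
  obtain ⟨x', hx'⟩ := h'.exists_of_zero this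
  obtain ⟨x, rfl⟩ := ha x'
  refine ⟨y + f.hom.hom x, ?_⟩
  rw [map_add, ← comp_app, h₁, comp_app, hx', add_sub_cancel]

theorem injective_of_ends {X' Y' Z' : FGModuleCat.{u} A} {f' : X' ⟶ Y'} {g' : Y' ⟶ Z'}
    (h : IsShortExact f g) (h' : IsShortExact f' g') {a : X ⟶ X'} {b : Y ⟶ Y'} {c : Z ⟶ Z'}
    (h₁ : f ≫ b = a ≫ f') (h₂ : g ≫ c = b ≫ g') (ha : Function.Injective a.hom.hom)
    (hc : Function.Injective c.hom.hom) : Function.Injective b.hom.hom := by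
  rw [injective_iff_map_eq_zero]
  intro y hy
  have : g.hom.hom y = 0 := hc (by rw [← comp_app, h₂, comp_app, hy, map_zero, map_zero])
  obtain ⟨x, rfl⟩ := h.exists_of_zero this
  have : x = 0 := ha (h'.injective (by
    rw [← comp_app, ← h₁, comp_app, hy, map_zero, map_zero]))
  rw [this, map_zero]

/-- The horseshoe lemma. -/
theorem exists_horseshoe [IsNoetherianRing A] (h : IsShortExact f g)
    {KX PX KZ PZ : FGModuleCat.{u} A}
    {i : KX ⟶ PX} {p : PX ⟶ X} (hX : IsShortExact i p) {i' : KZ ⟶ PZ} {p' : PZ ⟶ Z}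
    (hZ : IsShortExact i' p') (hPZ : fgProjective A PZ) :
    ∃ (KY : FGModuleCat.{u} A) (i'' : KY ⟶ FGModuleCat.sum PX PZ) (p'' : FGModuleCat.sum PX PZ ⟶ Y)
      (a : KX ⟶ KY) (b : KY ⟶ KZ), IsShortExact i'' p'' ∧ IsShortExact a b := by
  obtain ⟨l, hl⟩ := hPZ.exists_lift p' g h.surjective
  have h₁ : FGModuleCat.inl PX PZ ≫ FGModuleCat.desc (p ≫ f) l = p ≫ f := by simp
  have h₂ : FGModuleCat.snd PX PZ ≫ p' = FGModuleCat.desc (p ≫ f) l ≫ g := by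
    refine sum_hom_ext ?_ ?_
    · rw [← Category.assoc, inl_snd, zero_comp, ← Category.assoc, inl_desc, Category.assoc,
        h.comp_zero, CategoryTheory.Limits.comp_zero]
    · rw [← Category.assoc, inr_snd, ← Category.assoc, inr_desc, hl, Category.id_comp]
  obtain ⟨KY, k, hk⟩ := exists_kernel _
    ((isShortExact_sum PX PZ).surjective_of_ends h h₁ h₂ hX.surjective hZ.surjective)
  obtain ⟨a, b, hab, -, -⟩ := (isShortExact_sum PX PZ).kernels h h₁ h₂ hX hk hZ
  exact ⟨KY, k, _, a, b, hk, hab⟩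

/-- The dual horseshoe lemma. -/
theorem exists_cohorseshoe (h : IsShortExact f g)
    {CX PX CZ PZ : FGModuleCat.{u} A}
    {i : X ⟶ PX} {p : PX ⟶ CX} (hX : IsShortExact i p) {i' : Z ⟶ PZ} {p' : PZ ⟶ CZ}
    (hZ : IsShortExact i' p') (hE : ExtVanish Z PX) :
    ∃ (CY : FGModuleCat.{u} A) (i'' : Y ⟶ FGModuleCat.sum PX PZ) (p'' : FGModuleCat.sum PX PZ ⟶ CY)
      (a : CX ⟶ CY) (b : CY ⟶ CZ), IsShortExact i'' p'' ∧ IsShortExact a b := by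
  -- Projectives need not be injective, so the extension of `i` to `Y` comes from the vanishing of
  -- extensions of `Z` by `PX`.
  obtain ⟨l, hl⟩ := hE f g h i
  have h₁ : f ≫ FGModuleCat.lift l (g ≫ i') = i ≫ FGModuleCat.inl PX PZ :=
    hom_sum_ext (by simp [hl]) (by simp [reassoc_of% h.comp_zero])
  have h₂ : g ≫ i' = FGModuleCat.lift l (g ≫ i') ≫ FGModuleCat.snd PX PZ := by simp
  obtain ⟨CY, k, hk⟩ := exists_cokernel _
    (h.injective_of_ends (isShortExact_sum PX PZ) h₁ h₂ hX.injective hZ.injective)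
  obtain ⟨a, b, hab, -, -⟩ := h.cokernels (isShortExact_sum PX PZ) h₁ h₂ hX hk hZ
  exact ⟨CY, _, k, a, b, hk, hab⟩

end IsShortExact

/-! ### Closure properties of Gorenstein projective modules. -/

namespace gorensteinProjective

variable [IsNoetherianRing A]

/-- The two horseshoe lemmas show that extensions of Gorenstein projectives have syzygies and
cosyzygies of the same kind, so `coinduction` applies to them. -/
theorem of_extension {X Y Z : FGModuleCat.{u} A} {f : X ⟶ Y} {g : Y ⟶ Z} (h : IsShortExact f g)
    (hX : gorensteinProjective A X) (hZ : gorensteinProjective A Z) :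
    gorensteinProjective A Y := by
  refine coinduction (fun Y => ∃ (X Z : FGModuleCat.{u} A) (f : X ⟶ Y) (g : Y ⟶ Z),
    gorensteinProjective A X ∧ gorensteinProjective A Z ∧ IsShortExact f g) ?_ ?_ ?_ Y
    ⟨X, Z, f, g, hX, hZ, h⟩
  · rintro Y ⟨X, Z, f, g, hX, hZ, h⟩
    obtain ⟨PX, CX, i, p, hPX, hCX, hX'⟩ := hX.exists_cosyzygy
    obtain ⟨PZ, CZ, i', p', hPZ, hCZ, hZ'⟩ := hZ.exists_cosyzygy
    obtain ⟨CY, i'', p'', a, b, hY, hab⟩ := h.exists_cohorseshoe hX' hZ' (hZ.extVanish hPX)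
    exact ⟨_, CY, i'', p'', hPX.sum hPZ, ⟨_, _, a, b, hCX, hCZ, hab⟩, hY⟩
  · rintro Y ⟨X, Z, f, g, hX, hZ, h⟩
    obtain ⟨PX, CX, i, p, hPX, hCX, hX'⟩ := hX.exists_syzygy
    obtain ⟨PZ, CZ, i', p', hPZ, hCZ, hZ'⟩ := hZ.exists_syzygy
    obtain ⟨CY, i'', p'', a, b, hY, hab⟩ := h.exists_horseshoe hX' hZ' hPZ
    exact ⟨_, CY, i'', p'', hPX.sum hPZ, ⟨_, _, a, b, hCX, hCZ, hab⟩, hY⟩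
  · rintro Y Q ⟨X, Z, f, g, hX, hZ, h⟩ hQ
    exact ExtVanish.of_extension h (hX.extVanish hQ) (hZ.extVanish hQ)

/-- The coinduction runs over direct summands. If `X ⊕ Y ⊆ P` has quotient `G`, then `C = P / X`
contains a copy of `Y` with quotient `G`. So `C ⊕ X` is an extension of `G` by `X ⊕ Y`, and `C` is
again a summand of a Gorenstein projective. The new complement is `X` itself, which keeps everything
finitely generated. Syzygies are dual. -/
theorem of_summand {X Y : FGModuleCat.{u} A} (h : gorensteinProjective A (FGModuleCat.sum X Y)) :
    gorensteinProjective A X := by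
  refine coinduction (fun X => ∃ Y, gorensteinProjective A (FGModuleCat.sum X Y)) ?_ ?_ ?_ X ⟨Y, h⟩
  · rintro X ⟨Y, hXY⟩
    obtain ⟨P, G, i, p, hP, hG, hip⟩ := hXY.exists_cosyzygy
    have hinj : Function.Injective (inl X Y ≫ i).hom.hom :=
      hip.injective.comp (isShortExact_sum X Y).injective
    obtain ⟨C, q, hq⟩ := exists_cokernel _ hinj
    refine ⟨P, C, _, q, hP, ⟨X, ?_⟩, hq⟩
    -- the extension `0 → X ⊕ Y → C ⊕ X → G → 0`
    obtain ⟨c, hc⟩ := hq.exists_desc p (by rw [Category.assoc, hip.comp_zero, comp_zero])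
    refine of_extension (f := FGModuleCat.desc (inr C X) (inr X Y ≫ i ≫ q ≫ inl C X))
      (g := fst C X ≫ c) ⟨?_, fun y => ⟨fun hy => ?_, ?_⟩, ?_⟩ hXY hG
    · rw [injective_iff_map_eq_zero]
      intro z hz
      have e₁ := congrArg (snd C X).hom.hom hz
      have e₂ := congrArg (fst C X).hom.hom hz
      rw [desc_app, map_add] at e₁ e₂
      simp only [comp_app, snd_inr_app, snd_inl_app, fst_inr_app, fst_inl_app, map_zero, add_zero,
        zero_add] at e₁ e₂
      obtain ⟨x, hx⟩ := hq.exists_of_zero e₂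
      have e₃ := congrArg (snd X Y).hom.hom (hip.injective hx)
      refine sum_ext (e₁.trans (map_zero _).symm) ?_
      exact e₃.symm
    · rw [comp_app] at hy
      obtain ⟨w, hw⟩ := hq.surjective ((fst C X).hom.hom y)
      have e : p.hom.hom w = 0 := by rw [← hc, comp_app, hw, hy]
      obtain ⟨z, rfl⟩ := hip.exists_of_zero e
      refine ⟨(inl X Y).hom.hom ((snd C X).hom.hom y) +
        (inr X Y).hom.hom ((snd X Y).hom.hom z), ?_⟩
      rw [desc_app, map_add, map_add]
      refine sum_ext ?_ ?_
      · rw [map_add]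
        simp only [map_add, map_zero, comp_app, fst_inl_app, fst_inr_app, snd_inl_app, snd_inr_app, add_zero, zero_add]
        have e := hq.apply_apply ((fst X Y).hom.hom z)
        rw [← hw]
        conv_rhs => rw [sum_eq z, map_add, map_add]
        rw [comp_app] at e
        rw [e, zero_add]
      · rw [map_add]
        simp only [map_add, map_zero, comp_app, fst_inl_app, fst_inr_app, snd_inl_app, snd_inr_app, add_zero, zero_add]
    · rintro ⟨z, rfl⟩
      rw [desc_app, map_add]
      have e : c.hom.hom (q.hom.hom (i.hom.hom ((inr X Y).hom.hom ((snd X Y).hom.hom z)))) = 0 := by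
        rw [← comp_app, hc, hip.apply_apply]
      simp only [comp_app, fst_inl_app, fst_inr_app, e, map_zero, add_zero]
    · intro g
      obtain ⟨w, rfl⟩ := hip.surjective g
      exact ⟨(inl C X).hom.hom (q.hom.hom w), congr_apply hc w⟩
  · rintro X ⟨Y, hXY⟩
    obtain ⟨P, G, i, p, hP, hG, hip⟩ := hXY.exists_syzygy
    obtain ⟨C, q, hq⟩ := exists_kernel (p ≫ fst X Y)
      ((isShortExact_sum' X Y).surjective.comp hip.surjective)
    refine ⟨P, C, q, _, hP, ⟨X, ?_⟩, hq⟩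
    -- the extension `0 → G → C ⊕ X → X ⊕ Y → 0`
    obtain ⟨c, hc⟩ := hq.exists_lift i (by rw [reassoc_of% hip.comp_zero, zero_comp])
    refine of_extension (f := c ≫ inl C X)
      (g := FGModuleCat.desc (q ≫ p ≫ snd X Y ≫ inr X Y) (inl X Y))
      ⟨?_, fun y => ⟨fun hy => ?_, ?_⟩, fun z => ?_⟩ hG hXY
    · intro x y hxy
      refine hip.injective ?_
      rw [← hc, comp_app, comp_app]
      exact congrArg q.hom.hom ((isShortExact_sum C X).injective hxy)
    · rw [desc_app] at hy
      have e₁ := congrArg (fst X Y).hom.hom hy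
      have e₂ := congrArg (snd X Y).hom.hom hy
      rw [map_add] at e₁ e₂
      simp only [comp_app, snd_inr_app, snd_inl_app, fst_inr_app, fst_inl_app, map_zero, add_zero,
        zero_add] at e₁ e₂
      have e₃ : p.hom.hom (q.hom.hom ((fst C X).hom.hom y)) = 0 := by
        refine sum_ext ?_ (e₂.trans (map_zero _).symm)
        have := hq.apply_apply ((fst C X).hom.hom y)
        rw [comp_app] at this
        rw [this, map_zero]
      obtain ⟨g, hg⟩ := hip.exists_of_zero e₃
      refine ⟨g, sum_ext ?_ ?_⟩
      · rw [comp_app, fst_inl_app]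
        exact hq.injective (by rw [← comp_app, hc, hg])
      · rw [comp_app, snd_inl_app, e₁]
    · rintro ⟨z, rfl⟩
      rw [desc_app]
      have e : p.hom.hom (q.hom.hom (c.hom.hom z)) = 0 := by
        rw [← comp_app c, hc, hip.apply_apply]
      simp only [comp_app, fst_inl_app, snd_inl_app, e, map_zero, add_zero]
    · obtain ⟨w, hw⟩ := hip.surjective ((inr X Y).hom.hom ((snd X Y).hom.hom z))
      obtain ⟨y, hy⟩ := hq.exists_of_zero (y := w) (by rw [comp_app, hw, fst_inr_app])
      refine ⟨(inl C X).hom.hom y + (inr C X).hom.hom ((fst X Y).hom.hom z), ?_⟩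
      rw [desc_app, map_add, map_add]
      simp only [map_add, map_zero, comp_app, fst_inl_app, fst_inr_app, snd_inl_app, snd_inr_app, add_zero, zero_add,
        hy, hw]
      rw [add_comm]
      exact (sum_eq z).symm
  · rintro X Q ⟨Y, hXY⟩ hQ
    exact (hXY.extVanish hQ).of_retract (inl X Y) (fst X Y) inl_fst

theorem of_retract {X Y : FGModuleCat.{u} A} (hY : gorensteinProjective A Y) (i : X ⟶ Y)
    (r : Y ⟶ X) (hir : i ≫ r = 𝟙 X) : gorensteinProjective A X := by
  obtain ⟨K, k, hk⟩ := exists_kernel r (fun x => ⟨i.hom.hom x, congr_apply hir x⟩)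
  obtain ⟨t, ht, ht'⟩ := hk.exists_retraction i hir
  refine of_summand (Y := K) (hY.of_iso ⟨FGModuleCat.lift r t, FGModuleCat.desc i k, ?_, ?_⟩)
  · simp only [FGModuleCat.lift, Preadditive.add_comp, Category.assoc, inl_desc, inr_desc, ht']
    abel
  · have hit : i ≫ t = 0 := mono_cancel hk.injective (by
      rw [Category.assoc, ht', zero_comp, Preadditive.comp_sub, Category.comp_id,
        reassoc_of% hir, sub_self])
    refine sum_hom_ext ?_ ?_
    · rw [← Category.assoc, inl_desc]
      exact hom_sum_ext (by simp [hir]) (by simp [hit])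
    · rw [← Category.assoc, inr_desc]
      exact hom_sum_ext (by simp [hk.comp_zero]) (by simp [ht])

/-- Pulling back along a projective cover `P ⟶ Z` with Gorenstein projective kernel gives an
extension `E` of `Y` by that kernel. As `P` is projective, `E` also splits over `P` with complement
`X`. -/
theorem of_epi {X Y Z : FGModuleCat.{u} A} {f : X ⟶ Y} {g : Y ⟶ Z} (h : IsShortExact f g)
    (hY : gorensteinProjective A Y) (hZ : gorensteinProjective A Z) :
    gorensteinProjective A X := by
  obtain ⟨P, K, i, p, hP, hK, hip⟩ := hZ.exists_syzygy
  obtain ⟨E, f', g', k, u, hE, hk, -, -⟩ := h.exists_pullback_epi hip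
  have hEG : gorensteinProjective A E := of_extension hk hK hY
  obtain ⟨s, hs⟩ := hP.exists_section hE
  obtain ⟨r, hr, -⟩ := hE.exists_retraction s hs
  exact hEG.of_retract f' r hr

end gorensteinProjective

end GorensteinClosure

end

noncomputable section

/-! ### Finite projective dimension and finite Gorenstein projective dimension -/

section Approximations

open FGModuleCat

variable {A : Type u} [Ring A]

namespace IsShortExact

variable {X Y Z : FGModuleCat.{u} A} {f : X ⟶ Y} {g : Y ⟶ Z}

theorem shortExact (h : IsShortExact f g) : (ShortComplex.mk f.hom g.hom
    (congrArg (fun φ => φ.hom) h.comp_zero)).ShortExact where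
  exact := (ShortComplex.ShortExact.moduleCat_exact_iff_function_exact _).2 h.exact
  mono_f := (ModuleCat.mono_iff_injective _).2 h.injective
  epi_g := (ModuleCat.epi_iff_surjective _).2 h.surjective

theorem finiteProjDim₂ (h : IsShortExact f g) (hX : finiteProjDim A X) (hZ : finiteProjDim A Z) :
    finiteProjDim A Y := by
  obtain ⟨n, hn⟩ := hX
  obtain ⟨m, hm⟩ := hZ
  exact ⟨max n m, h.shortExact.hasProjectiveDimensionLT_X₂ (max n m)
    (hasProjectiveDimensionLT_of_ge _ n _ (le_max_left _ _))
    (hasProjectiveDimensionLT_of_ge _ m _ (le_max_right _ _))⟩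

theorem finiteProjDim₃ (h : IsShortExact f g) (hX : finiteProjDim A X) (hY : finiteProjDim A Y) :
    finiteProjDim A Z := by
  obtain ⟨n, hn⟩ := hX
  obtain ⟨m, hm⟩ := hY
  exact ⟨max n m + 1, h.shortExact.hasProjectiveDimensionLT_X₃ (max n m)
    (hasProjectiveDimensionLT_of_ge _ n _ (le_max_left _ _))
    (hasProjectiveDimensionLT_of_ge _ m _ ((le_max_right _ _).trans (Nat.le_succ _)))⟩

theorem finiteProjDim₁ (h : IsShortExact f g) (hY : finiteProjDim A Y) (hZ : finiteProjDim A Z) :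
    finiteProjDim A X := by
  obtain ⟨n, hn⟩ := hY
  obtain ⟨m, hm⟩ := hZ
  exact ⟨max n m, h.shortExact.hasProjectiveDimensionLT_X₁ (max n m)
    (hasProjectiveDimensionLT_of_ge _ n _ (le_max_left _ _))
    (hasProjectiveDimensionLT_of_ge _ m _ ((le_max_right _ _).trans (Nat.le_succ _)))⟩

end IsShortExact

theorem fgProjective_iff_projective {X : FGModuleCat.{u} A} :
    fgProjective A X ↔ Projective X.obj :=
  IsProjective.iff_projective (R := A) X.obj

theorem fgProjective.finiteProjDim {X : FGModuleCat.{u} A} (h : fgProjective A X) :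
    finiteProjDim A X := by
  have := fgProjective_iff_projective.1 h
  exact ⟨1, inferInstance⟩

/-- Induction along a finite projective resolution. -/
theorem finiteProjDim.induction [IsNoetherianRing A] {C : FGModuleCat.{u} A → Prop}
    (proj : ∀ P, fgProjective A P → C P)
    (step : ∀ {K P X : FGModuleCat.{u} A} {i : K ⟶ P} {p : P ⟶ X}, IsShortExact i p →
      fgProjective A P → finiteProjDim A K → C K → C X)
    {X : FGModuleCat.{u} A} (hX : finiteProjDim A X) : C X := by
  obtain ⟨n, hn⟩ := hX
  induction n generalizing X with
  | zero =>
    -- The bound is strict: `0` means that `X` vanishes and `1` that `X` is projective, so both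
    -- belong to the base of the induction.
    have : HasProjectiveDimensionLT X.obj 1 := hasProjectiveDimensionLT_of_ge _ 0 _ zero_le_one
    exact proj X (fgProjective_iff_projective.2 inferInstance)
  | succ n ih =>
    obtain ⟨K, P, i, p, hP, hip⟩ := exists_projective_ses X
    rcases n with _ | n
    · exact proj X (fgProjective_iff_projective.2 inferInstance)
    · have hK : HasProjectiveDimensionLT K.obj (n + 1) := by
        have := fgProjective_iff_projective.1 hP
        exact (hip.shortExact.hasProjectiveDimensionLT_X₃_iff n this).1 hn
      exact step hip hP ⟨_, hK⟩ (ih hK)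

/-- The morphism factors through a finitely generated projective module. -/
def FactorsThroughProjective {X Y : FGModuleCat.{u} A} (f : X ⟶ Y) : Prop :=
  ∃ (Q : FGModuleCat.{u} A) (a : X ⟶ Q) (b : Q ⟶ Y), fgProjective A Q ∧ f = a ≫ b

namespace FactorsThroughProjective

variable {X Y Z : FGModuleCat.{u} A}

theorem zero : FactorsThroughProjective (0 : X ⟶ Y) :=
  ⟨zeroObj A, 0, 0, fgProjective_zero, by simp⟩

theorem add {f g : X ⟶ Y} (hf : FactorsThroughProjective f) (hg : FactorsThroughProjective g) :
    FactorsThroughProjective (f + g) := by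
  obtain ⟨Q, a, b, hQ, rfl⟩ := hf
  obtain ⟨Q', a', b', hQ', rfl⟩ := hg
  exact ⟨_, FGModuleCat.lift a a', FGModuleCat.desc b b', hQ.sum hQ', by
    simp [FGModuleCat.lift]⟩

theorem neg {f : X ⟶ Y} (hf : FactorsThroughProjective f) : FactorsThroughProjective (-f) := by
  obtain ⟨Q, a, b, hQ, rfl⟩ := hf
  exact ⟨Q, -a, b, hQ, by simp⟩

theorem sub {f g : X ⟶ Y} (hf : FactorsThroughProjective f) (hg : FactorsThroughProjective g) :
    FactorsThroughProjective (f - g) := by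
  rw [sub_eq_add_neg]; exact hf.add hg.neg

theorem comp_left {f : X ⟶ Y} (hf : FactorsThroughProjective f) (g : Z ⟶ X) :
    FactorsThroughProjective (g ≫ f) := by
  obtain ⟨Q, a, b, hQ, rfl⟩ := hf
  exact ⟨Q, g ≫ a, b, hQ, by simp⟩

theorem comp_right {f : X ⟶ Y} (hf : FactorsThroughProjective f) (g : Y ⟶ Z) :
    FactorsThroughProjective (f ≫ g) := by
  obtain ⟨Q, a, b, hQ, rfl⟩ := hf
  exact ⟨Q, a, b ≫ g, hQ, by simp⟩

end FactorsThroughProjective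

namespace gorensteinProjective

variable [IsNoetherianRing A] {G X Y : FGModuleCat.{u} A}

/-- Dimension shifting replaces `W` and `G` by their syzygies simultaneously, which is why the
induction on `W` quantifies over all `G`. -/
theorem extVanish_of_finiteProjDim (hG : gorensteinProjective A G) {W : FGModuleCat.{u} A}
    (hW : finiteProjDim A W) : ExtVanish G W := by
  revert G
  refine hW.induction (C := fun W => ∀ {G}, gorensteinProjective A G → ExtVanish G W)
    (fun P hP G hG => hG.extVanish hP) fun {K P X i p} hip hP _ ih G hG => ?_
  obtain ⟨P', X', i', p', hP', hX', hip'⟩ := hG.exists_syzygy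
  exact ExtVanish.shift hip hip' hP' (hG.extVanish hP) (ih hX')

/-- `G` embeds in a projective with Gorenstein projective cokernel, and `f` extends over that
embedding by orthogonality. -/
theorem factors_of_finiteProjDim (hG : gorensteinProjective A G) {W : FGModuleCat.{u} A}
    (hW : finiteProjDim A W) (f : G ⟶ W) : FactorsThroughProjective f := by
  obtain ⟨P, G', i, p, hP, hG', hip⟩ := hG.exists_cosyzygy
  obtain ⟨v, hv⟩ := hG'.extVanish_of_finiteProjDim hW i p hip f
  exact ⟨P, i, v, hP, hv.symm⟩

theorem fgProjective_of_finiteProjDim (hG : gorensteinProjective A G)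
    (hG' : finiteProjDim A G) : fgProjective A G := by
  obtain ⟨Q, a, b, hQ, h⟩ := hG.factors_of_finiteProjDim hG' (𝟙 G)
  exact hQ.of_retract a b h.symm

end gorensteinProjective

/-! ### Approximations and closure properties for finite Gorenstein projective dimension. -/

namespace finiteGorensteinProjDim

variable [IsNoetherianRing A]

theorem of_gorensteinProjective {X : FGModuleCat.{u} A} (hX : gorensteinProjective A X) :
    finiteGorensteinProjDim A X := ⟨0, hX⟩

theorem of_ses {K G X : FGModuleCat.{u} A} {i : K ⟶ G} {p : G ⟶ X} (h : IsShortExact i p)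
    (hK : finiteGorensteinProjDim A K) (hG : gorensteinProjective A G) :
    finiteGorensteinProjDim A X := by
  obtain ⟨n, hn⟩ := hK
  exact ⟨n + 1, K, G, i, p, h, hG, hn⟩

theorem of_finiteProjDim {X : FGModuleCat.{u} A} (hX : finiteProjDim A X) :
    finiteGorensteinProjDim A X :=
  hX.induction (fun _ hP => of_gorensteinProjective (.of_projective hP))
    fun h hP _ hK => of_ses h hK (.of_projective hP)

/-- The two halves feed each other. Given `0 → K → G → X → 0`, pushing out along a preenvelope `K ⟶
W` gives `0 → W → E → X → 0` with `E` an extension of Gorenstein projectives, a precover of `X`.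
Embedding `E` in a projective and pushing out along `E ⟶ X` gives a preenvelope of `X`. -/
theorem exists_approximations {X : FGModuleCat.{u} A} (hX : finiteGorensteinProjDim A X) :
    (∃ (W G : FGModuleCat.{u} A) (i : W ⟶ G) (p : G ⟶ X), IsShortExact i p ∧
      finiteProjDim A W ∧ gorensteinProjective A G) ∧
    (∃ (W G : FGModuleCat.{u} A) (i : X ⟶ W) (p : W ⟶ G), IsShortExact i p ∧
      finiteProjDim A W ∧ gorensteinProjective A G) := by
  obtain ⟨n, hn⟩ := hX
  induction n generalizing X with
  | zero =>
    have hX : gorensteinProjective A X := hn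
    obtain ⟨P, G', i, p, hP, hG', hip⟩ := hX.exists_cosyzygy
    exact ⟨⟨_, _, _, _, isShortExact_zero_id X, fgProjective_zero.finiteProjDim, hX⟩,
      _, _, _, _, hip, hP.finiteProjDim, hG'⟩
  | succ n ih =>
    obtain ⟨K, G, i, p, hip, hG, hK⟩ := hn
    obtain ⟨W, G', j, q, hjq, hW, hG'⟩ := (ih hK).2
    obtain ⟨E, f', g', u', v', h₁, h₂, -⟩ := hip.exists_pushout_mono hjq
    have hE : gorensteinProjective A E := .of_extension h₂ hG hG'
    refine ⟨⟨W, E, f', g', h₁, hW, hE⟩, ?_⟩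
    obtain ⟨P, G'', a, b, hP, hG'', hab⟩ := hE.exists_cosyzygy
    obtain ⟨W', f'', g'', u'', h₃, h₄, -, -⟩ := hab.exists_pushout_epi h₁
    exact ⟨W', G'', f'', g'', h₃, h₄.finiteProjDim₃ hW hP.finiteProjDim, hG''⟩

/-- Gorenstein projective precovers with kernel of finite projective dimension. -/
theorem exists_precover {X : FGModuleCat.{u} A} (hX : finiteGorensteinProjDim A X) :
    ∃ (W G : FGModuleCat.{u} A) (i : W ⟶ G) (p : G ⟶ X), IsShortExact i p ∧
      finiteProjDim A W ∧ gorensteinProjective A G := (exists_approximations hX).1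

theorem exists_preenvelope {X : FGModuleCat.{u} A} (hX : finiteGorensteinProjDim A X) :
    ∃ (W G : FGModuleCat.{u} A) (i : X ⟶ W) (p : W ⟶ G), IsShortExact i p ∧
      finiteProjDim A W ∧ gorensteinProjective A G := (exists_approximations hX).2

theorem of_precover {W G X : FGModuleCat.{u} A} {i : W ⟶ G} {p : G ⟶ X} (h : IsShortExact i p)
    (hW : finiteProjDim A W) (hG : gorensteinProjective A G) : finiteGorensteinProjDim A X :=
  of_ses h (of_finiteProjDim hW) hG

/-- Pull a projective cover `P ⟶ W` back to `X`: the pullback is the kernel of an epimorphism `P ⟶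
G`, hence Gorenstein projective, and it covers `X` with kernel of finite projective dimension. -/
theorem of_preenvelope {W G X : FGModuleCat.{u} A} {i : X ⟶ W} {p : W ⟶ G} (h : IsShortExact i p)
    (hW : finiteProjDim A W) (hG : gorensteinProjective A G) : finiteGorensteinProjDim A X := by
  obtain ⟨K, P, k, q, hP, hkq⟩ := exists_projective_ses W
  obtain ⟨E, f', g', i', h₁, h₂, -, -⟩ := hkq.exists_pullback_mono h
  exact of_precover h₁ (hkq.finiteProjDim₁ hP.finiteProjDim hW) (.of_epi h₂ (.of_projective hP) hG)

/-- The quotient of a module of finite Gorenstein projective dimension by a submodule of finite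
projective dimension. -/
theorem of_quotient {W Y X : FGModuleCat.{u} A} {i : W ⟶ Y} {p : Y ⟶ X} (h : IsShortExact i p)
    (hW : finiteProjDim A W) (hY : finiteGorensteinProjDim A Y) :
    finiteGorensteinProjDim A X := by
  obtain ⟨W', G, j, q, hjq, hW', hG⟩ := hY.exists_precover
  obtain ⟨E, f', g', i', h₁, h₂, -, -⟩ := hjq.exists_pullback_mono h
  exact of_precover h₂ (h₁.finiteProjDim₂ hW' hW) hG

/-- By orthogonality the sequence splits. If `P` covers `W`, then `P ⊕ X` covers `Y`, and the kernel
is that of `P ⟶ W`. -/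
theorem of_extension_gorensteinProjective {W Y X : FGModuleCat.{u} A} {i : W ⟶ Y} {p : Y ⟶ X}
    (h : IsShortExact i p) (hW : finiteProjDim A W) (hX : gorensteinProjective A X) :
    finiteGorensteinProjDim A Y := by
  obtain ⟨s, hs⟩ := (hX.extVanish_of_finiteProjDim hW).exists_lift h (𝟙 X)
  obtain ⟨K, P, k, q, hP, hkq⟩ := exists_projective_ses W
  have e₁ : inl P X ≫ FGModuleCat.desc (q ≫ i) s = q ≫ i := by simp
  have e₂ : snd P X ≫ 𝟙 X = FGModuleCat.desc (q ≫ i) s ≫ p :=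
    sum_hom_ext (by rw [← Category.assoc, ← Category.assoc]; simp [h.comp_zero])
      (by rw [← Category.assoc, ← Category.assoc]; simp [hs])
  obtain ⟨N, n, hn⟩ := exists_kernel _ ((isShortExact_sum P X).surjective_of_ends h e₁ e₂
    hkq.surjective (isShortExact_zero_id X).surjective)
  obtain ⟨a, b, hab, -, -⟩ := (isShortExact_sum P X).kernels h e₁ e₂ hkq hn (isShortExact_zero_id X)
  refine of_precover hn (hab.finiteProjDim₂ (hkq.finiteProjDim₁ hP.finiteProjDim hW)
    fgProjective_zero.finiteProjDim) (.of_extension (isShortExact_sum P X) (.of_projective hP) hX)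

theorem of_extension_finiteProjDim {W Y X : FGModuleCat.{u} A} {i : W ⟶ Y} {p : Y ⟶ X}
    (h : IsShortExact i p) (hW : finiteProjDim A W) (hX : finiteGorensteinProjDim A X) :
    finiteGorensteinProjDim A Y := by
  obtain ⟨W', G, j, q, hjq, hW', hG⟩ := hX.exists_precover
  obtain ⟨E, f', g', k', u', h₁, h₂, -, -⟩ := h.exists_pullback_epi hjq
  exact of_quotient h₂ hW' (of_extension_gorensteinProjective h₁ hW hG)

/-- Replacing `Y` by a precover reduces to `0 → K → E → G → 0`. Pushing a preenvelope `E ⟶ W'` out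
along `E ⟶ G` then exhibits `K` as the kernel of an epimorphism from `W'` to an extension of
Gorenstein projectives. -/
theorem of_epi {K X Y : FGModuleCat.{u} A} {i : K ⟶ X} {p : X ⟶ Y} (h : IsShortExact i p)
    (hX : finiteGorensteinProjDim A X) (hY : finiteGorensteinProjDim A Y) :
    finiteGorensteinProjDim A K := by
  obtain ⟨W, G, j, q, hjq, hW, hG⟩ := hY.exists_precover
  obtain ⟨E, f', g', k', u', h₁, h₂, -, -⟩ := h.exists_pullback_epi hjq
  obtain ⟨W', G', a, b, hab, hW', hG'⟩ := (of_extension_finiteProjDim h₂ hW hX).exists_preenvelope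
  obtain ⟨C, f'', g'', u'', h₃, h₄, -, -⟩ := hab.exists_pushout_epi h₁
  exact of_preenvelope h₄ hW' (.of_extension h₃ hG hG')

/-- A precover of `Z` and a preenvelope of `X` reduce to an extension of a Gorenstein projective by
a module of finite projective dimension. The way back uses `of_epi` and `of_quotient`. -/
theorem of_extension {X Y Z : FGModuleCat.{u} A} {f : X ⟶ Y} {g : Y ⟶ Z} (h : IsShortExact f g)
    (hX : finiteGorensteinProjDim A X) (hZ : finiteGorensteinProjDim A Z) :
    finiteGorensteinProjDim A Y := by
  obtain ⟨W, G, j, q, hjq, hW, hG⟩ := hZ.exists_precover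
  obtain ⟨E, f', g', k', u', h₁, h₂, -, -⟩ := h.exists_pullback_epi hjq
  obtain ⟨W', G', a, b, hab, hW', hG'⟩ := hX.exists_preenvelope
  obtain ⟨E', f'', g'', u'', v'', h₃, h₄, -⟩ := h₁.exists_pushout_mono hab
  exact of_quotient h₂ hW (of_epi h₄ (of_extension_gorensteinProjective h₃ hW' hG)
    (of_gorensteinProjective hG'))

theorem sum {X Y : FGModuleCat.{u} A} (hX : finiteGorensteinProjDim A X)
    (hY : finiteGorensteinProjDim A Y) : finiteGorensteinProjDim A (FGModuleCat.sum X Y) :=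
  of_extension (isShortExact_sum X Y) hX hY

end finiteGorensteinProjDim

end Approximations

end

noncomputable section

/-! ### The stable category and Gorenstein projective precovers -/

section StableFunctor

open FGModuleCat

variable {A : Type u} [Ring A]

theorem stableRel_iff {X Y : GP A} {f g : X ⟶ Y} :
    stableRel A f g ↔ FactorsThroughProjective (f.hom - g.hom) := Iff.rfl

instance : Congruence (stableRel A) where
  equivalence :=
    { refl := fun f => stableRel_iff.2 (by rw [sub_self]; exact .zero)
      symm := fun h => stableRel_iff.2 (by rw [← neg_sub]; exact (stableRel_iff.1 h).neg)
      trans := fun h h' => stableRel_iff.2 (by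
        rw [← sub_add_sub_cancel]; exact (stableRel_iff.1 h).add (stableRel_iff.1 h')) }
  comp_left f g g' h := stableRel_iff.2 (by
    have := (stableRel_iff.1 h).comp_left f.hom
    rwa [Preadditive.comp_sub] at this)
  comp_right g h := stableRel_iff.2 (by
    have := (stableRel_iff.1 h).comp_right g.hom
    rwa [Preadditive.sub_comp] at this)

theorem StableGP.map_eq_iff {X Y : GP A} {f g : X ⟶ Y} :
    (StableGP.proj A).map f = (StableGP.proj A).map g ↔
      FactorsThroughProjective (f.hom - g.hom) :=
  CategoryTheory.Quotient.functor_map_eq_iff _ f g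

/-- The second half of a factorization of `f ≫ π` lifts to `G`; what remains of `f` maps into `W`
and so factors through a projective. With the existence of lifts, composition with a precover is
thus bijective on morphisms from `T` modulo projectives. -/
theorem gorensteinProjective.factors_of_comp [IsNoetherianRing A] {T W G X : FGModuleCat.{u} A}
    (hT : gorensteinProjective A T) {i : W ⟶ G} {π : G ⟶ X} (h : IsShortExact i π)
    (hW : finiteProjDim A W) (f : T ⟶ G) (hf : FactorsThroughProjective (f ≫ π)) :
    FactorsThroughProjective f := by
  obtain ⟨Q, a, b, hQ, e⟩ := hf
  obtain ⟨b', rfl⟩ := hQ.exists_lift b π h.surjective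
  obtain ⟨m, hm⟩ := h.exists_lift (f - a ≫ b') (by
    rw [Preadditive.sub_comp, e, Category.assoc, sub_self])
  rw [← sub_add_cancel f (a ≫ b'), ← hm]
  exact ((hT.factors_of_finiteProjDim hW m).comp_right i).add ⟨Q, a, b', hQ, rfl⟩

variable [IsNoetherianRing A]

namespace GPFin

theorem exists_cover (X : GPFin A) : ∃ (G : GP A) (π : G.obj ⟶ X.obj) (W : FGModuleCat.{u} A)
    (i : W ⟶ G.obj), IsShortExact i π ∧ finiteProjDim A W := by
  obtain ⟨W, G, i, p, h, hW, hG⟩ := X.property.exists_precover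
  exact ⟨⟨G, hG⟩, p, W, i, h, hW⟩

/-- A Gorenstein projective precover. -/
def cover (X : GPFin A) : GP A := X.exists_cover.choose

/-- The precover map. -/
def π (X : GPFin A) : (GP.incl A).obj X.cover ⟶ X :=
  ObjectProperty.homMk X.exists_cover.choose_spec.choose

theorem exists_ker (X : GPFin A) : ∃ (W : FGModuleCat.{u} A) (i : W ⟶ X.cover.obj),
    IsShortExact i X.π.hom ∧ finiteProjDim A W := X.exists_cover.choose_spec.choose_spec

theorem exists_lift {X : GPFin A} {T : FGModuleCat.{u} A} (hT : gorensteinProjective A T)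
    (f : T ⟶ X.obj) : ∃ g : T ⟶ X.cover.obj, g ≫ X.π.hom = f := by
  obtain ⟨W, i, h, hW⟩ := X.exists_ker
  exact (hT.extVanish_of_finiteProjDim hW).exists_lift h f

theorem factors_of_comp {X : GPFin A} {T : FGModuleCat.{u} A} (hT : gorensteinProjective A T)
    {f : T ⟶ X.cover.obj} (hf : FactorsThroughProjective (f ≫ X.π.hom)) :
    FactorsThroughProjective f := by
  obtain ⟨W, i, h, hW⟩ := X.exists_ker
  exact hT.factors_of_comp h hW f hf

theorem factors_of_comp_eq {X : GPFin A} {T : FGModuleCat.{u} A} (hT : gorensteinProjective A T)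
    {f g : T ⟶ X.cover.obj} (hf : f ≫ X.π.hom = g ≫ X.π.hom) :
    FactorsThroughProjective (f - g) :=
  factors_of_comp hT (by rw [Preadditive.sub_comp, hf, sub_self]; exact .zero)

theorem exists_coverMap {X Y : GPFin A} (f : X ⟶ Y) :
    ∃ g : X.cover ⟶ Y.cover, g.hom ≫ Y.π.hom = X.π.hom ≫ f.hom := by
  obtain ⟨g, hg⟩ := exists_lift X.cover.property (X.π.hom ≫ f.hom)
  exact ⟨ObjectProperty.homMk g, hg⟩

/-- A lift of a morphism to the precovers. -/
def coverMap {X Y : GPFin A} (f : X ⟶ Y) : X.cover ⟶ Y.cover := (exists_coverMap f).choose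

theorem coverMap_comp_π {X Y : GPFin A} (f : X ⟶ Y) :
    (coverMap f).hom ≫ Y.π.hom = X.π.hom ≫ f.hom := (exists_coverMap f).choose_spec

theorem proj_map_eq {X : GPFin A} {T : GP A} {f g : T ⟶ X.cover}
    (h : f.hom ≫ X.π.hom = g.hom ≫ X.π.hom) :
    (StableGP.proj A).map f = (StableGP.proj A).map g :=
  StableGP.map_eq_iff.2 (factors_of_comp_eq T.property h)

variable (A) in
/-- The stable functor: a module of finite Gorenstein projective dimension is sent to its
Gorenstein projective precover. -/
def stableFunctor : GPFin A ⥤ StableGP A where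
  obj X := (StableGP.proj A).obj X.cover
  map f := (StableGP.proj A).map (coverMap f)
  map_id X := by
    rw [← CategoryTheory.Functor.map_id]
    exact proj_map_eq (by rw [coverMap_comp_π]; exact (Category.comp_id _).trans (Category.id_comp _).symm)
  map_comp f g := by
    rw [← CategoryTheory.Functor.map_comp]
    refine proj_map_eq ?_
    rw [coverMap_comp_π, ObjectProperty.FullSubcategory.comp_hom,
      ObjectProperty.FullSubcategory.comp_hom, Category.assoc, coverMap_comp_π,
      ← Category.assoc, ← Category.assoc, coverMap_comp_π]

theorem stableFunctor_map_eq {X Y : GPFin A} {f : X ⟶ Y} {g : X.cover ⟶ Y.cover}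
    (h : g.hom ≫ Y.π.hom = X.π.hom ≫ f.hom) :
    (stableFunctor A).map f = (StableGP.proj A).map g :=
  proj_map_eq ((coverMap_comp_π f).trans h.symm)

/-- Extensions of `Y.cover` by `K` vanish, so `Y.π` lifts through `p`, and a further lift `m` to
`X.cover` is the inverse. The error `g ≫ m - 𝟙` becomes, after `X.π`, a map into `K`, hence stably
zero. -/
theorem isIso_of_epi {X Y : GPFin A} {p : X ⟶ Y} {K : FGModuleCat.{u} A} {k : K ⟶ X.obj}
    (h : IsShortExact k p.hom) (hK : finiteProjDim A K) : IsIso ((stableFunctor A).map p) := by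
  obtain ⟨l, hl⟩ := (Y.cover.property.extVanish_of_finiteProjDim hK).exists_lift h Y.π.hom
  obtain ⟨m, hm⟩ := exists_lift Y.cover.property l
  obtain ⟨g, hg⟩ := exists_coverMap p
  rw [stableFunctor_map_eq hg]
  refine ⟨(StableGP.proj A).map (ObjectProperty.homMk m), ?_, ?_⟩
  · refine ((StableGP.proj A).map_comp _ _).symm.trans
      (Eq.trans ?_ ((StableGP.proj A).map_id X.cover))
    rw [StableGP.map_eq_iff]
    have e : ((g.hom ≫ m - 𝟙 _) ≫ X.π.hom) ≫ p.hom = 0 := by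
      rw [Preadditive.sub_comp, Preadditive.sub_comp, Category.assoc, Category.assoc,
        reassoc_of% hm, hl, hg, Category.id_comp, sub_self]
    obtain ⟨n, hn⟩ := h.exists_lift _ e
    refine factors_of_comp X.cover.property (X := X) (f := g.hom ≫ m - 𝟙 _) ?_
    rw [← hn]
    exact (X.cover.property.factors_of_finiteProjDim hK n).comp_right k
  · refine ((StableGP.proj A).map_comp _ _).symm.trans
      (Eq.trans ?_ ((StableGP.proj A).map_id Y.cover))
    refine proj_map_eq ?_
    change (m ≫ g.hom) ≫ Y.π.hom = 𝟙 _ ≫ Y.π.hom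
    rw [Category.assoc, hg, ← Category.assoc, hm, hl, Category.id_comp]

theorem _root_.IsShortExact.exists_split {X Y P : FGModuleCat.{u} A} {f : X ⟶ Y} {g : Y ⟶ P}
    (h : IsShortExact f g) (hP : fgProjective A P) :
    ∃ (s : P ⟶ Y) (r : Y ⟶ X), f ≫ r = 𝟙 X ∧ IsShortExact s r := by
  obtain ⟨s, hs⟩ := hP.exists_lift (𝟙 P) g h.surjective
  obtain ⟨r, hr, hr'⟩ := h.exists_retraction s hs
  have e : s ≫ r = 0 := by
    refine mono_cancel h.injective ?_
    rw [Category.assoc, hr', Preadditive.comp_sub, reassoc_of% hs]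
    simp
  refine ⟨s, r, hr, fun x y hxy => ?_, fun y => ⟨fun hy => ⟨g.hom.hom y, ?_⟩, ?_⟩, fun x =>
    ⟨f.hom.hom x, congr_apply hr x⟩⟩
  · have := congrArg g.hom.hom hxy
    rwa [← comp_app, ← comp_app, hs] at this
  · have := congr_apply hr' y
    rw [comp_app, hy, map_zero, sub_apply'] at this
    exact (sub_eq_zero.1 this.symm).symm
  · rintro ⟨x, rfl⟩
    exact congr_apply e x

/-- The sequence splits, so `f` is a section of an epimorphism with projective kernel, to which
`isIso_of_epi` applies. -/
theorem isIso_of_mono {X Y : GPFin A} {f : X ⟶ Y} {P : FGModuleCat.{u} A} {g : Y.obj ⟶ P}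
    (h : IsShortExact f.hom g) (hP : fgProjective A P) : IsIso ((stableFunctor A).map f) := by
  obtain ⟨s, r, hr, hsr⟩ := h.exists_split hP
  let r' : Y ⟶ X := ObjectProperty.homMk r
  have := isIso_of_epi (p := r') hsr hP.finiteProjDim
  have e : f ≫ r' = 𝟙 X := ObjectProperty.hom_ext _ hr
  have e' : (stableFunctor A).map f ≫ (stableFunctor A).map r' = 𝟙 _ := by
    rw [← CategoryTheory.Functor.map_comp, e, CategoryTheory.Functor.map_id]
  have e'' : (stableFunctor A).map f ≫ (stableFunctor A).map r' = inv ((stableFunctor A).map r') ≫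
    (stableFunctor A).map r' := by rw [e', IsIso.inv_hom_id]
  rw [(cancel_mono _).1 e'']
  infer_instance

theorem isIso_of_weq {X Y : GPFin A} {f : X ⟶ Y} (hf : (gpModel A).weq f) :
    IsIso ((stableFunctor A).map f) := by
  obtain ⟨Z, i, p, ⟨P, g, hi, hP⟩, ⟨K, k, hp, hK⟩, rfl⟩ := hf
  have := isIso_of_mono hi hP
  have := isIso_of_epi hp hK
  rw [CategoryTheory.Functor.map_comp]
  infer_instance

/-- The kernel of an epimorphism which is stably invertible has finite projective dimension. -/
theorem finiteProjDim_ker {X Y : GPFin A} {p : X ⟶ Y} {K : FGModuleCat.{u} A} {k : K ⟶ X.obj}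
    (h : IsShortExact k p.hom) (hp : IsIso ((stableFunctor A).map p)) : finiteProjDim A K := by
  obtain ⟨W, G, i, a, hia, hW, hG⟩ := (finiteGorensteinProjDim.of_epi h X.property
    Y.property).exists_precover
  obtain ⟨Q, G', j, q, hQ, hG', hjq⟩ := hG.exists_cosyzygy
  obtain ⟨g, hg⟩ := exists_coverMap p
  rw [stableFunctor_map_eq hg] at hp
  obtain ⟨m', hm₁, hm₂⟩ := hp
  obtain ⟨m, rfl⟩ := (StableGP.proj A).map_surjective m'
  have hm₁ := StableGP.map_eq_iff.1 (((StableGP.proj A).map_comp g m).trans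
    (hm₁.trans ((StableGP.proj A).map_id X.cover).symm))
  have hm₂ := StableGP.map_eq_iff.1 (((StableGP.proj A).map_comp m g).trans
    (hm₂.trans ((StableGP.proj A).map_id Y.cover).symm))
  -- Stable surjectivity becomes surjectivity: a map to `Y` lifts to `X` up to a map through a
  -- projective `R`, and that map lifts because `p` is an epimorphism.
  have surj : ∀ {T : FGModuleCat.{u} A} (_ : gorensteinProjective A T) (t : T ⟶ Y.obj),
      ∃ l : T ⟶ X.obj, l ≫ p.hom = t := by
    intro T hT t
    obtain ⟨t', rfl⟩ := exists_lift hT t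
    obtain ⟨R, b, c, hR, e⟩ := hm₂.comp_left t'
    obtain ⟨d, hd⟩ := hR.exists_lift (c ≫ Y.π.hom) p.hom h.surjective
    refine ⟨t' ≫ m.hom ≫ X.π.hom - b ≫ d, ?_⟩
    have e' := congrArg (· ≫ Y.π.hom) e
    simp only [Preadditive.comp_sub, Preadditive.sub_comp, ObjectProperty.FullSubcategory.comp_hom,
      ObjectProperty.FullSubcategory.id_hom, Category.assoc, Category.comp_id] at e' ⊢
    rw [hd, ← e', hg, sub_sub_cancel]
  -- `G ⟶ K ⟶ X` vanishes in `Y`, so its lift to `X.cover` is killed stably by `g`, and `g` is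
  -- stably invertible.
  have ext : FactorsThroughProjective (a ≫ k) := by
    obtain ⟨n, hn⟩ := exists_lift hG (a ≫ k)
    have e : FactorsThroughProjective (n ≫ g.hom) := factors_of_comp hG (by
      rw [Category.assoc, hg, reassoc_of% hn, h.comp_zero, comp_zero]; exact .zero)
    have e' := (e.comp_right m.hom).sub (hm₁.comp_left n)
    simp only [Preadditive.comp_sub, ObjectProperty.FullSubcategory.comp_hom,
      ObjectProperty.FullSubcategory.id_hom, Category.assoc, Category.comp_id,
      sub_sub_cancel] at e'
    rw [← hn]
    exact e'.comp_right _
  obtain ⟨R, c, d, hR, e⟩ := ext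
  obtain ⟨c', rfl⟩ := hG'.extVanish hR j q hjq c
  -- `c' ≫ d : Q ⟶ X` extends `a ≫ k`. Its image in `Y` factors through `G'`, where it lifts to `X`;
  -- subtracting the lift gives a map `Q ⟶ K` which still restricts to `a` on `G`.
  obtain ⟨t, ht⟩ := hjq.exists_desc ((c' ≫ d) ≫ p.hom) (by
    have := congrArg (· ≫ p.hom) e
    simp only [Category.assoc, h.comp_zero, comp_zero] at this ⊢
    exact this.symm)
  obtain ⟨t', rfl⟩ := surj hG' t
  obtain ⟨e'', he⟩ := h.exists_lift (c' ≫ d - q ≫ t') (by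
    rw [Preadditive.sub_comp, ← ht, Category.assoc q, sub_self])
  obtain ⟨b, rfl⟩ := hQ.exists_lift e'' a hia.surjective
  have hab : j ≫ b ≫ a = a := mono_cancel h.injective (by
    have := congrArg (j ≫ ·) he
    simp only [Preadditive.comp_sub, reassoc_of% hjq.comp_zero, zero_comp, sub_zero,
      Category.assoc] at this e ⊢
    rw [this, e])
  -- `𝟙 G` is the sum of a map through `W` and a map through `Q`. Both factor through projectives,
  -- so `G` is projective and `K` has finite projective dimension.
  obtain ⟨n, hn⟩ := hia.exists_lift (𝟙 G - j ≫ b) (by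
    rw [Preadditive.sub_comp, Category.assoc, hab, Category.id_comp, sub_self])
  obtain ⟨R', x, y, hR', hxy⟩ := ((hG.factors_of_finiteProjDim hW n).comp_right i).add
    ⟨Q, j, b, hQ, rfl⟩
  rw [hn, sub_add_cancel] at hxy
  exact hia.finiteProjDim₃ hW (hR'.of_retract x y hxy.symm).finiteProjDim

/-- The graph factorization of a morphism. -/
theorem exists_factor {X Y : GPFin A} (f : X ⟶ Y) : ∃ (Z : GPFin A) (i : X ⟶ Z) (p : Z ⟶ Y),
    monoWithCoker A (fgProjective A) i.hom ∧ Function.Surjective p.hom.hom.hom ∧ i ≫ p = f := by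
  obtain ⟨P, q, hP, hq⟩ := exists_projective_cover Y.obj
  refine ⟨⟨FGModuleCat.sum X.obj P, X.property.sum (.of_gorensteinProjective (.of_projective hP))⟩,
    ObjectProperty.homMk (inl _ _), ObjectProperty.homMk (FGModuleCat.desc f.hom q),
    ⟨P, snd _ _, isShortExact_sum _ _, hP⟩, fun y => ?_, ObjectProperty.hom_ext _ (inl_desc _ _)⟩
  obtain ⟨x, rfl⟩ := hq y
  exact ⟨(inr X.obj P).hom.hom x, congr_apply (inr_desc f.hom q) x⟩

/-- For the converse, factor `f` as `X ⟶ X ⊕ P ⟶ Y`. The first map is stably invertible, hence so is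
the second, and an epimorphism that is stably invertible has a kernel of finite projective
dimension. -/
theorem weq_iff {X Y : GPFin A} {f : X ⟶ Y} :
    (gpModel A).weq f ↔ IsIso ((stableFunctor A).map f) := by
  refine ⟨isIso_of_weq, fun hf => ?_⟩
  obtain ⟨Z, i, p, hi, hp, rfl⟩ := exists_factor f
  obtain ⟨P, g, hi, hP⟩ := hi
  obtain ⟨K, k, hk⟩ := exists_kernel p.hom hp
  have := isIso_of_mono hi hP
  rw [CategoryTheory.Functor.map_comp] at hf
  have := IsIso.of_isIso_comp_left ((stableFunctor A).map i) ((stableFunctor A).map p)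
  exact ⟨Z, i, p, ⟨P, g, hi, hP⟩, ⟨K, k, hk, finiteProjDim_ker hk this⟩, rfl⟩

variable (A) in
-- As an inverse image of isomorphisms, the class inherits two out of three and closure under
-- retracts.
theorem weq_eq : (gpModel A).weq = (MorphismProperty.isomorphisms _).inverseImage (stableFunctor A) :=
  MorphismProperty.ext _ _ fun _ _ _ => weq_iff

theorem weq_of_epi {X Y : GPFin A} {p : X ⟶ Y} {K : FGModuleCat.{u} A} {k : K ⟶ X.obj}
    (h : IsShortExact k p.hom) (hK : finiteProjDim A K) : (gpModel A).weq p :=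
  weq_iff.2 (isIso_of_epi h hK)

theorem weq_of_mono {X Y : GPFin A} {f : X ⟶ Y} {P : FGModuleCat.{u} A} {g : Y.obj ⟶ P}
    (h : IsShortExact f.hom g) (hP : fgProjective A P) : (gpModel A).weq f :=
  weq_iff.2 (isIso_of_mono h hP)

theorem weq_π (X : GPFin A) : (gpModel A).weq X.π := by
  obtain ⟨W, i, h, hW⟩ := X.exists_ker
  exact weq_of_epi h hW

theorem finiteProjDim_ker_of_weq {X Y : GPFin A} {p : X ⟶ Y} (hp : (gpModel A).weq p)
    {K : FGModuleCat.{u} A} {k : K ⟶ X.obj} (h : IsShortExact k p.hom) : finiteProjDim A K :=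
  finiteProjDim_ker h (weq_iff.1 hp)

/-- In a factorization of `f`, the projective cokernel `P` of the first map surjects onto `C`, with
the kernel `W` of the second map as its kernel. So `C` has finite projective dimension and, being
Gorenstein projective, is projective. -/
theorem fgProjective_coker_of_weq {X Y : GPFin A} {f : X ⟶ Y} (hf : (gpModel A).weq f)
    {C : FGModuleCat.{u} A} {g : Y.obj ⟶ C} (h : IsShortExact f.hom g)
    (hC : gorensteinProjective A C) : fgProjective A C := by
  obtain ⟨Z, i, p, ⟨P, c, hi, hP⟩, ⟨W, w, hp, hW⟩, rfl⟩ := hf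
  obtain ⟨r, hr⟩ := hi.exists_desc (p.hom ≫ g) (by rw [← Category.assoc]; exact h.comp_zero)
  have hr' : Function.Surjective r.hom.hom := fun z => by
    obtain ⟨y, rfl⟩ := h.surjective z
    obtain ⟨x, rfl⟩ := hp.surjective y
    exact ⟨c.hom.hom x, congr_apply hr x⟩
  obtain ⟨K, k, hk⟩ := exists_kernel r hr'
  obtain ⟨a, b, hab, -, -⟩ := hi.kernels h (a := 𝟙 _) (b := p.hom) (c := r)
    (Category.id_comp _).symm hr (isShortExact_zero_id _) hp hk
  exact hC.fgProjective_of_finiteProjDim (hk.finiteProjDim₃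
    (hab.finiteProjDim₃ fgProjective_zero.finiteProjDim hW) hP.finiteProjDim)

end GPFin

/-- The composite of two monomorphisms with Gorenstein projective cokernel. -/
theorem monoWithCoker.comp {X Y Z : FGModuleCat.{u} A} {f : X ⟶ Y} {g : Y ⟶ Z}
    (hf : monoWithCoker A (gorensteinProjective A) f)
    (hg : monoWithCoker A (gorensteinProjective A) g) :
    monoWithCoker A (gorensteinProjective A) (f ≫ g) := by
  obtain ⟨C, c, hc, hC⟩ := hf
  obtain ⟨D, d, hd, hD⟩ := hg
  obtain ⟨E, f', g', u', h₁, h₂, -, -⟩ := hd.exists_pushout_epi hc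
  exact ⟨E, u', h₂, .of_extension h₁ hC hD⟩

theorem monoWithCoker.of_retractArrow {X Y X' Y' : FGModuleCat.{u} A} {f : X ⟶ Y} {g : X' ⟶ Y'}
    (h : RetractArrow f g) (hg : monoWithCoker A (gorensteinProjective A) g) :
    monoWithCoker A (gorensteinProjective A) f := by
  obtain ⟨C', c', hc', hC'⟩ := hg
  obtain ⟨C, c, hc⟩ := exists_cokernel f fun x y hxy => by
    have e := congrArg h.i.right.hom.hom hxy
    rw [← comp_app, ← comp_app, ← h.i_w, comp_app, comp_app] at e
    have e' := congrArg h.r.left.hom.hom (hc'.injective e)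
    rwa [← comp_app, ← comp_app, h.retract_left] at e'
  obtain ⟨s, hs⟩ := hc.exists_desc (h.i.right ≫ c') (by
    rw [← Category.assoc, ← h.i_w, Category.assoc, hc'.comp_zero, comp_zero])
  obtain ⟨r, hr⟩ := hc'.exists_desc (h.r.right ≫ c) (by
    rw [← Category.assoc, ← h.r_w, Category.assoc, hc.comp_zero, comp_zero])
  refine ⟨C, c, hc, hC'.of_retract s r (epi_cancel hc.surjective ?_)⟩
  rw [reassoc_of% hs, hr, h.retract_right_assoc, Category.comp_id]
  exact Category.id_comp c

/-- The functor on arrows induced by the inclusion into all modules. -/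
def GPFin.retractArrow {X Y X' Y' : GPFin A} {f : X ⟶ Y} {g : X' ⟶ Y'} (h : RetractArrow f g) :
    RetractArrow f.hom g.hom := h.map (finiteGorensteinProjDim A).ι

variable (A) in
/-- The Gorenstein projective model structure is a model structure. -/
theorem gpModel_isModelStructure : (gpModel A).IsModelStructure where
  two_of_three := by rw [GPFin.weq_eq]; infer_instance
  retract_weq := by rw [GPFin.weq_eq]; infer_instance
  retract_cof := ⟨fun h hg => hg.of_retractArrow (GPFin.retractArrow h)⟩
  retract_fib := ⟨fun h hg y => by
    have h := GPFin.retractArrow h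
    obtain ⟨x, hx⟩ := hg (h.i.right.hom.hom y)
    refine ⟨h.r.left.hom.hom x, ?_⟩
    rw [← comp_app, h.r_w, comp_app]
    exact (congrArg _ hx).trans (congr_apply h.retract_right y)⟩
  lift_tcof i p hi hw hp := ⟨fun {a b} sq => by
    obtain ⟨C, c, hc, hC⟩ := hi
    obtain ⟨K, k, hk⟩ := exists_kernel p.hom hp
    obtain ⟨l, h₁, h₂⟩ := (ExtVanish.of_projective (W := K)
      (GPFin.fgProjective_coker_of_weq hw hc hC)).exists_diagonal hc hk a.hom b.hom
      (congrArg (·.hom) sq.w).symm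
    exact ⟨⟨⟨ObjectProperty.homMk l, ObjectProperty.hom_ext _ h₁, ObjectProperty.hom_ext _ h₂⟩⟩⟩⟩
  lift_tfib i p hi hp hw := ⟨fun {a b} sq => by
    obtain ⟨C, c, hc, hC⟩ := hi
    obtain ⟨K, k, hk⟩ := exists_kernel p.hom hp
    obtain ⟨l, h₁, h₂⟩ := (hC.extVanish_of_finiteProjDim
      (GPFin.finiteProjDim_ker_of_weq hw hk)).exists_diagonal hc hk a.hom b.hom
      (congrArg (·.hom) sq.w).symm
    exact ⟨⟨⟨ObjectProperty.homMk l, ObjectProperty.hom_ext _ h₁, ObjectProperty.hom_ext _ h₂⟩⟩⟩⟩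
  factor_tfib := ⟨fun {X Y} f => by
    let E : GPFin A := ⟨FGModuleCat.sum X.obj Y.cover.obj,
      X.property.sum (.of_gorensteinProjective Y.cover.property)⟩
    let p : E ⟶ Y := ObjectProperty.homMk (FGModuleCat.desc f.hom Y.π.hom)
    have hp : Function.Surjective p.hom.hom.hom := fun y => by
      obtain ⟨W, i, h, -⟩ := Y.exists_ker
      obtain ⟨x, rfl⟩ := h.surjective y
      exact ⟨(inr X.obj Y.cover.obj).hom.hom x, congr_apply (inr_desc f.hom Y.π.hom) x⟩
    obtain ⟨K, k, hk⟩ := exists_kernel p.hom hp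
    -- The map `p` is onto but its kernel `K` is arbitrary. Pushing out along a preenvelope `K ⟶ W`
    -- makes the kernel `W` and enlarges the source by a Gorenstein projective cokernel only.
    obtain ⟨W, G, a, b, hab, hW, hG⟩ := (finiteGorensteinProjDim.of_epi hk E.property
      Y.property).exists_preenvelope
    obtain ⟨Z, f', g', u', v', h₁, h₂, -, h₃⟩ := hk.exists_pushout_mono hab
    exact ⟨⟨⟨Z, .of_extension h₂ E.property (.of_gorensteinProjective hG)⟩,
      ObjectProperty.homMk (inl _ _ ≫ u'), ObjectProperty.homMk g',
      ObjectProperty.hom_ext _ (by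
        change (inl _ _ ≫ u') ≫ g' = f.hom
        rw [Category.assoc, h₃]; exact inl_desc _ _),
      monoWithCoker.comp ⟨_, _, isShortExact_sum _ _, Y.cover.property⟩ ⟨_, _, h₂, hG⟩,
      h₁.surjective, GPFin.weq_of_epi h₁ hW⟩⟩⟩
  factor_tcof := ⟨fun {X Y} f => by
    obtain ⟨Z, i, p, ⟨P, g, hi, hP⟩, hp, rfl⟩ := GPFin.exists_factor f
    exact ⟨⟨Z, i, p, rfl, ⟨⟨P, g, hi, .of_projective hP⟩, GPFin.weq_of_mono hi hP⟩, hp⟩⟩⟩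

end StableFunctor

end

noncomputable section

/-! ### The homotopy category is the stable category -/

section HomotopyCategory

open FGModuleCat

variable {A : Type u} [Ring A] [IsNoetherianRing A]

namespace GPFin

/-- Two morphisms which differ by a morphism factoring through a module of finite projective
dimension become equal in the homotopy category. -/
theorem toHo_map_eq {X Y : GPFin A} {f g : X ⟶ Y} {W : FGModuleCat.{u} A}
    (hW : finiteProjDim A W) (a : X.obj ⟶ W) (b : W ⟶ Y.obj) (h : f.hom - g.hom = a ≫ b) :
    (gpModel A).toHo.map f = (gpModel A).toHo.map g := by
  -- `X ⊕ W` acts as a cylinder: `i` and `j` are sections of the same weak equivalence `p`, and `q`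
  -- restricts to `g` and `f` along them.
  let Z : GPFin A := ⟨FGModuleCat.sum X.obj W, X.property.sum (.of_finiteProjDim hW)⟩
  let p : Z ⟶ X := ObjectProperty.homMk (fst _ _)
  let i : X ⟶ Z := ObjectProperty.homMk (inl _ _)
  let j : X ⟶ Z := ObjectProperty.homMk (FGModuleCat.lift (𝟙 _) a)
  let q : Z ⟶ Y := ObjectProperty.homMk (FGModuleCat.desc g.hom b)
  have hp : IsIso ((gpModel A).toHo.map p) :=
    Localization.inverts _ (gpModel A).weq p (weq_of_epi (isShortExact_sum' _ _) hW)
  have e₁ : j ≫ q = f := ObjectProperty.hom_ext _ (by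
    change FGModuleCat.lift (𝟙 _) a ≫ FGModuleCat.desc g.hom b = f.hom
    rw [← sub_add_cancel f.hom g.hom, h]
    simp [FGModuleCat.lift, add_comm])
  have e₂ : i ≫ q = g := ObjectProperty.hom_ext _ (inl_desc _ _)
  have e₃ : i ≫ p = j ≫ p := ObjectProperty.hom_ext _
    ((inl_fst (X := X.obj) (Y := W)).trans (lift_fst _ _).symm)
  have e₄ : (gpModel A).toHo.map i = (gpModel A).toHo.map j := by
    rw [← cancel_mono ((gpModel A).toHo.map p), ← CategoryTheory.Functor.map_comp, e₃,
      CategoryTheory.Functor.map_comp]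
  rw [← e₁, ← e₂, CategoryTheory.Functor.map_comp, CategoryTheory.Functor.map_comp, e₄]

theorem stableFunctor_isInverted : (gpModel A).weq.IsInvertedBy (stableFunctor A) :=
  fun _ _ _ hf => isIso_of_weq hf

variable (A) in
/-- The functor `Ho(𝒢𝒫^{<∞}(A)) ⥤ StableGP A` induced by Gorenstein projective precovers. -/
def hoToStable : HoGP A ⥤ StableGP A :=
  Localization.lift (stableFunctor A) stableFunctor_isInverted (gpModel A).toHo

variable (A) in
/-- `hoToStable` extends the stable functor. -/
def toHoHoToStable : (gpModel A).toHo ⋙ hoToStable A ≅ stableFunctor A :=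
  Localization.fac _ stableFunctor_isInverted _

/-- The localization inverts nothing more than the weak equivalences, because `stableFunctor`
factors through it and detects them. -/
theorem weq_iff_isIso_toHo {X Y : GPFin A} {f : X ⟶ Y} :
    (gpModel A).weq f ↔ IsIso ((gpModel A).toHo.map f) := by
  refine ⟨fun h => Localization.inverts _ (gpModel A).weq f h, fun h => weq_iff.2 ?_⟩
  rw [← NatIso.naturality_1 (toHoHoToStable A) f]
  have : IsIso (((gpModel A).toHo ⋙ hoToStable A).map f) := by
    rw [Functor.comp_map]; infer_instance
  infer_instance

variable (A) in
/-- The functor `StableGP A ⥤ Ho(𝒢𝒫^{<∞}(A))` induced by the inclusion. -/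
def stableToHo : StableGP A ⥤ HoGP A :=
  CategoryTheory.Quotient.lift (stableRel A) (GP.incl A ⋙ (gpModel A).toHo)
    fun X Y f g ⟨Q, a, b, hQ, h⟩ => toHo_map_eq hQ.finiteProjDim a b h

variable (A) in
/-- `stableToHo` is induced by the inclusion. -/
def projStableToHo : StableGP.proj A ⋙ stableToHo A ≅ GP.incl A ⋙ (gpModel A).toHo :=
  CategoryTheory.Quotient.lift.isLift _ _ _

variable (A) in
/-- The stable functor is the projection on Gorenstein projective modules. -/
def inclStableFunctor : GP.incl A ⋙ stableFunctor A ≅ StableGP.proj A :=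
  NatIso.ofComponents (fun X => by
    let φ : (((GP.incl A).obj X).cover) ⟶ X := ObjectProperty.homMk ((GP.incl A).obj X).π.hom
    have : IsIso ((StableGP.proj A).map φ) := by
      obtain ⟨s, hs⟩ := exists_lift (X := (GP.incl A).obj X) X.property (𝟙 X.obj)
      refine ⟨(StableGP.proj A).map (ObjectProperty.homMk s), ?_, ?_⟩
      · rw [← CategoryTheory.Functor.map_comp, ← CategoryTheory.Functor.map_id]
        refine proj_map_eq ?_
        change (((GP.incl A).obj X).π.hom ≫ s) ≫ ((GP.incl A).obj X).π.hom =
          𝟙 _ ≫ ((GP.incl A).obj X).π.hom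
        rw [Category.assoc, hs, Category.id_comp]
        exact Category.comp_id _
      · rw [← CategoryTheory.Functor.map_comp, ← CategoryTheory.Functor.map_id]
        exact congrArg _ (ObjectProperty.hom_ext _ hs)
    exact @asIso _ _ _ _ ((StableGP.proj A).map φ) this) fun {X Y} f => by
      refine ((StableGP.proj A).map_comp _ _).symm.trans
        (Eq.trans (congrArg _ ?_) ((StableGP.proj A).map_comp _ _))
      exact ObjectProperty.hom_ext _ (coverMap_comp_π ((GP.incl A).map f))

variable (A) in
/-- Precovers are invertible in the homotopy category. -/
def stableFunctorToHo : stableFunctor A ⋙ stableToHo A ≅ (gpModel A).toHo :=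
  NatIso.ofComponents (fun X =>
    @asIso _ _ _ _ ((gpModel A).toHo.map X.π) (weq_iff_isIso_toHo.1 X.weq_π)) fun {X Y} f => by
      refine ((gpModel A).toHo.map_comp _ _).symm.trans
        (Eq.trans (congrArg _ ?_) ((gpModel A).toHo.map_comp _ _))
      exact ObjectProperty.hom_ext _ (coverMap_comp_π f)

variable (A) in
/-- The equivalence between the stable category and the homotopy category. -/
def stableEquiv : StableGP A ≌ HoGP A :=
  CategoryTheory.Equivalence.mk (stableToHo A) (hoToStable A)
    (CategoryTheory.Quotient.natIsoLift _ (Functor.rightUnitor _ ≪≫ (inclStableFunctor A).symm ≪≫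
      Functor.isoWhiskerLeft (GP.incl A) (toHoHoToStable A).symm ≪≫
      (Functor.associator _ _ _).symm ≪≫
      Functor.isoWhiskerRight (projStableToHo A).symm (hoToStable A) ≪≫ Functor.associator _ _ _))
    (Localization.liftNatIso (gpModel A).toHo (gpModel A).weq
      ((gpModel A).toHo ⋙ hoToStable A ⋙ stableToHo A) ((gpModel A).toHo ⋙ 𝟭 _) _ _
      ((Functor.associator _ _ _).symm ≪≫
        Functor.isoWhiskerRight (toHoHoToStable A) (stableToHo A) ≪≫ stableFunctorToHo A ≪≫
        (Functor.rightUnitor _).symm))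

/-- Every morphism in the target of a full and essentially surjective functor is isomorphic to the
image of a morphism. -/
theorem _root_.CategoryTheory.Functor.mapArrow_essSurj {C D : Type*} [Category C] [Category D]
    (F : C ⥤ D) [F.Full] [F.EssSurj] : F.mapArrow.EssSurj where
  mem_essImage f := by
    have e : F.map (F.preimage ((F.objObjPreimageIso f.left).hom ≫ f.hom ≫
        (F.objObjPreimageIso f.right).inv)) ≫ (F.objObjPreimageIso f.right).hom =
        (F.objObjPreimageIso f.left).hom ≫ f.hom := by
      rw [F.map_preimage]; simp
    exact ⟨Arrow.mk _, ⟨Arrow.isoMk (F.objObjPreimageIso f.left)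
      (F.objObjPreimageIso f.right) e.symm⟩⟩

instance : (stableToHo A).IsEquivalence := (stableEquiv A).isEquivalence_functor

instance : (GP.incl A ⋙ (gpModel A).toHo).EssSurj :=
  Functor.essSurj_of_iso (projStableToHo A)

instance : (GP.incl A ⋙ (gpModel A).toHo).Full :=
  Functor.Full.of_iso (projStableToHo A)

/-- Arrows of the homotopy category come from honest morphisms, already between Gorenstein
projectives. This is what allows a distinguished triangle to be matched with a standard one. -/
instance : (gpModel A).toHo.mapArrow.EssSurj where
  mem_essImage f := by
    obtain ⟨g, ⟨e⟩⟩ := (Functor.mapArrow_essSurj (GP.incl A ⋙ (gpModel A).toHo)).mem_essImage f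
    exact ⟨(GP.incl A).mapArrow.obj g, ⟨e⟩⟩

end GPFin

end HomotopyCategory

end

noncomputable section

/-! ### Transport of triangulated structures along equivalences -/

section Transport

section

variable {C D : Type*} [Category C] [Category D] [HasShift C ℤ] [HasShift D ℤ]
  [Preadditive C] [Preadditive D] [HasZeroObject C] [HasZeroObject D]
  [∀ n : ℤ, (shiftFunctor C n).Additive] [∀ n : ℤ, (shiftFunctor D n).Additive]
  [Pretriangulated C]

variable (F : D ⥤ C) [F.CommShift ℤ] [F.Additive]

/-- The pretriangulated structure induced by an equivalence commuting with shifts. -/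
@[reducible]
def pretriangulatedOfEquivalence [F.IsEquivalence] : Pretriangulated D where
  distinguishedTriangles := F.mapTriangle.obj ⁻¹' (distTriang C)
  isomorphic_distinguished T₁ hT₁ T₂ e :=
    isomorphic_distinguished _ hT₁ _ (F.mapTriangle.mapIso e)
  contractible_distinguished X :=
    isomorphic_distinguished _ (contractible_distinguished (F.obj X)) _
      (Triangle.isoMk _ _ (Iso.refl _) (Iso.refl _) F.mapZeroObject
        ((Category.comp_id _).trans ((F.map_id X).trans (Category.id_comp _).symm))
        ((isZero_zero C).eq_of_tgt _ _)
        (((F.map_isZero (isZero_zero D))).eq_of_src _ _))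
  distinguished_cocone_triangle {X Y} f := by
    obtain ⟨Z', g', h', mem⟩ := distinguished_cocone_triangle (F.map f)
    obtain ⟨g, hg⟩ := F.map_surjective (g' ≫ (F.objObjPreimageIso Z').inv)
    obtain ⟨h, hh⟩ := F.map_surjective ((F.objObjPreimageIso Z').hom ≫ h' ≫
      (F.commShiftIso (1 : ℤ)).inv.app X)
    refine ⟨F.objPreimage Z', g, h,
      isomorphic_distinguished _ mem _ (Triangle.isoMk _ _ (Iso.refl _) (Iso.refl _)
        (F.objObjPreimageIso Z') ?_ ?_ ?_)⟩
    · exact (Category.comp_id _).trans (Category.id_comp _).symm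
    · refine Eq.trans ?_ (Category.id_comp _).symm
      change F.map g ≫ (F.objObjPreimageIso Z').hom = g'
      rw [hg, Category.assoc, Iso.inv_hom_id, Category.comp_id]
    · refine (congrArg (_ ≫ ·) ((shiftFunctor C (1 : ℤ)).map_id (F.obj X))).trans
        ((Category.comp_id _).trans ?_)
      change F.map h ≫ (F.commShiftIso (1 : ℤ)).hom.app X = (F.objObjPreimageIso Z').hom ≫ h'
      rw [hh, Category.assoc, Category.assoc, Iso.inv_hom_id_app]
      exact congrArg _ (Category.comp_id _)
  rotate_distinguished_triangle T :=
    (rotate_distinguished_triangle (F.mapTriangle.obj T)).trans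
      (distinguished_iff_of_iso (F.mapTriangleRotateIso.app T))
  complete_distinguished_triangle_morphism T₁ T₂ hT₁ hT₂ a b comm := by
    obtain ⟨c, hc₁, hc₂⟩ := complete_distinguished_triangle_morphism (F.mapTriangle.obj T₁)
      (F.mapTriangle.obj T₂) hT₁ hT₂ (F.map a) (F.map b)
      ((F.map_comp _ _).symm.trans ((congrArg F.map comm).trans (F.map_comp _ _)))
    obtain ⟨c, rfl⟩ : ∃ c' : T₁.obj₃ ⟶ T₂.obj₃, F.map c' = c := F.map_surjective c
    refine ⟨c, F.map_injective ?_, F.map_injective ?_⟩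
    · rw [F.map_comp, F.map_comp]
      exact hc₁
    · rw [F.map_comp, F.map_comp, ← cancel_mono ((F.commShiftIso (1 : ℤ)).hom.app T₂.obj₁),
        Category.assoc, Category.assoc, F.commShiftIso_hom_naturality]
      exact (Category.assoc _ _ _).symm.trans hc₂

end

/-- An equivalence of categories transports triangulated structures. -/
theorem exists_triangulatedStructure {C D : Type*} [Category C] [Category D] (E : C ≌ D)
    [TriangulatedStructure C] :
    ∃ _ : TriangulatedStructure D, IsTriangleEquivalence E ∧ IsTriangleEquivalence E.symm := by
  let hF := E.fullyFaithfulInverse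
  -- The shift of `D` is the shift of `C` conjugated by `E`, which makes `E.inverse` commute with
  -- shifts by construction.
  let s : ℤ → D ⥤ D := fun n => E.inverse ⋙ shiftFunctor C n ⋙ E.functor
  let i : ∀ n, s n ⋙ E.inverse ≅ E.inverse ⋙ shiftFunctor C n := fun n =>
    Functor.associator _ _ _ ≪≫ Functor.isoWhiskerLeft E.inverse (Functor.associator _ _ _ ≪≫
      Functor.isoWhiskerLeft (shiftFunctor C n) E.unitIso.symm ≪≫ Functor.rightUnitor _)
  letI h₁ : Preadditive D := Preadditive.ofFullyFaithful hF
  letI h₂ : HasShift D ℤ := hF.hasShift s i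
  letI h₃ : E.inverse.CommShift ℤ := Functor.CommShift.ofHasShiftOfFullyFaithful hF s i
  haveI h₄ : E.inverse.Additive := hF.additive_ofFullyFaithful
  haveI h₅ : HasZeroObject D := by
    obtain ⟨Z, hZ⟩ := HasZeroObject.zero (C := C)
    exact ⟨E.functor.obj Z, (IsZero.iff_id_eq_zero _).2 (hF.map_injective
      ((hZ.of_iso (E.unitIso.app Z).symm).eq_of_src _ _))⟩
  haveI h₆ : ∀ n : ℤ, (shiftFunctor D n).Additive := fun n => by
    haveI : E.symm.functor.Additive := h₄
    haveI : E.functor.Additive := E.symm.inverse_additive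
    exact inferInstanceAs ((E.inverse ⋙ shiftFunctor C n ⋙ E.functor).Additive)
  letI h₇ : Pretriangulated D := pretriangulatedOfEquivalence E.inverse
  haveI h₈ : E.inverse.IsTriangulated := ⟨fun T hT => hT⟩
  haveI h₉ : IsTriangulated D := IsTriangulated.of_fully_faithful_triangulated_functor E.inverse
  refine ⟨⟨h₁, h₅, h₂, h₆, h₇, h₉⟩, ?_, ?_⟩
  · letI := E.commShiftFunctor ℤ
    haveI := E.commShift_of_inverse ℤ
    have := CategoryTheory.Equivalence.IsTriangulated.mk'' E h₈
    exact ⟨inferInstance, inferInstance⟩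
  · exact ⟨h₃, h₈⟩

end Transport

end

noncomputable section

/-! ### Transport of standard triangulations -/

section StandardTransport

variable {A B : Type u} [Ring A] [Ring B] {𝓔 : ObjectProperty (FGModuleCat.{u} A)}
  {𝓔' : ObjectProperty (FGModuleCat.{u} B)} {𝒲 : ObjectProperty (FGModuleCat.{u} A)}
  {𝒲' : ObjectProperty (FGModuleCat.{u} B)}

/-- An exact functor which respects trivial and Gorenstein projective objects. -/
structure IsExactFunctor (𝒲 : ObjectProperty (FGModuleCat.{u} A))
    (𝒲' : ObjectProperty (FGModuleCat.{u} B)) (G : 𝓔'.FullSubcategory ⥤ 𝓔.FullSubcategory) :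
    Prop where
  map_ses : ∀ {X Y Z : 𝓔'.FullSubcategory} (f : X ⟶ Y) (g : Y ⟶ Z),
    IsShortExact f.hom g.hom → IsShortExact (G.map f).hom (G.map g).hom
  trivial : ∀ X, 𝒲' X.obj → 𝒲 (G.obj X).obj
  gorenstein : ∀ X, gorensteinProjective B X.obj → gorensteinProjective A (G.obj X).obj

variable {G : 𝓔'.FullSubcategory ⥤ 𝓔.FullSubcategory}

/-- The image of a suspension sequence. -/
def SuspensionSequence.map (hG : IsExactFunctor 𝒲 𝒲' G) {X : 𝓔'.FullSubcategory}
    (s : SuspensionSequence 𝒲' X) : SuspensionSequence 𝒲 (G.obj X) where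
  W := G.obj s.W
  S := G.obj s.S
  j := G.map s.j
  q := G.map s.q
  shortExact := hG.map_ses _ _ s.shortExact
  trivial := hG.trivial _ s.trivial
  gorenstein := hG.gorenstein _ s.gorenstein

/-- The image of a standard triangle. -/
def StandardTriangle.map (hG : IsExactFunctor 𝒲 𝒲' G) (Δ : StandardTriangle (𝓔 := 𝓔') 𝒲') :
    StandardTriangle (𝓔 := 𝓔) 𝒲 where
  X := G.obj Δ.X
  Y := G.obj Δ.Y
  C := G.obj Δ.C
  susp := Δ.susp.map hG
  u := G.map Δ.u
  v := G.map Δ.v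
  w := G.map Δ.w
  t := G.map Δ.t
  shortExact := hG.map_ses _ _ Δ.shortExact
  comm_left := (G.map_comp _ _).symm.trans ((congrArg G.map Δ.comm_left).trans (G.map_comp _ _))
  comm_right := (G.map_comp _ _).symm.trans (congrArg G.map Δ.comm_right)

/-- Every morphism has a standard triangle. -/
def HasStandardTriangles (𝓔 𝒲 : ObjectProperty (FGModuleCat.{u} A)) : Prop :=
  ∀ {X Y : 𝓔.FullSubcategory} (u : X ⟶ Y), ∃ (C : 𝓔.FullSubcategory)
    (s : SuspensionSequence 𝒲 X) (v : Y ⟶ C) (w : C ⟶ s.S) (t : s.W ⟶ C),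
    IsShortExact v.hom w.hom ∧ s.j ≫ t = u ≫ v ∧ t ≫ w = s.q

/-- Given an isomorphism `σ` between suspensions and shifts such that the images of standard
triangles are distinguished, the distinguished triangles are the images of standard triangles. -/
theorem distinguished_iff_of_standard {T : Type*} [Category T] [TriangulatedStructure T]
    (L : 𝓔.FullSubcategory ⥤ T) [L.mapArrow.EssSurj]
    (σ : ∀ {X : 𝓔.FullSubcategory} (s : SuspensionSequence 𝒲 X), L.obj s.S ≅ (L.obj X)⟦(1 : ℤ)⟧)
    (hσ : ∀ Δ : StandardTriangle (𝓔 := 𝓔) 𝒲, Triangle.mk (L.map Δ.u) (L.map Δ.v)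
      (L.map Δ.w ≫ (σ Δ.susp).hom) ∈ distTriang T) (h : HasStandardTriangles 𝓔 𝒲)
    (D : Triangle T) : D ∈ distTriang T ↔ ∃ Δ : StandardTriangle (𝓔 := 𝓔) 𝒲, Nonempty (D ≅
      Triangle.mk (L.map Δ.u) (L.map Δ.v) (L.map Δ.w ≫ (σ Δ.susp).hom)) := by
  refine ⟨fun hD => ?_, fun ⟨Δ, ⟨e⟩⟩ => isomorphic_distinguished _ (hσ Δ) _ e⟩
  -- It suffices to realize `D.mor₁`: distinguished triangles with isomorphic first morphisms are
  -- isomorphic.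
  obtain ⟨X, Y, u, e₁, e₂, w⟩ : ∃ (X Y : 𝓔.FullSubcategory) (u : X ⟶ Y) (e₁ : L.obj X ≅ D.obj₁)
      (e₂ : L.obj Y ≅ D.obj₂), L.map u ≫ e₂.hom = e₁.hom ≫ D.mor₁ := by
    let e := L.mapArrow.objObjPreimageIso (Arrow.mk D.mor₁)
    exact ⟨_, _, _, Arrow.leftFunc.mapIso e, Arrow.rightFunc.mapIso e, e.hom.w.symm⟩
  obtain ⟨C, s, v, w', t, h₁, h₂, h₃⟩ := h u
  exact ⟨⟨X, Y, C, s, u, v, w', t, h₁, h₂, h₃⟩,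
    ⟨(isoTriangleOfIso₁₂ _ _ (hσ ⟨X, Y, C, s, u, v, w', t, h₁, h₂, h₃⟩) hD e₁ e₂ w).symm⟩⟩

/-- Naturality of a suspension isomorphism is preserved by `F`. The tail `f` makes the equality
usable inside longer composites. -/
theorem _root_.CategoryTheory.Functor.map_commShift_comp {C D : Type*} [Category C] [Category D]
    [HasShift C ℤ] [HasShift D ℤ] (F : C ⥤ D) [F.CommShift ℤ] {X X' S S' : C}
    {σ : S ⟶ X⟦(1 : ℤ)⟧} {σ' : S' ⟶ X'⟦(1 : ℤ)⟧} {a : X ⟶ X'} {c : S ⟶ S'}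
    (h : c ≫ σ' = σ ≫ a⟦(1 : ℤ)⟧') {Z : D} (f : (F.obj X')⟦(1 : ℤ)⟧ ⟶ Z) :
    F.map c ≫ F.map σ' ≫ (F.commShiftIso (1 : ℤ)).hom.app X' ≫ f =
      F.map σ ≫ (F.commShiftIso (1 : ℤ)).hom.app X ≫ (F.map a)⟦(1 : ℤ)⟧' ≫ f := by
  have e₃ := F.commShiftIso_hom_naturality a (1 : ℤ)
  rw [← F.map_comp_assoc, h, F.map_comp_assoc, reassoc_of% e₃]

/-- Transport of a standard triangulation along a triangulated functor. -/
theorem StandardTriangulation.transport (hG : IsExactFunctor 𝒲 𝒲' G) [G.Additive]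
    {T T' : Type*} [Category T] [Category T'] [TriangulatedStructure T]
    [TriangulatedStructure T'] {L : 𝓔.FullSubcategory ⥤ T} (St : StandardTriangulation 𝒲 L)
    {F : T ⥤ T'} (hF : ∃ _ : F.CommShift ℤ, F.IsTriangulated) {L' : 𝓔'.FullSubcategory ⥤ T'}
    [L'.mapArrow.EssSurj] (i : L' ≅ G ⋙ L ⋙ F) (h : HasStandardTriangles 𝓔' 𝒲') :
    Nonempty (StandardTriangulation 𝒲' L') := by
  obtain ⟨_, _⟩ := hF
  let σ : ∀ {X : 𝓔'.FullSubcategory} (s : SuspensionSequence 𝒲' X),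
      L'.obj s.S ≅ (L'.obj X)⟦(1 : ℤ)⟧ := fun {X} s =>
    i.app s.S ≪≫ F.mapIso (St.σ (s.map hG)) ≪≫ (F.commShiftIso (1 : ℤ)).app (L.obj (G.obj X)) ≪≫
      (shiftFunctor T' (1 : ℤ)).mapIso (i.app X).symm
  have hσ : ∀ {X : 𝓔'.FullSubcategory} (s : SuspensionSequence 𝒲' X), (σ s).hom =
      i.hom.app s.S ≫ F.map (St.σ (s.map hG)).hom ≫
        (F.commShiftIso (1 : ℤ)).hom.app (L.obj (G.obj X)) ≫ (i.inv.app X)⟦(1 : ℤ)⟧' :=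
    fun s => rfl
  refine ⟨⟨?_, σ, ?_, distinguished_iff_of_standard L' σ ?_ h⟩⟩
  · have := St.additive
    exact Functor.additive_of_iso i.symm
  · intro X X' s s' a b c h₁ h₂
    have e := St.σ_naturality (s.map hG) (s'.map hG) (G.map a) (G.map b) (G.map c)
      ((G.map_comp _ _).symm.trans ((congrArg G.map h₁).trans (G.map_comp _ _)))
      ((G.map_comp _ _).symm.trans ((congrArg G.map h₂).trans (G.map_comp _ _)))
    have e₁ := i.hom.naturality c
    have e₂ := i.inv.naturality a
    rw [hσ, hσ, reassoc_of% e₁, Category.assoc, Category.assoc, Category.assoc,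
      ← CategoryTheory.Functor.map_comp (shiftFunctor T' (1 : ℤ)), ← e₂,
      CategoryTheory.Functor.map_comp (shiftFunctor T' (1 : ℤ))]
    congr 1
    exact F.map_commShift_comp e _
  · intro Δ
    refine isomorphic_distinguished _ (F.map_distinguished _ ((St.distinguished_iff _).2
      ⟨Δ.map hG, ⟨Iso.refl _⟩⟩)) _ (Triangle.isoMk _ _ (i.app _) (i.app _) (i.app _)
        (i.hom.naturality _) (i.hom.naturality _) ?_)
    change (L'.map Δ.w ≫ (σ Δ.susp).hom) ≫ (i.hom.app Δ.X)⟦(1 : ℤ)⟧' = i.hom.app Δ.C ≫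
      F.map (L.map (G.map Δ.w) ≫ (St.σ (Δ.susp.map hG)).hom) ≫
        (F.commShiftIso (1 : ℤ)).hom.app (L.obj (G.obj Δ.X))
    have e₁ := i.hom.naturality Δ.w
    have e₂ : (i.inv.app Δ.X)⟦(1 : ℤ)⟧' ≫ (i.hom.app Δ.X)⟦(1 : ℤ)⟧' = 𝟙 _ := by
      rw [← CategoryTheory.Functor.map_comp, Iso.inv_hom_id_app]
      exact CategoryTheory.Functor.map_id _ _
    rw [hσ, Category.assoc, Category.assoc, Category.assoc, Category.assoc, e₂, reassoc_of% e₁]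
    refine congrArg (i.hom.app Δ.C ≫ ·) (Eq.trans ?_
      (congrArg (· ≫ _) (F.map_comp (L.map (G.map Δ.w)) (St.σ (Δ.susp.map hG)).hom).symm))
    exact (congrArg (fun z => _ ≫ _ ≫ z) (Category.comp_id _)).trans (Category.assoc _ _ _).symm

end StandardTransport

end

noncomputable section

/-! ### Totally acyclic cochain complexes -/

section CompleteResolutions

open FGModuleCat

variable {A : Type u} [Ring A]

/-- A totally acyclic cochain complex of finitely generated projective modules. -/
structure IsTAC (K : CochainComplex (FGModuleCat.{u} A) ℤ) : Prop where
  projective : ∀ n, fgProjective A (K.X n)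
  exact : ∀ i j k, i + 1 = j → j + 1 = k → ∀ x : K.X j, (K.d j k).hom.hom x = 0 →
    ∃ y, (K.d i j).hom.hom y = x
  extend : ∀ i j k, i + 1 = j → j + 1 = k → ∀ Q : FGModuleCat.{u} A, fgProjective A Q →
    ∀ f : K.X j ⟶ Q, K.d i j ≫ f = 0 → ∃ g : K.X k ⟶ Q, K.d j k ≫ g = f

variable [IsNoetherianRing A]

/-- The module of `n`-cycles of a cochain complex. -/
def cyc (K : CochainComplex (FGModuleCat.{u} A) ℤ) (n : ℤ) : FGModuleCat.{u} A :=
  of A (LinearMap.ker (K.d n (n + 1)).hom.hom)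

/-- The inclusion of the cycles. -/
def cycι (K : CochainComplex (FGModuleCat.{u} A) ℤ) (n : ℤ) : cyc K n ⟶ K.X n :=
  mkHom (X := of A (LinearMap.ker (K.d n (n + 1)).hom.hom)) (Submodule.subtype _)

section

variable {K L M : CochainComplex (FGModuleCat.{u} A) ℤ} {n : ℤ}

theorem cycι_injective : Function.Injective (cycι K n).hom.hom := Subtype.val_injective

theorem cycι_d : cycι K n ≫ K.d n (n + 1) = 0 := ext' fun x => x.2

theorem exists_cyc {x : K.X n} (hx : (K.d n (n + 1)).hom.hom x = 0) :
    ∃ y, (cycι K n).hom.hom y = x := ⟨⟨x, hx⟩, rfl⟩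

/-- A morphism to the cycles. -/
def cycLift {T : FGModuleCat.{u} A} (f : T ⟶ K.X n) (hf : f ≫ K.d n (n + 1) = 0) : T ⟶ cyc K n :=
  mkHom (Y := of A (LinearMap.ker (K.d n (n + 1)).hom.hom))
    (LinearMap.codRestrict _ f.hom.hom fun x => congr_apply hf x)

theorem cycLift_ι {T : FGModuleCat.{u} A} (f : T ⟶ K.X n) (hf : f ≫ K.d n (n + 1) = 0) :
    cycLift f hf ≫ cycι K n = f := rfl

variable (n) in
/-- The map induced on cycles. -/
def cycMap (φ : K ⟶ L) : cyc K n ⟶ cyc L n :=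
  cycLift (cycι K n ≫ φ.f n) (by
    rw [Category.assoc, φ.comm, ← Category.assoc, cycι_d, zero_comp])

theorem cycMap_ι (φ : K ⟶ L) : cycMap n φ ≫ cycι L n = cycι K n ≫ φ.f n := rfl

theorem cyc_hom_ext {T : FGModuleCat.{u} A} {f g : T ⟶ cyc K n} (h : f ≫ cycι K n = g ≫ cycι K n) :
    f = g := mono_cancel cycι_injective h

end

namespace IsTAC

variable {K L : CochainComplex (FGModuleCat.{u} A) ℤ}

theorem isShortExact_cyc (hK : IsTAC K) (n : ℤ) :
    IsShortExact (cycι K n) (cycLift (K.d n (n + 1)) (K.d_comp_d _ _ _)) where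
  injective := cycι_injective
  exact x := ⟨fun hx => exists_cyc (congrArg (cycι K (n + 1)).hom.hom hx), by
    rintro ⟨y, rfl⟩
    exact cycι_injective (congr_apply cycι_d y)⟩
  surjective z := by
    obtain ⟨x, hx⟩ := hK.exact n (n + 1) (n + 1 + 1) rfl rfl _ z.2
    exact ⟨x, cycι_injective hx⟩

theorem extVanish_cyc (hK : IsTAC K) (n : ℤ) {Q : FGModuleCat.{u} A} (hQ : fgProjective A Q) :
    ExtVanish (cyc K n) Q := by
  obtain ⟨n, rfl⟩ : ∃ m, n = m + 1 := ⟨n - 1, by ring⟩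
  obtain ⟨n, rfl⟩ : ∃ m, n = m + 1 := ⟨n - 1, by ring⟩
  refine ExtVanish.of_presentation (hK.projective (n + 1)) (hK.isShortExact_cyc (n + 1))
    fun u => ?_
  obtain ⟨g, hg⟩ := hK.extend (n - 1) n (n + 1) (by ring) rfl Q hQ
    (cycLift (K.d n (n + 1)) (K.d_comp_d _ _ _) ≫ u) (by
      have h : K.d (n - 1) n ≫ cycLift (K.d n (n + 1)) (K.d_comp_d n (n + 1) (n + 1 + 1)) = 0 :=
        cyc_hom_ext (Eq.trans (K.d_comp_d _ _ _) zero_comp.symm)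
      rw [← Category.assoc, h, zero_comp])
  refine ⟨g, epi_cancel (hK.isShortExact_cyc n).surjective ?_⟩
  rw [← hg, ← Category.assoc, cycLift_ι]

/-- Exactness allows to lift morphisms from projective modules. -/
theorem exists_lift (hK : IsTAC K) (i j k : ℤ) (hij : i + 1 = j) (hjk : j + 1 = k)
    {P : FGModuleCat.{u} A} (hP : fgProjective A P) (f : P ⟶ K.X j) (hf : f ≫ K.d j k = 0) :
    ∃ g : P ⟶ K.X i, g ≫ K.d i j = f := by
  obtain rfl := hij
  obtain rfl := hjk
  obtain ⟨g, hg⟩ := hP.exists_lift (cycLift f hf) _ (hK.isShortExact_cyc i).surjective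
  refine ⟨g, ?_⟩
  rw [← cycLift_ι f hf, ← hg, Category.assoc, cycLift_ι]

/-- The next and the preceding cycles are a cosyzygy and a syzygy, so the cycles of all such
complexes form a class for `coinduction`. -/
theorem gorensteinProjective_cyc (hK : IsTAC K) (n : ℤ) : gorensteinProjective A (cyc K n) := by
  refine gorensteinProjective.coinduction (fun X => ∃ (K : CochainComplex (FGModuleCat.{u} A) ℤ)
    (_ : IsTAC K) (n : ℤ), X = cyc K n) ?_ ?_ ?_ _ ⟨K, hK, n, rfl⟩
  · rintro _ ⟨K, hK, n, rfl⟩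
    exact ⟨_, _, _, _, hK.projective n, ⟨K, hK, n + 1, rfl⟩, hK.isShortExact_cyc n⟩
  · rintro _ ⟨K, hK, n, rfl⟩
    obtain ⟨n, rfl⟩ : ∃ m, n = m + 1 := ⟨n - 1, by ring⟩
    exact ⟨_, _, _, _, hK.projective n, ⟨K, hK, n, rfl⟩, hK.isShortExact_cyc n⟩
  · rintro _ Q ⟨K, hK, n, rfl⟩ hQ
    exact hK.extVanish_cyc n hQ

end IsTAC

/-- A Gorenstein projective module has a complete resolution. -/
theorem gorensteinProjective.exists_completeResolution {X : FGModuleCat.{u} A}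
    (hX : gorensteinProjective A X) : ∃ K : CochainComplex (FGModuleCat.{u} A) ℤ, IsTAC K ∧
      Nonempty (cyc K 0 ≅ X) := by
  obtain ⟨s, hs0, hs⟩ := exists_int_chain
    (α := fun _ => {X : FGModuleCat.{u} A // gorensteinProjective A X})
    (fun _ a b => ∃ (P : FGModuleCat.{u} A) (i : a.1 ⟶ P) (p : P ⟶ b.1),
      fgProjective A P ∧ IsShortExact i p)
    (fun _ a => by
      obtain ⟨P, X', i, p, hP, hX', h⟩ := a.2.exists_cosyzygy
      exact ⟨⟨X', hX'⟩, P, i, p, hP, h⟩)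
    (fun _ b => by
      obtain ⟨P, X', i, p, hP, hX', h⟩ := b.2.exists_syzygy
      exact ⟨⟨X', hX'⟩, P, i, p, hP, h⟩) ⟨X, hX⟩
  choose P i p hP hip using hs
  let K : CochainComplex (FGModuleCat.{u} A) ℤ := CochainComplex.of P
    (fun n => p n ≫ i (n + 1)) fun n => by
      rw [Category.assoc, ← Category.assoc (i (n + 1)), (hip (n + 1)).comp_zero]
      simp
  have hd : ∀ n, K.d n (n + 1) = p n ≫ i (n + 1) := fun n =>
    CochainComplex.of_d P (fun n => p n ≫ i (n + 1)) n
  have hK : IsTAC K := by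
    refine ⟨hP, ?_, ?_⟩
    · rintro n _ _ rfl rfl x hx
      rw [hd] at hx ⊢
      obtain ⟨z, hz⟩ := (hip (n + 1)).exists_of_zero
        ((hip (n + 1 + 1)).injective (hx.trans (map_zero _).symm))
      obtain ⟨y, rfl⟩ := (hip n).surjective z
      exact ⟨y, hz⟩
    · rintro n _ _ rfl rfl Q hQ f hf
      rw [hd] at hf ⊢
      obtain ⟨g₁, hg₁⟩ := (hip (n + 1)).exists_desc f (epi_cancel (hip n).surjective (by
        rw [comp_zero, ← Category.assoc]; exact hf))
      obtain ⟨g, hg⟩ := (s (n + 1 + 1 + 1)).2.extVanish hQ _ _ (hip (n + 1 + 1)) g₁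
      exact ⟨g, by rw [Category.assoc, hg, hg₁]⟩
  refine ⟨K, hK, ?_⟩
  have eX : (s 0).1 = X := congrArg Subtype.val hs0
  rw [← eX]
  have hi : i 0 ≫ K.d 0 (0 + 1) = 0 := by
    rw [hd, ← Category.assoc, (hip 0).comp_zero, zero_comp]
  obtain ⟨b, hb⟩ := (hip 0).exists_lift (cycι K 0) (mono_cancel (hip (0 + 1)).injective (by
    rw [zero_comp, Category.assoc, ← hd]
    exact cycι_d))
  refine ⟨⟨b, cycLift (i 0) hi, cyc_hom_ext ?_, mono_cancel (hip 0).injective ?_⟩⟩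
  · rw [Category.assoc, cycLift_ι, hb, Category.id_comp]
  · rw [Category.assoc, hb, cycLift_ι, Category.id_comp]

namespace IsTAC

variable {K L : CochainComplex (FGModuleCat.{u} A) ℤ}

/-- Morphisms between cycles extend to chain maps. -/
theorem exists_cycMap_eq (hK : IsTAC K) (hL : IsTAC L) (f : cyc K 0 ⟶ cyc L 0) :
    ∃ φ : K ⟶ L, cycMap 0 φ = f := by
  obtain ⟨φ₀, hφ₀⟩ := (hK.gorensteinProjective_cyc (0 + 1)).extVanish (hL.projective 0) _ _
    (hK.isShortExact_cyc 0) (f ≫ cycι L 0)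
  -- The condition carried along says that `g` maps boundaries to cycles. It is what lets `g` be
  -- extended one degree up by `extend` and one degree down by exactness.
  obtain ⟨φ, h₀, hφ⟩ := exists_int_chain
    (α := fun n => {g : K.X n ⟶ L.X n // ∀ m, m + 1 = n → K.d m n ≫ g ≫ L.d n (n + 1) = 0})
    (fun n g h => g.1 ≫ L.d n (n + 1) = K.d n (n + 1) ≫ h.1)
    (fun n g => by
      obtain ⟨h, hh⟩ := hK.extend (n - 1) n (n + 1) (by ring) rfl _ (hL.projective (n + 1))
        (g.1 ≫ L.d n (n + 1)) (g.2 _ (by ring))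
      refine ⟨⟨h, fun m hm => ?_⟩, hh.symm⟩
      obtain rfl : m = n := by linarith
      rw [← Category.assoc, hh, Category.assoc, L.d_comp_d, comp_zero])
    (fun n h => by
      have e := h.2 n rfl
      obtain ⟨g, hg⟩ := hL.exists_lift n (n + 1) (n + 1 + 1) rfl rfl (hK.projective n)
        (K.d n (n + 1) ≫ h.1) (by rw [Category.assoc, e])
      exact ⟨⟨g, fun m hm => by rw [hg, ← Category.assoc, K.d_comp_d, zero_comp]⟩, hg⟩)
    ⟨φ₀, fun m hm => by
      have e : K.d m 0 = cycLift (K.d m 0) (K.d_comp_d _ _ _) ≫ cycι K 0 := rfl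
      rw [e, Category.assoc, ← Category.assoc (cycι K 0), hφ₀, Category.assoc, cycι_d, comp_zero,
        comp_zero]⟩
  refine ⟨{ f := fun n => (φ n).1, comm' := ?_ }, cyc_hom_ext ?_⟩
  · rintro n _ rfl
    exact hφ n
  · rw [cycMap_ι]
    change cycι K 0 ≫ (φ 0).1 = _
    rw [h₀, hφ₀]

/-- A chain map is null-homotopic if the map on cycles factors through a projective module. -/
theorem exists_homotopy (hK : IsTAC K) (hL : IsTAC L) (φ : K ⟶ L)
    (h : FactorsThroughProjective (cycMap 0 φ)) : Nonempty (Homotopy φ 0) := by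
  obtain ⟨Q, a, b, hQ, hab⟩ := h
  -- Extending `a` to degree `0` of `K` and lifting `b` to degree `-1` of `L` gives the degree `0`
  -- component `a' ≫ b'` of the homotopy.
  obtain ⟨a', rfl⟩ := (hK.gorensteinProjective_cyc (0 + 1)).extVanish hQ _ _
    (hK.isShortExact_cyc 0) a
  obtain ⟨b', hb'⟩ := hL.exists_lift (0 - 1) 0 (0 + 1) rfl rfl hQ (b ≫ cycι L 0)
    (by rw [Category.assoc, cycι_d, comp_zero])
  -- The invariant is that `g ≫ d` and `φ` agree on boundaries, so their difference extends to the
  -- next degree. The isomorphisms `XIsoOfEq` bridge `n + 1 - 1` and `n`.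
  obtain ⟨η, -, hη⟩ := exists_int_chain
    (α := fun n => {g : K.X n ⟶ L.X (n - 1) //
      ∀ m, m + 1 = n → K.d m n ≫ g ≫ L.d (n - 1) n = K.d m n ≫ φ.f n})
    (fun n g h => φ.f n = g.1 ≫ L.d (n - 1) n + K.d n (n + 1) ≫ h.1 ≫
      (L.XIsoOfEq (add_sub_cancel_right n 1)).hom)
    (fun n g => by
      obtain ⟨h, hh⟩ := hK.extend (n - 1) n (n + 1) (by ring) rfl _ (hL.projective n)
        (φ.f n - g.1 ≫ L.d (n - 1) n) (by rw [Preadditive.comp_sub, g.2 _ (by ring), sub_self])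
      refine ⟨⟨h ≫ (L.XIsoOfEq (add_sub_cancel_right n 1)).inv, fun m hm => ?_⟩, ?_⟩
      · obtain rfl : m = n := by linarith
        rw [Category.assoc, HomologicalComplex.XIsoOfEq_inv_comp_d, reassoc_of% hh,
          Preadditive.sub_comp, Category.assoc, L.d_comp_d, comp_zero, sub_zero, φ.comm]
      · simp [hh])
    (fun n h => by
      have e := h.2 n rfl
      obtain ⟨g, hg⟩ := hL.exists_lift (n - 1) n (n + 1) (by ring) rfl (hK.projective n)
        (φ.f n - K.d n (n + 1) ≫ h.1 ≫ (L.XIsoOfEq (add_sub_cancel_right n 1)).hom) (by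
          rw [Preadditive.sub_comp, Category.assoc, Category.assoc,
            HomologicalComplex.XIsoOfEq_hom_comp_d, e, φ.comm, sub_self])
      refine ⟨⟨g, fun m hm => ?_⟩, ?_⟩
      · rw [hg, Preadditive.comp_sub, ← Category.assoc (K.d m n), K.d_comp_d, zero_comp, sub_zero]
      · rw [hg, sub_add_cancel])
    ⟨a' ≫ b', fun m hm => by
      have e : K.d m 0 = cycLift (K.d m 0) (K.d_comp_d _ _ _) ≫ cycι K 0 := rfl
      have e' : cycι K 0 ≫ a' ≫ b' ≫ L.d (0 - 1) 0 = cycι K 0 ≫ φ.f 0 := by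
        rw [hb', ← cycMap_ι, hab, Category.assoc, Category.assoc]
      rw [e, Category.assoc, Category.assoc, Category.assoc, e']⟩
  let H : ∀ i j, K.X i ⟶ L.X j := fun i j =>
    if h : j + 1 = i then (η i).1 ≫ (L.XIsoOfEq (eq_sub_of_add_eq h).symm).hom else 0
  refine ⟨{ hom := H, zero := fun i j hij => dif_neg hij, comm := fun n => ?_ }⟩
  rw [dNext_eq H (show (ComplexShape.up ℤ).Rel n (n + 1) from rfl),
    prevD_eq H (show (ComplexShape.up ℤ).Rel (n - 1) n from sub_add_cancel n 1)]
  have h₁ : H (n + 1) n = (η (n + 1)).1 ≫ (L.XIsoOfEq (add_sub_cancel_right n 1)).hom :=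
    dif_pos rfl
  have h₂ : H n (n - 1) = (η n).1 := (dif_pos (sub_add_cancel n 1)).trans (by simp)
  rw [h₁, h₂]
  refine (hη n).trans ?_
  simp [add_comm]

/-- Homotopic chain maps induce the same stable morphism on cycles. -/
theorem factorsThroughProjective_of_homotopy (hL : IsTAC L) {φ ψ : K ⟶ L} (h : Homotopy φ ψ) :
    FactorsThroughProjective (cycMap 0 φ - cycMap 0 ψ) := by
  refine ⟨L.X (-1), cycι K 0 ≫ h.hom 0 (-1), cycLift (L.d (-1) 0) (L.d_comp_d _ _ _),
    hL.projective _, cyc_hom_ext ?_⟩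
  have e := h.comm 0
  rw [dNext_eq _ (show (ComplexShape.up ℤ).Rel 0 (0 + 1) from rfl),
    prevD_eq _ (show (ComplexShape.up ℤ).Rel (-1) 0 from rfl)] at e
  rw [Category.assoc, cycLift_ι, Preadditive.sub_comp, cycMap_ι, cycMap_ι, e]
  simp only [Preadditive.comp_add, Category.assoc, add_sub_cancel_right]
  rw [← Category.assoc, cycι_d, zero_comp, zero_add]

end IsTAC

end CompleteResolutions

end

noncomputable section

/-! ### The triangulated category of totally acyclic complexes. -/

section

open FGModuleCat

variable {A : Type u} [Ring A] [IsNoetherianRing A]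

namespace IsTAC

variable {K L : CochainComplex (FGModuleCat.{u} A) ℤ}

/-- Shifting a complex multiplies its differentials by a sign. This and `extend_units_smul` show
that signs affect neither exactness nor extension. -/
theorem exact_units_smul {X Y Z : FGModuleCat.{u} A} {f : X ⟶ Y} {g : Y ⟶ Z} (u : ℤˣ)
    (h : ∀ x, g.hom.hom x = 0 → ∃ y, f.hom.hom y = x) (x : Y) (hx : (u • g).hom.hom x = 0) :
    ∃ y, (u • f).hom.hom y = x := by
  obtain rfl | rfl := Int.units_eq_one_or u
  · rw [one_smul] at hx ⊢
    exact h x hx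
  · rw [Units.neg_smul, one_smul] at hx ⊢
    obtain ⟨y, hy⟩ := h x (neg_eq_zero.1 hx)
    exact ⟨-y, by rw [map_neg, neg_apply', neg_neg, hy]⟩

theorem extend_units_smul {X Y Z Q : FGModuleCat.{u} A} {f : X ⟶ Y} {g : Y ⟶ Z} (u : ℤˣ)
    (h : ∀ a : Y ⟶ Q, f ≫ a = 0 → ∃ b, g ≫ b = a) (a : Y ⟶ Q) (ha : (u • f) ≫ a = 0) :
    ∃ b, (u • g) ≫ b = a := by
  obtain rfl | rfl := Int.units_eq_one_or u
  · rw [one_smul] at ha ⊢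
    exact h a ha
  · rw [Units.neg_smul, one_smul] at ha ⊢
    obtain ⟨b, hb⟩ := h a (neg_eq_zero.1 ((Preadditive.neg_comp _ _).symm.trans ha))
    exact ⟨-b, by rw [Preadditive.neg_comp_neg, hb]⟩

theorem shift (hK : IsTAC K) (n : ℤ) : IsTAC (K⟦n⟧) where
  projective i := hK.projective _
  exact i j k hij hjk := exact_units_smul (f := K.d (i + n) (j + n)) (g := K.d (j + n) (k + n))
    n.negOnePow (hK.exact _ _ _ (by lia) (by lia))
  extend i j k hij hjk Q hQ := extend_units_smul (f := K.d (i + n) (j + n))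
    (g := K.d (j + n) (k + n)) n.negOnePow (hK.extend _ _ _ (by lia) (by lia) Q hQ)


open CochainComplex CochainComplex.HomComplex

/-- In degree `n` the cone is `K.X (n + 1) ⊕ L.X n`. A cocycle is bounded by solving in `K` first
and then in `L`; a map to `Q` is extended by solving on `L` first and then on `K`. -/
theorem isTAC_mappingCone (hK : IsTAC K) (hL : IsTAC L) (φ : K ⟶ L) : IsTAC (CochainComplex.mappingCone φ) where
  projective n := by
    refine ((hK.projective (n + 1)).sum (hL.projective n)).of_retract
      ((mappingCone.fst φ).1.v n (n + 1) rfl ≫ inl _ _ +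
        (mappingCone.snd φ).v n n (add_zero n) ≫ inr _ _)
      (desc ((mappingCone.inl φ).v (n + 1) n (by lia)) ((mappingCone.inr φ).f n)) ?_
    rw [Preadditive.add_comp, Category.assoc, Category.assoc, inl_desc, inr_desc,
      mappingCone.id_X]
  exact := by
    rintro n _ _ rfl rfl x hx
    have e₁ := congr_apply (mappingCone.d_fst_v φ (n + 1) (n + 1 + 1) (n + 1 + 1 + 1) rfl rfl) x
    have e₂ := congr_apply (mappingCone.d_snd_v φ (n + 1) (n + 1 + 1) rfl) x
    have e₃ := congr_apply (mappingCone.id_X φ (n + 1) (n + 1 + 1) rfl) x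
    simp only [comp_app, add_apply', neg_apply'] at e₁ e₂ e₃
    rw [hx, map_zero] at e₁ e₂
    obtain ⟨a, ha⟩ := hK.exact (n + 1) _ _ rfl rfl _ (neg_eq_zero.1 e₁.symm)
    have e₄ := congr_apply (φ.comm (n + 1) (n + 1 + 1)) a
    simp only [comp_app] at e₄
    obtain ⟨b, hb⟩ := hL.exact n _ _ rfl rfl ((φ.f (n + 1)).hom.hom a +
      ((mappingCone.snd φ).v (n + 1) (n + 1) (add_zero _)).hom.hom x) (by
        rw [map_add, e₄, ha]
        exact e₂.symm)
    refine ⟨((mappingCone.inr φ).f n).hom.hom b -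
      ((mappingCone.inl φ).v (n + 1) n (by lia)).hom.hom a, ?_⟩
    have e₅ := congr_apply (mappingCone.inl_v_d φ (n + 1) n (n + 1 + 1) (by lia) (by lia)) a
    have e₆ := congr_apply ((mappingCone.inr φ).comm n (n + 1)) b
    simp only [comp_app, sub_apply'] at e₅ e₆
    rw [map_sub, e₅, e₆, hb, map_add, ha]
    refine Eq.trans ?_ e₃
    abel
  extend := by
    rintro n _ _ rfl rfl Q hQ f hf
    obtain ⟨g₂, hg₂⟩ := hL.extend n (n + 1) (n + 1 + 1) rfl rfl Q hQ
      ((mappingCone.inr φ).f (n + 1) ≫ f) (by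
        rw [← Category.assoc, ← (mappingCone.inr φ).comm, Category.assoc, hf, comp_zero])
    obtain ⟨g₁, hg₁⟩ := hK.extend (n + 1) (n + 1 + 1) (n + 1 + 1 + 1) rfl rfl Q hQ
      (φ.f (n + 1 + 1) ≫ g₂ - (mappingCone.inl φ).v (n + 1 + 1) (n + 1) (by lia) ≫ f) (by
        have e := mappingCone.inl_v_d φ (n + 1) n (n + 1 + 1) (by lia) (by lia)
        have e' : K.d (n + 1) (n + 1 + 1) ≫ (mappingCone.inl φ).v (n + 1 + 1) (n + 1) (by lia)
          = φ.f (n + 1) ≫ (mappingCone.inr φ).f (n + 1) -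
            (mappingCone.inl φ).v (n + 1) n (by lia) ≫ (CochainComplex.mappingCone φ).d n (n + 1) := by
          rw [e, sub_sub_cancel]
        rw [Preadditive.comp_sub, ← Category.assoc, ← Category.assoc, e', ← φ.comm,
          Category.assoc, hg₂, Preadditive.sub_comp, Category.assoc, Category.assoc, hf,
          comp_zero, sub_zero, sub_self])
    refine ⟨(mappingCone.fst φ).1.v (n + 1 + 1) (n + 1 + 1 + 1) rfl ≫ g₁ +
      (mappingCone.snd φ).v (n + 1 + 1) (n + 1 + 1) (add_zero _) ≫ g₂, ?_⟩
    apply mappingCone.ext_from φ (n + 1 + 1) (n + 1) rfl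
    · have e := mappingCone.inl_v_d φ (n + 1 + 1) (n + 1) (n + 1 + 1 + 1) (by lia) (by lia)
      refine (Category.assoc _ _ _).symm.trans ((congrArg (· ≫ _) e).trans ?_)
      simp only [Preadditive.sub_comp, Preadditive.comp_add, Category.assoc,
        mappingCone.inr_f_fst_v_assoc, mappingCone.inr_f_snd_v_assoc,
        mappingCone.inl_v_fst_v_assoc, mappingCone.inl_v_snd_v_assoc, zero_comp, comp_zero,
        zero_add, add_zero, hg₁, sub_zero, zero_sub, neg_sub, sub_add_cancel]
    · have e := (mappingCone.inr φ).comm (n + 1) (n + 1 + 1)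
      refine (Category.assoc _ _ _).symm.trans ((congrArg (· ≫ _) e).trans ?_)
      simp only [Preadditive.comp_add, Category.assoc, mappingCone.inr_f_fst_v_assoc,
        mappingCone.inr_f_snd_v_assoc, zero_comp, comp_zero, zero_add, hg₂]

end IsTAC

variable (A)

/-- The totally acyclic complexes in the homotopy category. -/
def tac : ObjectProperty (HomotopyCategory (FGModuleCat.{u} A) (ComplexShape.up ℤ)) :=
  fun K => IsTAC K.as

instance : (tac A).ContainsZero where
  exists_zero := by
    have h : ∀ n (x : (HomologicalComplex.zero : CochainComplex (FGModuleCat.{u} A) ℤ).X n),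
        x = 0 := fun n x => congr_apply ((isZero_zero (FGModuleCat.{u} A)).eq_of_src (𝟙 _) 0) x
    refine ⟨(HomotopyCategory.quotient _ _).obj HomologicalComplex.zero,
      Functor.map_isZero _ HomologicalComplex.isZero_zero,
      show IsTAC HomologicalComplex.zero from
      ⟨fun n => fgProjective_zero.of_retract 0 0 (ext' fun x => ?_),
        fun _ _ _ _ _ x _ => ⟨0, (h _ _).trans (h _ x).symm⟩,
        fun _ _ _ _ _ Q _ f _ => ⟨0, ext' fun x => by rw [h _ x, map_zero, map_zero]⟩⟩⟩
    exact (h _ _).trans (h _ _).symm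

instance : (tac A).IsStableUnderShift ℤ where
  isStableUnderShiftBy n := ⟨fun K hK =>
    (congrArg (tac A) (HomotopyCategory.shift_quotient_obj K.as n)).mpr (IsTAC.shift hK n)⟩

/-- A distinguished triangle is isomorphic to the cone triangle of a chain map representing its
first morphism, and such cones are totally acyclic. -/
instance : (tac A).IsTriangulatedClosed₃ where
  ext₃' T hT h₁ h₂ := by
    obtain ⟨φ, hφ⟩ := (HomotopyCategory.quotient _ _).map_surjective
      (X := T.obj₁.as) (Y := T.obj₂.as) T.mor₁
    exact ⟨_, h₁.isTAC_mappingCone h₂ φ, ⟨Triangle.π₃.mapIso (isoTriangleOfIso₁₂ T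
      (CochainComplex.mappingCone.triangleh φ) hT
      (HomotopyCategory.mappingCone_triangleh_distinguished φ) (Iso.refl _) (Iso.refl _) (by
        refine (Category.comp_id _).trans (Eq.trans ?_ (Category.id_comp _).symm)
        exact hφ.symm))⟩⟩

instance : (tac A).IsTriangulatedClosed₂ := .of_isTriangulatedClosed₃

instance : (tac A).IsTriangulated where

/-- The homotopy category of totally acyclic complexes. -/
abbrev TACHo := (tac A).FullSubcategory

/-- All other triangulations arise from this one by transport along equivalences. -/
instance : TriangulatedStructure (TACHo A) where
  preadditive := inferInstance
  hasZeroObject := inferInstance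
  hasShift := inferInstance
  additive_shift := inferInstance
  pretriangulated := inferInstance
  isTriangulated := inferInstance

variable {A}

namespace TACHo

/-- The object of `TACHo A` defined by a totally acyclic complex. -/
abbrev mk (K : CochainComplex (FGModuleCat.{u} A) ℤ) (hK : IsTAC K) : TACHo A :=
  ⟨(HomotopyCategory.quotient _ _).obj K, hK⟩

/-- The morphism of `TACHo A` defined by a chain map. -/
abbrev mkHom {K L : CochainComplex (FGModuleCat.{u} A) ℤ} (hK : IsTAC K) (hL : IsTAC L)
    (φ : K ⟶ L) : mk K hK ⟶ mk L hL :=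
  ObjectProperty.homMk ((HomotopyCategory.quotient _ _).map φ)

theorem exists_mkHom {K L : CochainComplex (FGModuleCat.{u} A) ℤ} {hK : IsTAC K} {hL : IsTAC L}
    (f : mk K hK ⟶ mk L hL) : ∃ φ, f = mkHom hK hL φ := by
  obtain ⟨φ, hφ⟩ := (HomotopyCategory.quotient _ _).map_surjective f.hom
  exact ⟨φ, ObjectProperty.hom_ext _ hφ.symm⟩

/-- The Gorenstein projective module of cycles in degree `0`. -/
abbrev cyc (K : CochainComplex (FGModuleCat.{u} A) ℤ) (hK : IsTAC K) : GP A :=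
  ⟨_root_.cyc K 0, hK.gorensteinProjective_cyc 0⟩

/-- The morphism induced on cycles. -/
abbrev cycMap {K L : CochainComplex (FGModuleCat.{u} A) ℤ} (hK : IsTAC K) (hL : IsTAC L)
    (φ : K ⟶ L) : cyc K hK ⟶ cyc L hL :=
  ObjectProperty.homMk (_root_.cycMap 0 φ)

/-- One direction makes `toStable` well defined on homotopy classes, the other makes it faithful. -/
theorem proj_map_cycMap_eq_iff {K L : CochainComplex (FGModuleCat.{u} A) ℤ} (hK : IsTAC K)
    (hL : IsTAC L) (φ ψ : K ⟶ L) :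
    (StableGP.proj A).map (cycMap hK hL φ) = (StableGP.proj A).map (cycMap hK hL ψ) ↔
      mkHom hK hL φ = mkHom hK hL ψ := by
  rw [StableGP.map_eq_iff]
  constructor
  · intro h
    obtain ⟨h'⟩ := hK.exists_homotopy hL (φ - ψ) h
    exact ObjectProperty.hom_ext _ (HomotopyCategory.eq_of_homotopy _ _ (Homotopy.equivSubZero.symm h'))
  · intro h
    exact hL.factorsThroughProjective_of_homotopy
      (HomotopyCategory.homotopyOfEq _ _ (congrArg (·.hom) h))

variable (A)

/-- The functor taking a totally acyclic complex to its cycles. -/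
def toStable : TACHo A ⥤ StableGP A where
  obj X := (StableGP.proj A).obj (cyc X.obj.as X.property)
  map {X Y} f := (StableGP.proj A).map (cycMap X.property Y.property
    (exists_mkHom (K := X.obj.as) (L := Y.obj.as) f).choose)
  map_id X := by
    refine Eq.trans ((proj_map_cycMap_eq_iff X.property X.property _ (𝟙 X.obj.as)).2
      ((exists_mkHom (K := X.obj.as) (L := X.obj.as) _).choose_spec.symm.trans ?_)) ?_
    · exact ObjectProperty.hom_ext _ ((HomotopyCategory.quotient _ _).map_id X.obj.as).symm
    · exact (StableGP.proj A).map_id _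
  map_comp {X Y Z} f g := by
    refine Eq.trans ((proj_map_cycMap_eq_iff X.property Z.property _
      ((exists_mkHom (K := X.obj.as) (L := Y.obj.as) f).choose ≫
        (exists_mkHom (K := Y.obj.as) (L := Z.obj.as) g).choose)).2
      ((exists_mkHom (K := X.obj.as) (L := Z.obj.as) _).choose_spec.symm.trans ?_)) ?_
    · refine Eq.trans ?_ (ObjectProperty.hom_ext _
        ((HomotopyCategory.quotient _ _).map_comp _ _)).symm
      exact congrArg₂ (· ≫ ·) (exists_mkHom (K := X.obj.as) (L := Y.obj.as) f).choose_spec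
        (exists_mkHom (K := Y.obj.as) (L := Z.obj.as) g).choose_spec
    · exact (StableGP.proj A).map_comp (cycMap X.property Y.property _)
        (cycMap Y.property Z.property _)

variable {A}

theorem toStable_map {K L : CochainComplex (FGModuleCat.{u} A) ℤ} (hK : IsTAC K)
    (hL : IsTAC L) (φ : K ⟶ L) :
    (toStable A).map (mkHom hK hL φ) = (StableGP.proj A).map (cycMap hK hL φ) :=
  (proj_map_cycMap_eq_iff hK hL _ φ).2
    (exists_mkHom (K := K) (L := L) (hK := hK) (hL := hL) _).choose_spec.symm

instance : (toStable A).Faithful where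
  map_injective {X Y} f g h := by
    rw [(exists_mkHom (K := X.obj.as) (L := Y.obj.as) f).choose_spec,
      (exists_mkHom (K := X.obj.as) (L := Y.obj.as) g).choose_spec]
    exact (proj_map_cycMap_eq_iff X.property Y.property _ _).1 h

instance : (toStable A).Full where
  map_surjective {X Y} f := by
    obtain ⟨f, rfl⟩ := (StableGP.proj A).map_surjective f
    obtain ⟨φ, hφ⟩ := X.property.exists_cycMap_eq Y.property f.hom
    exact ⟨mkHom X.property Y.property φ, (toStable_map _ _ _).trans
      (congrArg (StableGP.proj A).map (ObjectProperty.hom_ext _ hφ))⟩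

instance : (toStable A).EssSurj where
  mem_essImage X := by
    obtain ⟨K, hK, ⟨e⟩⟩ := X.as.property.exists_completeResolution
    exact ⟨mk K hK, ⟨(StableGP.proj A).mapIso
      ((gorensteinProjective A).fullyFaithfulι.preimageIso (X := cyc K hK) e)⟩⟩

instance : (toStable A).IsEquivalence where

variable (A)

/-- The equivalence between totally acyclic complexes up to homotopy and the homotopy category of
the Gorenstein projective model structure. -/
def hoEquiv : TACHo A ≌ HoGP A := (toStable A).asEquivalence.trans (GPFin.stableEquiv A)

end TACHo

end

end

noncomputable section

/-! ### Comparison of suspension sequences and of standard triangles -/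

section Comparison

open FGModuleCat

variable {A : Type u} [Ring A]

theorem FGModuleCat.desc_surjective {X Y Z : FGModuleCat.{u} A} (f : X ⟶ Z) {q : Y ⟶ Z}
    (hq : Function.Surjective q.hom.hom) :
    Function.Surjective (FGModuleCat.desc f q).hom.hom := fun z => by
  obtain ⟨y, rfl⟩ := hq z
  exact ⟨(inr _ _).hom.hom y, by simp [desc_app]⟩

/-- The direct sum of two short exact sequences. -/
theorem IsShortExact.sum {X₁ Y₁ Z₁ X₂ Y₂ Z₂ : FGModuleCat.{u} A} {f₁ : X₁ ⟶ Y₁} {g₁ : Y₁ ⟶ Z₁}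
    {f₂ : X₂ ⟶ Y₂} {g₂ : Y₂ ⟶ Z₂} (h₁ : IsShortExact f₁ g₁) (h₂ : IsShortExact f₂ g₂) :
    IsShortExact (X := FGModuleCat.sum X₁ X₂) (Y := FGModuleCat.sum Y₁ Y₂)
      (Z := FGModuleCat.sum Z₁ Z₂) (FGModuleCat.desc (f₁ ≫ inl _ _) (f₂ ≫ inr _ _))
      (FGModuleCat.desc (g₁ ≫ inl _ _) (g₂ ≫ inr _ _)) where
  injective x y hxy := by
    have e₁ := congrArg (fst Y₁ Y₂).hom.hom hxy
    have e₂ := congrArg (snd Y₁ Y₂).hom.hom hxy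
    simp only [desc_app, comp_app, map_add, fst_inl_app, fst_inr_app, snd_inl_app, snd_inr_app,
      add_zero, zero_add] at e₁ e₂
    exact sum_ext (h₁.injective e₁) (h₂.injective e₂)
  exact y := by
    constructor
    · intro hy
      have e₁ := congrArg (fst Z₁ Z₂).hom.hom hy
      have e₂ := congrArg (snd Z₁ Z₂).hom.hom hy
      simp only [desc_app, comp_app, map_add, fst_inl_app, fst_inr_app, snd_inl_app, snd_inr_app,
        add_zero, zero_add, map_zero] at e₁ e₂
      obtain ⟨x₁, hx₁⟩ := h₁.exists_of_zero e₁
      obtain ⟨x₂, hx₂⟩ := h₂.exists_of_zero e₂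
      refine ⟨(inl X₁ X₂).hom.hom x₁ + (inr X₁ X₂).hom.hom x₂, sum_ext ?_ ?_⟩
      · simp [desc_app, comp_app, hx₁]
      · simp [desc_app, comp_app, hx₂]
    · rintro ⟨x, rfl⟩
      refine sum_ext ?_ ?_
      · simp [desc_app, comp_app, h₁.apply_apply]
      · simp [desc_app, comp_app, h₂.apply_apply]
  surjective z := by
    obtain ⟨y₁, hy₁⟩ := h₁.surjective ((fst Z₁ Z₂).hom.hom z)
    obtain ⟨y₂, hy₂⟩ := h₂.surjective ((snd Z₁ Z₂).hom.hom z)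
    refine ⟨(inl Y₁ Y₂).hom.hom y₁ + (inr Y₁ Y₂).hom.hom y₂, sum_ext ?_ ?_⟩
    · simp [desc_app, comp_app, hy₁]
    · simp [desc_app, comp_app, hy₂]

/-- A standard triangle presents its third object as a pushout. -/
theorem isShortExact_of_pushout {X W S Y C : FGModuleCat.{u} A} {j : X ⟶ W} {q : W ⟶ S} {u : X ⟶ Y}
    {v : Y ⟶ C} {w : C ⟶ S} {t : W ⟶ C} (h : IsShortExact j q) (h' : IsShortExact v w)
    (h₁ : j ≫ t = u ≫ v) (h₂ : t ≫ w = q) :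
    IsShortExact (FGModuleCat.lift j (-u)) (FGModuleCat.desc t v) where
  injective x y hxy := h.injective (by simpa using congrArg (fst W Y).hom.hom hxy)
  exact z := by
    have e₁ := congr_apply h₁
    have e₂ := congr_apply h₂
    simp only [comp_app] at e₁ e₂
    constructor
    · intro hz
      have e₃ := congrArg w.hom.hom hz
      simp only [desc_app, map_add, e₂, h'.apply_apply, add_zero, map_zero] at e₃
      obtain ⟨x, hx⟩ := h.exists_of_zero e₃
      refine ⟨x, sum_ext (by simpa using hx) (h'.injective ?_)⟩
      rw [desc_app, ← hx, e₁] at hz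
      simpa [neg_apply'] using (neg_eq_of_add_eq_zero_right hz)
    · rintro ⟨x, rfl⟩
      simp [desc_app, e₁, neg_apply']
  surjective c := by
    have e₂ := congr_apply h₂
    simp only [comp_app] at e₂
    obtain ⟨z, hz⟩ := h.surjective (w.hom.hom c)
    obtain ⟨y, hy⟩ := h'.exists_of_zero (show w.hom.hom (c - t.hom.hom z) = 0 by
      rw [map_sub, e₂, hz, sub_self])
    refine ⟨(inl W Y).hom.hom z + (inr W Y).hom.hom y, ?_⟩
    simp [desc_app, hy]

variable [IsNoetherianRing A]

namespace GPFin

/-- A morphism is a weak equivalence if and only if, made surjective by adding a projective module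
to its source, it has a kernel of finite projective dimension. -/
theorem weq_iff_ker {X Y : GPFin A} (a : X ⟶ Y) {P K : FGModuleCat.{u} A} (hP : fgProjective A P)
    {q : P ⟶ Y.obj} {k : K ⟶ FGModuleCat.sum X.obj P}
    (h : IsShortExact k (FGModuleCat.desc a.hom q)) : (gpModel A).weq a ↔ finiteProjDim A K := by
  let Z : GPFin A := ⟨FGModuleCat.sum X.obj P, X.property.sum (.of_finiteProjDim hP.finiteProjDim)⟩
  let i : X ⟶ Z := ObjectProperty.homMk (inl _ _)
  let p : Z ⟶ Y := ObjectProperty.homMk (FGModuleCat.desc a.hom q)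
  have e : i ≫ p = a := ObjectProperty.hom_ext _ (inl_desc _ _)
  have hi : (gpModel A).weq i := weq_of_mono (isShortExact_sum _ _) hP
  have := (gpModel_isModelStructure A).two_of_three
  rw [← e]
  constructor
  · intro h'
    exact finiteProjDim_ker_of_weq (p := p)
      (MorphismProperty.of_precomp (gpModel A).weq i p hi h') h
  · intro hK
    exact MorphismProperty.comp_mem _ _ _ hi (weq_of_epi (p := p) h hK)

/-- The kernels of a morphism of short exact sequences, each vertical morphism being made
surjective. -/
theorem exists_ker_ses {X Y Z X' Y' Z' : GPFin A} {f : X ⟶ Y} {g : Y ⟶ Z} {f' : X' ⟶ Y'}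
    {g' : Y' ⟶ Z'} (h : IsShortExact f.hom g.hom) (h' : IsShortExact f'.hom g'.hom) {a : X ⟶ X'}
    {b : Y ⟶ Y'} {c : Z ⟶ Z'} (h₁ : f ≫ b = a ≫ f') (h₂ : g ≫ c = b ≫ g') :
    ∃ (K₁ K₂ K₃ : FGModuleCat.{u} A) (i : K₁ ⟶ K₂) (p : K₂ ⟶ K₃), IsShortExact i p ∧
      ((gpModel A).weq a ↔ finiteProjDim A K₁) ∧ ((gpModel A).weq b ↔ finiteProjDim A K₂) ∧
      ((gpModel A).weq c ↔ finiteProjDim A K₃) := by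
  obtain ⟨P₁, q₁, hP₁, hq₁⟩ := exists_projective_cover X'.obj
  obtain ⟨P₃, q₃, hP₃, hq₃⟩ := exists_projective_cover Z'.obj
  obtain ⟨l, hl⟩ := hP₃.exists_lift q₃ g'.hom h'.surjective
  -- Adding the split sequence of `P₁` and `P₃` to the source makes all three vertical maps
  -- surjective at once; the middle one uses a lift `l` of `q₃` through `g'`.
  have H := h.sum (isShortExact_sum P₁ P₃)
  have e₁ : f.hom ≫ b.hom = a.hom ≫ f'.hom := congrArg (·.hom) h₁
  have e₂ : g.hom ≫ c.hom = b.hom ≫ g'.hom := congrArg (·.hom) h₂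
  have E₁ : FGModuleCat.desc (f.hom ≫ inl _ _) (inl P₁ P₃ ≫ inr _ _) ≫
      FGModuleCat.desc b.hom (FGModuleCat.desc (q₁ ≫ f'.hom) l) =
      FGModuleCat.desc a.hom q₁ ≫ f'.hom := sum_hom_ext
    (by simp only [← Category.assoc, inl_desc]; simp only [Category.assoc, inl_desc, e₁])
    (by simp only [← Category.assoc, inr_desc]; simp only [Category.assoc, inr_desc, inl_desc])
  have E₂ : FGModuleCat.desc (g.hom ≫ inl _ _) (snd P₁ P₃ ≫ inr _ _) ≫
      FGModuleCat.desc c.hom q₃ =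
      FGModuleCat.desc b.hom (FGModuleCat.desc (q₁ ≫ f'.hom) l) ≫ g'.hom := sum_hom_ext
    (by simp only [← Category.assoc, inl_desc]; simp only [Category.assoc, inl_desc, e₂])
    (by
      simp only [← Category.assoc, inr_desc]
      rw [Category.assoc (snd _ _), inr_desc]
      refine sum_hom_ext ?_ ?_
      · rw [← Category.assoc (inl _ _) _ q₃, inl_snd, zero_comp, ← Category.assoc, inl_desc,
          Category.assoc, h'.comp_zero, comp_zero]
      · rw [← Category.assoc (inr _ _) _ q₃, inr_snd, ← Category.assoc, inr_desc, hl,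
          Category.id_comp])
  have s₁ := desc_surjective a.hom hq₁
  have s₃ := desc_surjective c.hom hq₃
  obtain ⟨K₁, k₁, hk₁⟩ := exists_kernel _ s₁
  obtain ⟨K₂, k₂, hk₂⟩ := exists_kernel _ (H.surjective_of_ends h' E₁ E₂ s₁ s₃)
  obtain ⟨K₃, k₃, hk₃⟩ := exists_kernel _ s₃
  obtain ⟨i, p, hip, -, -⟩ := H.kernels h' E₁ E₂ hk₁ hk₂ hk₃
  exact ⟨K₁, K₂, K₃, i, p, hip, weq_iff_ker a hP₁ hk₁, weq_iff_ker b (hP₁.sum hP₃) hk₂,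
    weq_iff_ker c hP₃ hk₃⟩

theorem weq_ses₂ {X Y Z X' Y' Z' : GPFin A} {f : X ⟶ Y} {g : Y ⟶ Z} {f' : X' ⟶ Y'}
    {g' : Y' ⟶ Z'} (h : IsShortExact f.hom g.hom) (h' : IsShortExact f'.hom g'.hom) {a : X ⟶ X'}
    {b : Y ⟶ Y'} {c : Z ⟶ Z'} (h₁ : f ≫ b = a ≫ f') (h₂ : g ≫ c = b ≫ g')
    (ha : (gpModel A).weq a) (hc : (gpModel A).weq c) : (gpModel A).weq b := by
  obtain ⟨K₁, K₂, K₃, i, p, hip, w₁, w₂, w₃⟩ := exists_ker_ses h h' h₁ h₂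
  exact w₂.2 (hip.finiteProjDim₂ (w₁.1 ha) (w₃.1 hc))

theorem weq_ses₃ {X Y Z X' Y' Z' : GPFin A} {f : X ⟶ Y} {g : Y ⟶ Z} {f' : X' ⟶ Y'}
    {g' : Y' ⟶ Z'} (h : IsShortExact f.hom g.hom) (h' : IsShortExact f'.hom g'.hom) {a : X ⟶ X'}
    {b : Y ⟶ Y'} {c : Z ⟶ Z'} (h₁ : f ≫ b = a ≫ f') (h₂ : g ≫ c = b ≫ g')
    (ha : (gpModel A).weq a) (hb : (gpModel A).weq b) : (gpModel A).weq c := by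
  obtain ⟨K₁, K₂, K₃, i, p, hip, w₁, w₂, w₃⟩ := exists_ker_ses h h' h₁ h₂
  exact w₃.2 (hip.finiteProjDim₃ (w₁.1 ha) (w₂.1 hb))

/-- A morphism between modules of finite projective dimension is a weak equivalence. -/
theorem weq_of_finiteProjDim {X Y : GPFin A} (a : X ⟶ Y) (hX : finiteProjDim A X.obj)
    (hY : finiteProjDim A Y.obj) : (gpModel A).weq a := by
  obtain ⟨P, q, hP, hq⟩ := exists_projective_cover Y.obj
  obtain ⟨K, k, hk⟩ := exists_kernel _ (desc_surjective a.hom hq)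
  exact (weq_iff_ker a hP hk).2 (hk.finiteProjDim₁
    ((isShortExact_sum _ _).finiteProjDim₂ hX hP.finiteProjDim) hY)

end GPFin

/-- A morphism `c` between suspensions is a suspension of `a`. -/
def IsSuspensionOf {X X' : GPFin A} (s : SuspensionSequence (finiteProjDim A) X)
    (s' : SuspensionSequence (finiteProjDim A) X') (a : X ⟶ X') (c : s.S ⟶ s'.S) : Prop :=
  ∃ b : s.W ⟶ s'.W, s.j ≫ b = a ≫ s'.j ∧ s.q ≫ c = b ≫ s'.q

namespace IsSuspensionOf

variable {X X' X'' : GPFin A} {s : SuspensionSequence (finiteProjDim A) X}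
  {s' : SuspensionSequence (finiteProjDim A) X'} {s'' : SuspensionSequence (finiteProjDim A) X''}

theorem comp {a : X ⟶ X'} {a' : X' ⟶ X''} {c : s.S ⟶ s'.S} {c' : s'.S ⟶ s''.S}
    (h : IsSuspensionOf s s' a c) (h' : IsSuspensionOf s' s'' a' c') :
    IsSuspensionOf s s'' (a ≫ a') (c ≫ c') := by
  obtain ⟨b, h₁, h₂⟩ := h
  obtain ⟨b', h₁', h₂'⟩ := h'
  exact ⟨b ≫ b', by rw [reassoc_of% h₁, h₁', Category.assoc],
    by rw [reassoc_of% h₂, h₂', Category.assoc]⟩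

theorem weq {a : X ⟶ X'} {c : s.S ⟶ s'.S} (h : IsSuspensionOf s s' a c)
    (ha : (gpModel A).weq a) : (gpModel A).weq c := by
  obtain ⟨b, h₁, h₂⟩ := h
  exact GPFin.weq_ses₃ s.shortExact s'.shortExact h₁ h₂ ha
    (GPFin.weq_of_finiteProjDim b s.trivial s'.trivial)

/-- Two choices of the middle map agree on `X`, so they differ by a map from `s.S` to `s'.W`. The
two suspensions then differ by a map through `s'.W`, which has finite projective dimension. -/
theorem toHo_map_eq {a : X ⟶ X'} {c c' : s.S ⟶ s'.S} (h : IsSuspensionOf s s' a c)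
    (h' : IsSuspensionOf s s' a c') : (gpModel A).toHo.map c = (gpModel A).toHo.map c' := by
  obtain ⟨b, h₁, h₂⟩ := h
  obtain ⟨b', h₁', h₂'⟩ := h'
  have e₁ : s.j.hom ≫ b.hom = s.j.hom ≫ b'.hom := congrArg (·.hom) (h₁.trans h₁'.symm)
  have e₂ : s.q.hom ≫ c.hom = b.hom ≫ s'.q.hom := congrArg (·.hom) h₂
  have e₃ : s.q.hom ≫ c'.hom = b'.hom ≫ s'.q.hom := congrArg (·.hom) h₂'
  obtain ⟨l, hl⟩ := s.shortExact.exists_desc (b.hom - b'.hom) (by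
    rw [Preadditive.comp_sub, e₁, sub_self])
  refine GPFin.toHo_map_eq s'.trivial l s'.q.hom (epi_cancel s.shortExact.surjective ?_)
  rw [Preadditive.comp_sub, e₂, e₃, ← Category.assoc, hl, Preadditive.sub_comp]

end IsSuspensionOf

/-- The middle map exists because extensions of `s.S` by `s'.W` vanish. -/
theorem exists_isSuspensionOf {X X' : GPFin A} (s : SuspensionSequence (finiteProjDim A) X)
    (s' : SuspensionSequence (finiteProjDim A) X') (a : X ⟶ X') :
    ∃ c, IsSuspensionOf s s' a c := by
  obtain ⟨b, hb⟩ := s.gorenstein.extVanish_of_finiteProjDim s'.trivial _ _ s.shortExact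
    (a.hom ≫ s'.j.hom)
  obtain ⟨c, hc⟩ := s.shortExact.exists_desc (b ≫ s'.q.hom) (by
    rw [← Category.assoc, hb, Category.assoc, s'.shortExact.comp_zero, comp_zero])
  exact ⟨ObjectProperty.homMk c, ObjectProperty.homMk b, ObjectProperty.hom_ext _ hb,
    ObjectProperty.hom_ext _ hc⟩

/-- A square between the first two objects of standard triangles extends to a morphism of standard
triangles. -/
theorem exists_standardTriangle_hom (Δ Δ' : StandardTriangle (𝓔 := finiteGorensteinProjDim A)
    (finiteProjDim A)) (a : Δ.X ⟶ Δ'.X) (b : Δ.Y ⟶ Δ'.Y) (h : Δ.u ≫ b = a ≫ Δ'.u)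
    {c : Δ.susp.S ⟶ Δ'.susp.S} (hc : IsSuspensionOf Δ.susp Δ'.susp a c) :
    ∃ g : Δ.C ⟶ Δ'.C, Δ.v ≫ g = b ≫ Δ'.v ∧ Δ.w ≫ c = g ≫ Δ'.w ∧
      ((gpModel A).weq a → (gpModel A).weq b → (gpModel A).weq g) := by
  have hc' := hc
  obtain ⟨β, h₁, h₂⟩ := hc
  have hΔ := isShortExact_of_pushout Δ.susp.shortExact Δ.shortExact
    (congrArg (·.hom) Δ.comm_left) (congrArg (·.hom) Δ.comm_right)
  have e₁ : Δ.susp.j.hom ≫ β.hom = a.hom ≫ Δ'.susp.j.hom := congrArg (·.hom) h₁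
  have e₂ : Δ.susp.q.hom ≫ c.hom = β.hom ≫ Δ'.susp.q.hom := congrArg (·.hom) h₂
  have e₃ : Δ.u.hom ≫ b.hom = a.hom ≫ Δ'.u.hom := congrArg (·.hom) h
  have e₄ : Δ'.susp.j.hom ≫ Δ'.t.hom = Δ'.u.hom ≫ Δ'.v.hom := congrArg (·.hom) Δ'.comm_left
  have e₅ : Δ'.t.hom ≫ Δ'.w.hom = Δ'.susp.q.hom := congrArg (·.hom) Δ'.comm_right
  have e₆ : Δ.t.hom ≫ Δ.w.hom = Δ.susp.q.hom := congrArg (·.hom) Δ.comm_right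
  obtain ⟨g, hg⟩ := hΔ.exists_desc
    (FGModuleCat.desc (β.hom ≫ Δ'.t.hom) (b.hom ≫ Δ'.v.hom)) (by
      rw [FGModuleCat.lift, Preadditive.add_comp, Category.assoc, Category.assoc, inl_desc,
        inr_desc, ← Category.assoc, e₁, Preadditive.neg_comp, ← Category.assoc Δ.u.hom,
        e₃, Category.assoc, e₄, Category.assoc, add_neg_cancel])
  have g₁ : Δ.t.hom ≫ g = β.hom ≫ Δ'.t.hom := by
    have := congrArg (inl _ _ ≫ ·) hg
    simpa only [← Category.assoc, inl_desc] using this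
  have g₂ : Δ.v.hom ≫ g = b.hom ≫ Δ'.v.hom := by
    have := congrArg (inr _ _ ≫ ·) hg
    simpa only [← Category.assoc, inr_desc] using this
  have G₂ : Δ.v ≫ ObjectProperty.homMk g = b ≫ Δ'.v := ObjectProperty.hom_ext _ g₂
  have G₃ : Δ.w ≫ c = ObjectProperty.homMk g ≫ Δ'.w :=
    ObjectProperty.hom_ext _ (epi_cancel hΔ.surjective (sum_hom_ext (by
      change inl _ _ ≫ _ ≫ Δ.w.hom ≫ c.hom = inl _ _ ≫ _ ≫ g ≫ Δ'.w.hom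
      rw [← Category.assoc, ← Category.assoc (inl _ _), inl_desc, ← Category.assoc, e₆, e₂,
        ← Category.assoc, g₁, Category.assoc, e₅]) (by
      change inr _ _ ≫ _ ≫ Δ.w.hom ≫ c.hom = inr _ _ ≫ _ ≫ g ≫ Δ'.w.hom
      rw [← Category.assoc, ← Category.assoc (inr _ _), inr_desc, ← Category.assoc,
        Δ.shortExact.comp_zero, zero_comp, ← Category.assoc, g₂, Category.assoc,
        Δ'.shortExact.comp_zero, comp_zero])))
  exact ⟨ObjectProperty.homMk g, G₂, G₃, fun ha hb =>
    GPFin.weq_ses₂ Δ.shortExact Δ'.shortExact G₂ G₃ hb (hc'.weq ha)⟩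

variable (A) in
theorem hasStandardTriangles_gpFin :
    HasStandardTriangles (finiteGorensteinProjDim A) (finiteProjDim A) := by
  intro X Y u
  obtain ⟨W, S, j, q, h, hW, hS⟩ := X.property.exists_preenvelope
  obtain ⟨C, v, w, t, h', h₁, h₂, -⟩ := h.exists_pushout u.hom
  exact ⟨⟨C, .of_extension h' Y.property (.of_gorensteinProjective hS)⟩,
    ⟨⟨W, .of_finiteProjDim hW⟩, ⟨S, .of_gorensteinProjective hS⟩, ObjectProperty.homMk j,
      ObjectProperty.homMk q, h, hW, hS⟩, ObjectProperty.homMk v, ObjectProperty.homMk w,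
    ObjectProperty.homMk t, h', ObjectProperty.hom_ext _ h₁, ObjectProperty.hom_ext _ h₂⟩

variable (A) in
theorem hasStandardTriangles_gp :
    HasStandardTriangles (gorensteinProjective A) (fgProjective A) := by
  intro X Y u
  obtain ⟨W, S, j, q, hW, hS, h⟩ := X.property.exists_cosyzygy
  obtain ⟨C, v, w, t, h', h₁, h₂, -⟩ := h.exists_pushout u.hom
  exact ⟨⟨C, .of_extension h' Y.property hS⟩,
    ⟨⟨W, .of_projective hW⟩, ⟨S, hS⟩, ObjectProperty.homMk j,
      ObjectProperty.homMk q, h, hW, hS⟩, ObjectProperty.homMk v, ObjectProperty.homMk w,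
    ObjectProperty.homMk t, h', ObjectProperty.hom_ext _ h₁, ObjectProperty.hom_ext _ h₂⟩

end Comparison

end

noncomputable section

/-! ### Suspension sequences and standard triangles of complexes -/

section ComplexTriangles

open FGModuleCat

variable {A : Type u} [Ring A] [IsNoetherianRing A]

namespace TACHo

variable {K L : CochainComplex (FGModuleCat.{u} A) ℤ}

/-- The cycles of a totally acyclic complex, in `GPFin A`. -/
abbrev cycFin (K : CochainComplex (FGModuleCat.{u} A) ℤ) (hK : IsTAC K) : GPFin A :=
  (GP.incl A).obj (cyc K hK)

/-- The morphism induced on cycles, in `GPFin A`. -/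
abbrev cycFinMap (hK : IsTAC K) (hL : IsTAC L) (φ : K ⟶ L) : cycFin K hK ⟶ cycFin L hL :=
  (GP.incl A).map (cycMap hK hL φ)

/-- The shifted differential carries a sign, so degree `0` cycles of the shift are the kernel of
`-d`, not literally that of `d`. -/
theorem shift_d (K : CochainComplex (FGModuleCat.{u} A) ℤ) :
    (K⟦(1 : ℤ)⟧).d 0 (0 + 1) = -K.d (0 + 1) (0 + 1 + 1) := by
  simp [CochainComplex.shiftFunctor_obj_d']

/-- The differential, as a morphism from the cochains in degree `0` to the cycles of the shifted
complex. -/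
def dShift (K : CochainComplex (FGModuleCat.{u} A) ℤ) : K.X 0 ⟶ _root_.cyc (K⟦(1 : ℤ)⟧) 0 :=
  cycLift (K := K⟦(1 : ℤ)⟧) (n := 0) (K.d 0 (0 + 1)) ((congrArg (K.d 0 (0 + 1) ≫ ·)
    (shift_d K)).trans ((Preadditive.comp_neg (K.d 0 (0 + 1)) (K.d (0 + 1) (0 + 1 + 1))).trans
      ((congrArg Neg.neg (K.d_comp_d _ _ _)).trans neg_zero)))

theorem dShift_ι : dShift K ≫ cycι (K⟦(1 : ℤ)⟧) 0 = K.d 0 (0 + 1) := rfl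

/-- The complex supplies its own suspension sequence: the degree `1` cycles of `K`, read as degree
`0` cycles of the shift, are a suspension of the degree `0` cycles. -/
theorem isShortExact_dShift (hK : IsTAC K) : IsShortExact (cycι K 0) (dShift K) where
  injective := cycι_injective
  exact x := by
    have e := congr_apply (dShift_ι (K := K))
    constructor
    · intro hx
      exact exists_cyc ((e x).symm.trans ((congrArg (cycι (K⟦(1 : ℤ)⟧) 0).hom.hom hx).trans
        (map_zero _)))
    · rintro ⟨y, rfl⟩
      exact cycι_injective (n := 0) (K := K⟦(1 : ℤ)⟧)
        ((e _).trans ((congr_apply cycι_d y).trans (map_zero _).symm))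
  surjective z := by
    have e := congr_apply (dShift_ι (K := K))
    have hz := congr_apply ((congrArg (cycι (K⟦(1 : ℤ)⟧) 0 ≫ ·) (shift_d K)).symm.trans
      (cycι_d (n := 0) (K := K⟦(1 : ℤ)⟧))) z
    obtain ⟨x, hx⟩ := hK.exact 0 (0 + 1) (0 + 1 + 1) rfl rfl ((cycι (K⟦(1 : ℤ)⟧) 0).hom.hom z)
      (neg_eq_zero.1 hz)
    exact ⟨x, cycι_injective (n := 0) (K := K⟦(1 : ℤ)⟧) ((e x).trans hx)⟩

/-- The suspension sequence of the cycles of a complex. -/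
def suspensionSequence (K : CochainComplex (FGModuleCat.{u} A) ℤ) (hK : IsTAC K) :
    SuspensionSequence (finiteProjDim A) (cycFin K hK) where
  W := ⟨K.X 0, .of_finiteProjDim (hK.projective 0).finiteProjDim⟩
  S := cycFin (K⟦(1 : ℤ)⟧) (hK.shift 1)
  j := ObjectProperty.homMk (cycι K 0)
  q := ObjectProperty.homMk (dShift K)
  shortExact := isShortExact_dShift hK
  trivial := (hK.projective 0).finiteProjDim
  gorenstein := (hK.shift 1).gorensteinProjective_cyc 0

theorem isSuspensionOf_cycFinMap (hK : IsTAC K) (hL : IsTAC L) (φ : K ⟶ L) :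
    IsSuspensionOf (suspensionSequence K hK) (suspensionSequence L hL) (cycFinMap hK hL φ)
      (cycFinMap (hK.shift 1) (hL.shift 1) (φ⟦(1 : ℤ)⟧')) := by
  refine ⟨ObjectProperty.homMk (φ.f 0), ObjectProperty.hom_ext _ (cycMap_ι φ).symm,
    ObjectProperty.hom_ext _ (cyc_hom_ext (n := 0) (K := L⟦(1 : ℤ)⟧) ?_)⟩
  exact (φ.comm 0 (0 + 1)).symm

open CochainComplex CochainComplex.HomComplex

/-- The map from the cochains in degree `0` to the cycles of the mapping cone. -/
def toCone (φ : K ⟶ L) : K.X 0 ⟶ _root_.cyc (mappingCone φ) 0 :=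
  -- The values are boundaries of elements of degree `-1` in the cone, hence cycles.
  cycLift ((mappingCone.inl φ).v 0 (-1) (by lia) ≫ (mappingCone φ).d (-1) 0) (by
    rw [Category.assoc, HomologicalComplex.d_comp_d, comp_zero])

theorem toCone_ι (φ : K ⟶ L) : toCone φ ≫ cycι (mappingCone φ) 0 =
    φ.f 0 ≫ (mappingCone.inr φ).f 0 - K.d 0 (0 + 1) ≫ (mappingCone.inl φ).v (0 + 1) 0 (by lia) :=
  mappingCone.inl_v_d φ 0 (-1) (0 + 1) (by lia) (by lia)

/-- This sign cancels the one in `toCone_ι`, so that `toCone` is compatible with `dShift` in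
`toCone_mor₃`. -/
theorem mor₃_eq (φ : K ⟶ L) : (mappingCone.triangle φ).mor₃.f 0 =
    - (mappingCone.fst φ).1.v 0 (0 + 1) rfl := by
  have h₁ := mappingCone.inl_v_triangle_mor₃_f φ (0 + 1) 0 (by lia)
  have h₂ := mappingCone.inr_f_triangle_mor₃_f φ 0
  refine mappingCone.ext_from φ (0 + 1) 0 rfl ?_ ?_
  · refine h₁.trans (Eq.trans ?_ ((Preadditive.comp_neg _ _).trans
      (congrArg Neg.neg (mappingCone.inl_v_fst_v φ (0 + 1) 0 rfl))).symm)
    refine congrArg Neg.neg ?_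
    simp [CochainComplex.shiftFunctorObjXIso]
    rfl
  · exact h₂.trans ((Preadditive.comp_neg _ _).trans
      ((congrArg Neg.neg (mappingCone.inr_f_fst_v φ 0 (0 + 1) rfl)).trans neg_zero)).symm

theorem toCone_mor₃ (φ : K ⟶ L) :
    toCone φ ≫ _root_.cycMap 0 (mappingCone.triangle φ).mor₃ = dShift K := by
  refine cyc_hom_ext (n := 0) (K := K⟦(1 : ℤ)⟧) ?_
  change (toCone φ ≫ cycι (mappingCone φ) 0) ≫ (mappingCone.triangle φ).mor₃.f 0 = K.d 0 (0 + 1)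
  rw [toCone_ι]
  refine (congrArg (_ ≫ ·) (mor₃_eq φ)).trans ?_
  have e : (φ.f 0 ≫ (mappingCone.inr φ).f 0 -
      K.d 0 (0 + 1) ≫ (mappingCone.inl φ).v (0 + 1) 0 (by lia)) ≫
      (mappingCone.fst φ).1.v 0 (0 + 1) rfl = - K.d 0 (0 + 1) := by
    rw [Preadditive.sub_comp, Category.assoc, Category.assoc, mappingCone.inr_f_fst_v,
      mappingCone.inl_v_fst_v, comp_zero, zero_sub, Category.comp_id]
  exact (Preadditive.comp_neg _ _).trans ((congrArg Neg.neg e).trans (neg_neg _))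

/-- The degreewise split sequence of `L`, the cone and the shift of `K` stays exact on cycles.
Surjectivity is witnessed by `toCone`, since `dShift` is already onto. -/
theorem isShortExact_cone (hK : IsTAC K) (φ : K ⟶ L) :
    IsShortExact (_root_.cycMap 0 (mappingCone.inr φ))
      (_root_.cycMap 0 (mappingCone.triangle φ).mor₃) where
  injective x y hxy := cycι_injective (by
    have e := congrArg ((mappingCone.snd φ).v 0 0 (add_zero 0)).hom.hom
      (congrArg (cycι (mappingCone φ) 0).hom.hom hxy)
    have e' := congr_apply (mappingCone.inr_f_snd_v φ 0)
    exact (e' _).symm.trans (e.trans (e' _)))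
  exact y := by
    constructor
    · intro hy
      have hy' := congrArg (cycι (K⟦(1 : ℤ)⟧) 0).hom.hom hy
      have e₁ := congr_apply (mor₃_eq φ) ((cycι (mappingCone φ) 0).hom.hom y)
      have e₂ : ((mappingCone.fst φ).1.v 0 (0 + 1) rfl).hom.hom
          ((cycι (mappingCone φ) 0).hom.hom y) = 0 :=
        neg_eq_zero.1 (e₁.symm.trans (hy'.trans (map_zero _)))
      have e₃ := congr_apply (mappingCone.id_X φ 0 (0 + 1) rfl)
        ((cycι (mappingCone φ) 0).hom.hom y)
      simp only [add_apply', comp_app] at e₃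
      rw [e₂, map_zero, zero_add] at e₃
      set z := ((mappingCone.snd φ).v 0 0 (add_zero 0)).hom.hom
        ((cycι (mappingCone φ) 0).hom.hom y)
      have e₄ := congr_apply ((mappingCone.inr φ).comm 0 (0 + 1)) z
      simp only [comp_app] at e₄
      obtain ⟨x, hx⟩ := exists_cyc (K := L) (n := 0) (x := z) (by
        have e' := congr_apply (mappingCone.inr_f_snd_v φ (0 + 1))
          ((L.d 0 (0 + 1)).hom.hom z)
        refine e'.symm.trans ((congrArg ((mappingCone.snd φ).v (0 + 1) (0 + 1)
          (add_zero _)).hom.hom (e₄.symm.trans ?_)).trans (map_zero _))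
        refine (congrArg _ e₃).trans ?_
        exact congr_apply cycι_d y)
      refine ⟨x, cycι_injective ?_⟩
      refine Eq.trans ?_ e₃
      exact congrArg ((mappingCone.inr φ).f 0).hom.hom hx
    · rintro ⟨x, rfl⟩
      refine cycι_injective (n := 0) (K := K⟦(1 : ℤ)⟧) ?_
      exact congr_apply (mappingCone.inr_f_triangle_mor₃_f φ 0) _
  surjective z := by
    obtain ⟨x, hx⟩ := (isShortExact_dShift hK).surjective z
    exact ⟨(toCone φ).hom.hom x, (congr_apply (toCone_mor₃ φ) x).trans hx⟩

/-- The standard triangle on the cycles of a chain map. -/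
def standardTriangle (hK : IsTAC K) (hL : IsTAC L) (φ : K ⟶ L) :
    StandardTriangle (𝓔 := finiteGorensteinProjDim A) (finiteProjDim A) where
  X := cycFin K hK
  Y := cycFin L hL
  C := cycFin (mappingCone φ) (hK.isTAC_mappingCone hL φ)
  susp := suspensionSequence K hK
  u := cycFinMap hK hL φ
  v := cycFinMap hL _ (mappingCone.inr φ)
  w := cycFinMap _ (hK.shift 1) (mappingCone.triangle φ).mor₃
  t := ObjectProperty.homMk (toCone φ)
  shortExact := isShortExact_cone hK φ
  comm_left := ObjectProperty.hom_ext _ (cyc_hom_ext (by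
    change cycι K 0 ≫ toCone φ ≫ cycι (mappingCone φ) 0 =
      cycι K 0 ≫ φ.f 0 ≫ (mappingCone.inr φ).f 0
    rw [toCone_ι, Preadditive.comp_sub, ← Category.assoc _ (K.d _ _), cycι_d, zero_comp, sub_zero]))
  comm_right := ObjectProperty.hom_ext _ (toCone_mor₃ φ)

end TACHo

end ComplexTriangles

end

noncomputable section

/-! ### The standard triangulation of the homotopy category -/

section StandardHo

open FGModuleCat

variable {A : Type u} [Ring A] [IsNoetherianRing A]

namespace TACHo

variable {K L : CochainComplex (FGModuleCat.{u} A) ℤ}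

/-- The shift of the object defined by a totally acyclic complex. -/
def mkShiftIso (K : CochainComplex (FGModuleCat.{u} A) ℤ) (hK : IsTAC K) :
    mk (K⟦(1 : ℤ)⟧) (hK.shift 1) ≅ (mk K hK)⟦(1 : ℤ)⟧ :=
  (tac A).fullyFaithfulι.preimageIso
    (((HomotopyCategory.quotient (FGModuleCat.{u} A) (ComplexShape.up ℤ)).commShiftIso
      (1 : ℤ)).app K ≪≫ ((tac A).ι.commShiftIso (1 : ℤ)).symm.app (mk K hK))

theorem ι_map_mkShiftIso (hK : IsTAC K) : (tac A).ι.map (mkShiftIso K hK).hom =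
    ((HomotopyCategory.quotient (FGModuleCat.{u} A) (ComplexShape.up ℤ)).commShiftIso
      (1 : ℤ)).hom.app K ≫ ((tac A).ι.commShiftIso (1 : ℤ)).inv.app (mk K hK) := rfl

theorem mkShiftIso_naturality (hK : IsTAC K) (hL : IsTAC L) (φ : K ⟶ L) :
    mkHom (hK.shift 1) (hL.shift 1) (φ⟦(1 : ℤ)⟧') ≫ (mkShiftIso L hL).hom =
      (mkShiftIso K hK).hom ≫ (mkHom hK hL φ)⟦(1 : ℤ)⟧' := by
  apply (tac A).ι.map_injective
  rw [CategoryTheory.Functor.map_comp, CategoryTheory.Functor.map_comp, ι_map_mkShiftIso,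
    ι_map_mkShiftIso, Category.assoc]
  have e₁ := ((HomotopyCategory.quotient (FGModuleCat.{u} A) (ComplexShape.up ℤ)).commShiftIso
    (1 : ℤ)).hom.naturality φ
  have e₂ := ((tac A).ι.commShiftIso (1 : ℤ)).inv.naturality (mkHom hK hL φ)
  refine Eq.trans ?_ (congrArg (_ ≫ ·) e₂)
  refine (Category.assoc _ _ _).symm.trans (Eq.trans ?_ (Category.assoc _ _ _))
  exact congrArg (· ≫ _) e₁

/-- The triangle of a chain map is distinguished. -/
theorem triangle_distinguished (hK : IsTAC K) (hL : IsTAC L) (φ : K ⟶ L) :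
    Triangle.mk (mkHom hK hL φ)
      (mkHom hL (hK.isTAC_mappingCone hL φ) (CochainComplex.mappingCone.inr φ))
      (mkHom (hK.isTAC_mappingCone hL φ) (hK.shift 1) (CochainComplex.mappingCone.triangle φ).mor₃ ≫
        (mkShiftIso K hK).hom) ∈ distTriang (TACHo A) := by
  refine isomorphic_distinguished _
    (HomotopyCategory.mappingCone_triangleh_distinguished φ) _
    (Triangle.isoMk _ _ (Iso.refl _) (Iso.refl _) (Iso.refl _) ?_ ?_ ?_)
  · exact (Category.comp_id _).trans (Category.id_comp _).symm
  · exact (Category.comp_id _).trans (Category.id_comp _).symm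
  · change ((tac A).ι.map (_ ≫ (mkShiftIso K hK).hom) ≫
      ((tac A).ι.commShiftIso (1 : ℤ)).hom.app (mk K hK)) ≫ (𝟙 _)⟦(1 : ℤ)⟧' = 𝟙 _ ≫ _
    rw [CategoryTheory.Functor.map_id]
    refine (Category.comp_id _).trans (Eq.trans ?_ (Category.id_comp _).symm)
    refine (congrArg (· ≫ _) (((tac A).ι.map_comp _ _).trans
      (congrArg (_ ≫ ·) (ι_map_mkShiftIso hK)))).trans ?_
    rw [Category.assoc, Category.assoc, Iso.inv_hom_id_app]
    exact congrArg (_ ≫ ·) (Category.comp_id _)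

theorem hoEquiv_map (hK : IsTAC K) (hL : IsTAC L) (φ : K ⟶ L) :
    (hoEquiv A).functor.map (mkHom hK hL φ) = (gpModel A).toHo.map (cycFinMap hK hL φ) :=
  congrArg (GPFin.stableToHo A).map (toStable_map hK hL φ)

/-- A module of finite Gorenstein projective dimension has a resolution by the cycles of a totally
acyclic complex. -/
theorem exists_resolution (X : GPFin A) : ∃ (K : CochainComplex (FGModuleCat.{u} A) ℤ)
    (hK : IsTAC K) (p : cycFin K hK ⟶ X), (gpModel A).weq p ∧
      ∀ (L : CochainComplex (FGModuleCat.{u} A) ℤ) (hL : IsTAC L) (a : cycFin L hL ⟶ X),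
        ∃ φ : L ⟶ K, cycFinMap hL hK φ ≫ p = a := by
  obtain ⟨K, hK, ⟨e⟩⟩ := X.cover.property.exists_completeResolution
  let e' : cycFin K hK ≅ (GP.incl A).obj X.cover :=
    (finiteGorensteinProjDim A).fullyFaithfulι.preimageIso e
  refine ⟨K, hK, e'.hom ≫ X.π, ?_, fun L hL a => ?_⟩
  · rw [GPFin.weq_iff_isIso_toHo, CategoryTheory.Functor.map_comp]
    have := GPFin.weq_iff_isIso_toHo.1 X.weq_π
    infer_instance
  · obtain ⟨g, hg⟩ := GPFin.exists_lift (hL.gorensteinProjective_cyc 0) a.hom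
    obtain ⟨φ, hφ⟩ := hL.exists_cycMap_eq hK (g ≫ e.inv)
    refine ⟨φ, ObjectProperty.hom_ext _ ?_⟩
    change _root_.cycMap 0 φ ≫ e.hom ≫ X.π.hom = a.hom
    rw [hφ, Category.assoc, e.inv_hom_id_assoc, hg]

section

variable [TriangulatedStructure (HoGP A)] [(hoEquiv A).functor.CommShift ℤ]

/-- The shift of the cycles of a totally acyclic complex. -/
def cycShiftIso (K : CochainComplex (FGModuleCat.{u} A) ℤ) (hK : IsTAC K) :
    (gpModel A).toHo.obj (cycFin (K⟦(1 : ℤ)⟧) (hK.shift 1)) ≅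
      ((gpModel A).toHo.obj (cycFin K hK))⟦(1 : ℤ)⟧ :=
  (hoEquiv A).functor.mapIso (mkShiftIso K hK) ≪≫
    ((hoEquiv A).functor.commShiftIso (1 : ℤ)).app (mk K hK)

theorem cycShiftIso_hom (hK : IsTAC K) : (cycShiftIso K hK).hom =
    (hoEquiv A).functor.map (mkShiftIso K hK).hom ≫
      ((hoEquiv A).functor.commShiftIso (1 : ℤ)).hom.app (mk K hK) := rfl

theorem cycShiftIso_naturality (hK : IsTAC K) (hL : IsTAC L) (φ : K ⟶ L) :
    (gpModel A).toHo.map (cycFinMap (hK.shift 1) (hL.shift 1) (φ⟦(1 : ℤ)⟧')) ≫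
      (cycShiftIso L hL).hom =
      (cycShiftIso K hK).hom ≫ ((gpModel A).toHo.map (cycFinMap hK hL φ))⟦(1 : ℤ)⟧' := by
  have e := (hoEquiv A).functor.map_commShift_comp (mkShiftIso_naturality hK hL φ) (𝟙 _)
  rw [Category.comp_id, hoEquiv_map, hoEquiv_map] at e
  rw [cycShiftIso_hom, cycShiftIso_hom]
  exact (congrArg (fun z => _ ≫ _ ≫ z) (Category.comp_id _).symm).trans
    (e.trans (Category.assoc _ _ _).symm)

theorem standardTriangle_distinguished [(hoEquiv A).functor.IsTriangulated] (hK : IsTAC K)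
    (hL : IsTAC L) (φ : K ⟶ L) :
    Triangle.mk ((gpModel A).toHo.map (standardTriangle hK hL φ).u)
      ((gpModel A).toHo.map (standardTriangle hK hL φ).v)
      ((gpModel A).toHo.map (standardTriangle hK hL φ).w ≫ (cycShiftIso K hK).hom) ∈
        distTriang (HoGP A) := by
  refine isomorphic_distinguished _ ((hoEquiv A).functor.map_distinguished _
    (triangle_distinguished hK hL φ)) _
    (Triangle.isoMk _ _ (Iso.refl _) (Iso.refl _) (Iso.refl _) ?_ ?_ ?_)
  · exact (Category.comp_id _).trans ((hoEquiv_map hK hL φ).symm.trans (Category.id_comp _).symm)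
  · exact (Category.comp_id _).trans ((hoEquiv_map hL (hK.isTAC_mappingCone hL φ) _).symm.trans
      (Category.id_comp _).symm)
  · refine (congrArg (_ ≫ ·) (CategoryTheory.Functor.map_id _ _)).trans
      ((Category.comp_id _).trans (Eq.trans ?_ (Category.id_comp _).symm))
    change _ = (hoEquiv A).functor.map (mkHom _ _ _ ≫ (mkShiftIso K hK).hom) ≫ _
    rw [CategoryTheory.Functor.map_comp]
    refine Eq.trans ?_ (Category.assoc _ _ _).symm
    exact congrArg (· ≫ _) (hoEquiv_map (hK.isTAC_mappingCone hL φ) (hK.shift 1) _).symm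

end

theorem cycMap_add (φ ψ : K ⟶ L) :
    _root_.cycMap 0 (φ + ψ) = _root_.cycMap 0 φ + _root_.cycMap 0 ψ := rfl

variable (A) in
-- Addition in the target is only known through the equivalence with complexes. Both morphisms are
-- therefore represented by chain maps between resolutions, where adding chain maps adds the maps of
-- cycles.
theorem toHo_additive [TriangulatedStructure (HoGP A)] [(hoEquiv A).functor.Additive] :
    (gpModel A).toHo.Additive where
  map_add {X Y f g} := by
    obtain ⟨K, hK, p, hp, -⟩ := exists_resolution X
    obtain ⟨L, hL, q, hq, lift⟩ := exists_resolution Y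
    obtain ⟨φ, hφ⟩ := lift K hK (p ≫ f)
    obtain ⟨ψ, hψ⟩ := lift K hK (p ≫ g)
    have := GPFin.weq_iff_isIso_toHo.1 hp
    have e₁ : cycFinMap hK hL (φ + ψ) ≫ q = p ≫ (f + g) := by
      rw [Preadditive.comp_add, ← hφ, ← hψ]
      refine ObjectProperty.hom_ext _ (Eq.trans ?_ (Preadditive.add_comp _ _ _ _ _ _))
      exact congrArg (· ≫ q.hom) (cycMap_add φ ψ)
    have e₂ : (gpModel A).toHo.map (cycFinMap hK hL (φ + ψ)) =
        (gpModel A).toHo.map (cycFinMap hK hL φ) + (gpModel A).toHo.map (cycFinMap hK hL ψ) := by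
      rw [← hoEquiv_map, ← hoEquiv_map, ← hoEquiv_map]
      have e : mkHom hK hL (φ + ψ) = mkHom hK hL φ + mkHom hK hL ψ :=
        ObjectProperty.hom_ext _ (show (HomotopyCategory.quotient _ _).map (φ + ψ) =
          (HomotopyCategory.quotient _ _).map φ + (HomotopyCategory.quotient _ _).map ψ from
          Functor.map_add _)
      exact (congrArg _ e).trans (Functor.map_add _)
    rw [← cancel_epi ((gpModel A).toHo.map p), Preadditive.comp_add,
      ← CategoryTheory.Functor.map_comp, ← CategoryTheory.Functor.map_comp,
      ← CategoryTheory.Functor.map_comp, ← hφ, ← hψ, ← e₁, CategoryTheory.Functor.map_comp, e₂,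
      Preadditive.add_comp, ← CategoryTheory.Functor.map_comp, ← CategoryTheory.Functor.map_comp]

end TACHo

end StandardHo

end

noncomputable section

/-! ### The transported triangulations are the standard ones. -/

section StandardHo

open FGModuleCat TACHo

variable (A : Type u) [Ring A] [IsNoetherianRing A]

/-- Each `X` is resolved by the cycles of a complex `R X`. The suspension isomorphism is defined
there and carried to any suspension sequence by a suspension of the resolving map. -/
theorem standardTriangulation_of_isTriangulated [TriangulatedStructure (HoGP A)]
    [(hoEquiv A).functor.CommShift ℤ] [(hoEquiv A).functor.IsTriangulated]
    [(hoEquiv A).functor.Additive] :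
    Nonempty (StandardTriangulation (finiteProjDim A) (gpModel A).toHo) := by
  choose R hR p hp lift using exists_resolution (A := A)
  have hp' : ∀ X, IsIso ((gpModel A).toHo.map (p X)) := fun X =>
    GPFin.weq_iff_isIso_toHo.1 (hp X)
  choose c hc using fun {X : GPFin A} (s : SuspensionSequence (finiteProjDim A) X) =>
    exists_isSuspensionOf (suspensionSequence (R X) (hR X)) s (p X)
  have hc' : ∀ {X : GPFin A} (s : SuspensionSequence (finiteProjDim A) X),
      IsIso ((gpModel A).toHo.map (c s)) := fun s =>
    GPFin.weq_iff_isIso_toHo.1 ((hc s).weq (hp _))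
  let σ : ∀ {X : GPFin A} (s : SuspensionSequence (finiteProjDim A) X),
      (gpModel A).toHo.obj s.S ≅ ((gpModel A).toHo.obj X)⟦(1 : ℤ)⟧ := fun {X} s =>
    (asIso ((gpModel A).toHo.map (c s))).symm ≪≫ cycShiftIso (R X) (hR X) ≪≫
      (shiftFunctor (HoGP A) (1 : ℤ)).mapIso (asIso ((gpModel A).toHo.map (p X)))
  have hσ : ∀ {X : GPFin A} (s : SuspensionSequence (finiteProjDim A) X),
      (gpModel A).toHo.map (c s) ≫ (σ s).hom = (cycShiftIso (R X) (hR X)).hom ≫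
        ((gpModel A).toHo.map (p X))⟦(1 : ℤ)⟧' := fun s =>
    IsIso.hom_inv_id_assoc ((gpModel A).toHo.map (c s)) _
  -- Independence of choices: `σ s` can be computed from any totally acyclic complex mapping to `X`
  -- and any suspension of that map, as suspensions are unique in the homotopy category.
  have key : ∀ {X : GPFin A} (s : SuspensionSequence (finiteProjDim A) X)
      (K : CochainComplex (FGModuleCat.{u} A) ℤ) (hK : IsTAC K) (a : cycFin K hK ⟶ X)
      (d : cycFin (K⟦(1 : ℤ)⟧) (hK.shift 1) ⟶ s.S)
      (_ : IsSuspensionOf (suspensionSequence K hK) s a d),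
      (gpModel A).toHo.map d ≫ (σ s).hom = (cycShiftIso K hK).hom ≫
        ((gpModel A).toHo.map a)⟦(1 : ℤ)⟧' := by
    intro X s K hK a d hd
    obtain ⟨φ, rfl⟩ := lift X K hK a
    have e := hd.toHo_map_eq ((isSuspensionOf_cycFinMap hK (hR X) φ).comp (hc s))
    refine (congrArg (· ≫ (σ s).hom) (e.trans (CategoryTheory.Functor.map_comp _ _ _))).trans ?_
    refine (Category.assoc _ _ _).trans ((congrArg (_ ≫ ·) (hσ s)).trans ?_)
    refine (Category.assoc _ _ _).symm.trans
      ((congrArg (· ≫ _) (cycShiftIso_naturality hK (hR X) φ)).trans ?_)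
    rw [Category.assoc, ← CategoryTheory.Functor.map_comp, ← CategoryTheory.Functor.map_comp]
  refine ⟨⟨toHo_additive A, σ, ?_, distinguished_iff_of_standard _ σ ?_
    (hasStandardTriangles_gpFin A)⟩⟩
  · intro X X' s s' a b d h₁ h₂
    have e := key s' (R X) (hR X) (p X ≫ a) (c s ≫ d) ((hc s).comp ⟨b, h₁, h₂⟩)
    rw [← cancel_epi ((gpModel A).toHo.map (c s))]
    rw [CategoryTheory.Functor.map_comp, CategoryTheory.Functor.map_comp] at e
    refine (Category.assoc _ _ _).symm.trans ((congrArg (· ≫ _)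
      ((gpModel A).toHo.map_comp _ _).symm).trans (e.trans ?_))
    refine (Category.assoc _ _ _).symm.trans (Eq.trans ?_ (Category.assoc _ _ _))
    exact congrArg (· ≫ _) (hσ s).symm
  · intro Δ
    -- `Δ.u` is covered by a chain map `φ`. The standard triangle of `φ` maps to `Δ` by weak
    -- equivalences, so both have isomorphic images, and that of `φ` is distinguished as a cone
    -- triangle.
    obtain ⟨φ, hφ⟩ := lift Δ.Y (R Δ.X) (hR Δ.X) (p Δ.X ≫ Δ.u)
    obtain ⟨g, h₁, h₂, h₃⟩ := exists_standardTriangle_hom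
      (standardTriangle (hR Δ.X) (hR Δ.Y) φ) Δ (p Δ.X) (p Δ.Y) hφ (hc Δ.susp)
    have hg := GPFin.weq_iff_isIso_toHo.1 (h₃ (hp _) (hp _))
    refine isomorphic_distinguished _ (standardTriangle_distinguished (hR Δ.X) (hR Δ.Y) φ) _
      (Triangle.isoMk _ _ (@asIso _ _ _ _ ((gpModel A).toHo.map (p Δ.X)) (hp' _))
        (@asIso _ _ _ _ ((gpModel A).toHo.map (p Δ.Y)) (hp' _)) (@asIso _ _ _ _ ((gpModel A).toHo.map g) hg) ?_ ?_ ?_).symm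
    · exact ((gpModel A).toHo.map_comp _ _).symm.trans ((congrArg _ hφ).trans
        ((gpModel A).toHo.map_comp _ _))
    · exact ((gpModel A).toHo.map_comp _ _).symm.trans ((congrArg _ h₁).trans
        ((gpModel A).toHo.map_comp _ _))
    · have e₁ := ((gpModel A).toHo.map_comp _ _).symm.trans ((congrArg (gpModel A).toHo.map h₂).trans
        ((gpModel A).toHo.map_comp _ _))
      change (_ ≫ (cycShiftIso (R Δ.X) (hR Δ.X)).hom) ≫ ((gpModel A).toHo.map (p Δ.X))⟦(1 : ℤ)⟧' =
        (gpModel A).toHo.map g ≫ (gpModel A).toHo.map Δ.w ≫ (σ Δ.susp).hom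
      refine (Category.assoc _ _ _).trans ((congrArg (_ ≫ ·) (hσ Δ.susp).symm).trans ?_)
      refine (Category.assoc _ _ _).symm.trans (Eq.trans ?_ (Category.assoc _ _ _))
      exact congrArg (· ≫ _) e₁

/-- The homotopy category of the Gorenstein projective model structure has a standard
triangulation. -/
theorem exists_standardTriangulation_hoGP : ∃ _ : TriangulatedStructure (HoGP A),
    Nonempty (StandardTriangulation (finiteProjDim A) (gpModel A).toHo) := by
  obtain ⟨_, ⟨_, _⟩, -⟩ := exists_triangulatedStructure (hoEquiv A)
  exact ⟨_, standardTriangulation_of_isTriangulated A⟩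

instance : (GP.incl A).Additive := ⟨rfl⟩

/-- The stable category has a standard triangulation for which the equivalence with the homotopy
category is triangulated. -/
theorem exists_standardTriangulation_stableGP [TriangulatedStructure (HoGP A)]
    (St : StandardTriangulation (finiteProjDim A) (gpModel A).toHo) :
    ∃ _ : TriangulatedStructure (StableGP A),
      Nonempty (StandardTriangulation (fgProjective A) (StableGP.proj A)) ∧
      IsTriangleEquivalence (GPFin.stableEquiv A) ∧
      IsTriangleEquivalence (GPFin.stableEquiv A).symm := by
  obtain ⟨_, h₁, h₂⟩ := exists_triangulatedStructure (GPFin.stableEquiv A).symm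
  have : (StableGP.proj A).mapArrow.EssSurj := inferInstance
  refine ⟨_, StandardTriangulation.transport (G := GP.incl A)
    ⟨fun f g h => h,
    fun X hX => hX.finiteProjDim, fun X hX => hX⟩ St h₁
    ((GPFin.inclStableFunctor A).symm ≪≫
    Functor.isoWhiskerLeft (GP.incl A) (GPFin.toHoHoToStable A).symm)
    (hasStandardTriangles_gp A), h₂, h₁⟩

end StandardHo

end

noncomputable section

/-! ### Exact functors with exact adjoints -/

section ExactAdjoints

open FGModuleCat

variable {A B : Type u} [Ring A] [Ring B]

theorem FGModuleCat.injective_of_mono {X Y : FGModuleCat.{u} A} (f : X ⟶ Y) [Mono f] :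
    Function.Injective f.hom.hom := fun x y hxy => by
  let e : X → (of A A ⟶ X) := fun x => mkHom (X := of A A) (LinearMap.toSpanSingleton A X x)
  have he : ∀ x, (e x).hom.hom (1 : A) = x := fun x => one_smul A x
  have h : e x ≫ f = e y ≫ f := ext' fun (a : A) => by
    change f.hom.hom (a • x) = f.hom.hom (a • y)
    rw [map_smul, map_smul, hxy]
  rw [← he x, ← he y, (cancel_mono f).1 h]

theorem FGModuleCat.surjective_of_epi {X Y : FGModuleCat.{u} A} (f : X ⟶ Y) [Epi f] :
    Function.Surjective f.hom.hom := by
  have h : f ≫ mkHom (Y := of A (Y ⧸ LinearMap.range f.hom.hom)) (Submodule.mkQ _) = 0 :=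
    ext' fun x => (Submodule.Quotient.mk_eq_zero _).2 ⟨x, rfl⟩
  have h' := (cancel_epi f).1 (h.trans comp_zero.symm)
  exact fun y => (Submodule.Quotient.mk_eq_zero _).1 (congr_apply h' y)

theorem FGModuleCat.mono_of_injective {X Y : FGModuleCat.{u} A} (f : X ⟶ Y)
    (hf : Function.Injective f.hom.hom) : Mono f := ⟨fun _ _ h => mono_cancel hf h⟩

theorem FGModuleCat.epi_of_surjective {X Y : FGModuleCat.{u} A} (f : X ⟶ Y)
    (hf : Function.Surjective f.hom.hom) : Epi f := ⟨fun _ _ h => epi_cancel hf h⟩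

/-- A functor between module categories which has both a left and a right adjoint. -/
structure IsBiadjoint (F : FGModuleCat.{u} A ⥤ FGModuleCat.{u} B)
    (G : FGModuleCat.{u} B ⥤ FGModuleCat.{u} A) where
  additive : F.Additive
  additive' : G.Additive
  left : F ⊣ G
  right : G ⊣ F

namespace IsBiadjoint

variable {F : FGModuleCat.{u} A ⥤ FGModuleCat.{u} B} {G : FGModuleCat.{u} B ⥤ FGModuleCat.{u} A}

/-- The reversed pair. -/
def symm (h : IsBiadjoint F G) : IsBiadjoint G F := ⟨h.additive', h.additive, h.right, h.left⟩

/-- A left adjoint preserves epimorphisms and a right adjoint monomorphisms. For the middle, an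
element of `F.obj Y` is a map from `B`, which the adjunction `G ⊣ F` turns into a map to `Y` that
lifts to `X`. -/
theorem isShortExact (h : IsBiadjoint F G) {X Y Z : FGModuleCat.{u} A} {f : X ⟶ Y} {g : Y ⟶ Z}
    (hfg : IsShortExact f g) : IsShortExact (F.map f) (F.map g) where
  injective := by
    have := mono_of_injective f hfg.injective
    have := h.right.isRightAdjoint
    exact injective_of_mono _
  surjective := by
    have := epi_of_surjective g hfg.surjective
    have := h.left.isLeftAdjoint
    exact surjective_of_epi _
  exact y := by
    have := h.additive
    have := h.additive'
    constructor
    · intro hy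
      let e : of B B ⟶ F.obj Y := mkHom (X := of B B) (LinearMap.toSpanSingleton B (F.obj Y) y)
      have he : e ≫ F.map g = 0 := ext' fun (b : B) => by
        change (F.map g).hom.hom (b • y) = 0
        rw [map_smul, hy, smul_zero]
      obtain ⟨t, ht⟩ := hfg.exists_lift ((h.right.homEquiv _ _).symm e) (by
        rw [← Adjunction.homEquiv_naturality_right_symm, he, Adjunction.homEquiv_counit,
          Functor.map_zero, zero_comp])
      refine ⟨((h.right.homEquiv _ _) t).hom.hom (1 : B), ?_⟩
      have e' : h.right.homEquiv _ _ t ≫ F.map f = e := by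
        rw [← Adjunction.homEquiv_naturality_right, ht, Equiv.apply_symm_apply]
      exact (congr_apply e' (1 : B)).trans (one_smul B y)
    · rintro ⟨x, rfl⟩
      have e : F.map f ≫ F.map g = 0 := by rw [← F.map_comp, hfg.comp_zero, F.map_zero]
      exact congr_apply e x

theorem surjective (h : IsBiadjoint F G) {X Y : FGModuleCat.{u} A} {f : X ⟶ Y}
    (hf : Function.Surjective f.hom.hom) : Function.Surjective (F.map f).hom.hom := by
  have := epi_of_surjective f hf
  have := h.left.isLeftAdjoint
  exact surjective_of_epi _

/-- The right adjoint `G` preserves epimorphisms, so its left adjoint preserves projectives. -/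
theorem fgProjective (h : IsBiadjoint F G) {P : FGModuleCat.{u} A} (hP : fgProjective A P) :
    _root_.fgProjective B (F.obj P) := by
  refine fgProjective.of_lift fun X p hp => ?_
  obtain ⟨g, hg⟩ := hP.exists_lift (h.left.homEquiv _ _ (𝟙 _)) (G.map p) (h.symm.surjective hp)
  refine ⟨(h.left.homEquiv _ _).symm g, ?_⟩
  rw [← Adjunction.homEquiv_naturality_right_symm, hg, Equiv.symm_apply_apply]

variable [IsNoetherianRing A] [IsNoetherianRing B]

/-- Exactness carries syzygies and cosyzygies along. Extensions of `F.obj X` by `Q` correspond by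
adjunction to extensions of `X` by `G.obj Q`, which is projective, so `coinduction` applies to the
images. -/
theorem gorensteinProjective (h : IsBiadjoint F G) {X : FGModuleCat.{u} A}
    (hX : gorensteinProjective A X) : _root_.gorensteinProjective B (F.obj X) := by
  refine gorensteinProjective.coinduction (fun Y => ∃ X, _root_.gorensteinProjective A X ∧
    Y = F.obj X) ?_ ?_ ?_ _ ⟨X, hX, rfl⟩
  · rintro _ ⟨X, hX, rfl⟩
    obtain ⟨P, X', i, p, hP, hX', hip⟩ := hX.exists_cosyzygy
    exact ⟨_, _, _, _, h.fgProjective hP, ⟨X', hX', rfl⟩, h.isShortExact hip⟩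
  · rintro _ ⟨X, hX, rfl⟩
    obtain ⟨P, X', i, p, hP, hX', hip⟩ := hX.exists_syzygy
    exact ⟨_, _, _, _, h.fgProjective hP, ⟨X', hX', rfl⟩, h.isShortExact hip⟩
  · rintro _ Q ⟨X, hX, rfl⟩ hQ
    obtain ⟨P, X', i, p, hP, hX', hip⟩ := hX.exists_syzygy
    refine ExtVanish.of_presentation (h.fgProjective hP) (h.isShortExact hip) fun w => ?_
    obtain ⟨v, hv⟩ := hX.extVanish (h.symm.fgProjective hQ) i p hip (h.left.homEquiv _ _ w)
    refine ⟨(h.left.homEquiv _ _).symm v, ?_⟩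
    rw [← Adjunction.homEquiv_naturality_left_symm, hv, Equiv.symm_apply_apply]

theorem finiteProjDim (h : IsBiadjoint F G) {X : FGModuleCat.{u} A}
    (hX : finiteProjDim A X) : _root_.finiteProjDim B (F.obj X) :=
  hX.induction (C := fun X => _root_.finiteProjDim B (F.obj X))
    (fun _ hP => (h.fgProjective hP).finiteProjDim)
    fun hip hP _ ih => (h.isShortExact hip).finiteProjDim₃ ih (h.fgProjective hP).finiteProjDim

theorem finiteGorensteinProjDim (h : IsBiadjoint F G) {X : FGModuleCat.{u} A}
    (hX : finiteGorensteinProjDim A X) : _root_.finiteGorensteinProjDim B (F.obj X) := by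
  obtain ⟨n, hn⟩ := hX
  refine ⟨n, ?_⟩
  induction n generalizing X with
  | zero => exact h.gorensteinProjective hn
  | succ n ih =>
    obtain ⟨K, E, i, p, hip, hE, hK⟩ := hn
    exact ⟨_, _, _, _, h.isShortExact hip, h.gorensteinProjective hE, ih hK⟩

/-- The restriction to modules of finite Gorenstein projective dimension. -/
abbrev restrict (h : IsBiadjoint F G) : GPFin A ⥤ GPFin B :=
  restrictFunctor F fun _ hX => h.finiteGorensteinProjDim hX

theorem cof (h : IsBiadjoint F G) {X Y : GPFin A} (f : X ⟶ Y) (hf : (gpModel A).cof f) :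
    (gpModel B).cof (h.restrict.map f) := by
  obtain ⟨Z, g, hfg, hZ⟩ := hf
  exact ⟨_, _, h.isShortExact hfg, h.gorensteinProjective hZ⟩

theorem weq (h : IsBiadjoint F G) {X Y : GPFin A} (f : X ⟶ Y)
    (hf : (gpModel A).weq f) : (gpModel B).weq (h.restrict.map f) := by
  obtain ⟨Z, i, p, ⟨P, g, hi, hP⟩, ⟨K, k, hp, hK⟩, rfl⟩ := hf
  exact ⟨h.restrict.obj Z, h.restrict.map i, h.restrict.map p,
    ⟨_, _, h.isShortExact hi, h.fgProjective hP⟩, ⟨_, _, h.isShortExact hp, h.finiteProjDim hK⟩,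
    (h.restrict.map_comp _ _).symm⟩

theorem isExactFunctor (h : IsBiadjoint F G) :
    IsExactFunctor (𝓔' := _root_.finiteGorensteinProjDim A) (𝓔 := _root_.finiteGorensteinProjDim B)
      (_root_.finiteProjDim B) (_root_.finiteProjDim A) h.restrict where
  map_ses _ _ hfg := h.isShortExact hfg
  trivial _ hX := h.finiteProjDim hX
  gorenstein _ hX := h.gorensteinProjective hX

theorem restrict_additive (h : IsBiadjoint F G) : h.restrict.Additive where
  map_add {X Y f g} := by
    have := h.additive
    exact ObjectProperty.hom_ext _ (F.map_add (f := f.hom) (g := g.hom))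

end IsBiadjoint

end ExactAdjoints

end

noncomputable section

/-! ### Double tensor products -/

namespace BalancedTensor

section

variable {A M X T : Type u} [Ring A] [AddCommGroup M] [Module Aᵐᵒᵖ M] [AddCommGroup X]
  [Module A X] [AddCommGroup T]

/-- The additive map out of a tensor product defined by a balanced biadditive map. -/
def lift (f : M →+ X →+ T) (hf : ∀ m (a : A) x, f (op a • m) x = f m (a • x)) :
    BalancedTensor A M X →+ T :=
  QuotientAddGroup.lift (balancedRel A M X)
    (TensorProduct.liftAddHom f fun n m x => by simp) (by
      refine (AddSubgroup.closure_le _).2 ?_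
      rintro _ ⟨m, a, x, rfl⟩
      exact (map_sub _ _ _).trans (sub_eq_zero.2 (hf m a x)))

theorem hom_ext {f g : BalancedTensor A M X →+ T}
    (h : ∀ m x, f (tmul A m x) = g (tmul A m x)) : f = g :=
  AddMonoidHom.ext fun z => by
    refine induction_on z h ?_ fun y z hy hz => ?_
    · rw [map_zero, map_zero]
    · rw [map_add, map_add, hy, hz]

end

section

variable {A B N M X T : Type u} [Ring A] [Ring B] [AddCommGroup N] [Module Bᵐᵒᵖ N]
  [AddCommGroup M] [Module B M] [Module Aᵐᵒᵖ M] [SMulCommClass B Aᵐᵒᵖ M] [AddCommGroup X]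
  [Module A X] [AddCommGroup T]

/-- The map `t ↦ t ⊗ x` followed by the associativity isomorphism. -/
def assocRight (x : X) : BalancedTensor B N M →+ BalancedTensor B N (BalancedTensor A M X) :=
  map (LinearMap.id : N →ₗ[Bᵐᵒᵖ] N)
    ({ toFun := fun m => tmul A m x
       map_add' := fun m m' => add_tmul m m' x
       map_smul' := fun b m => rfl } : M →ₗ[B] BalancedTensor A M X)

@[simp]
theorem assocRight_tmul (x : X) (n : N) (m : M) :
    assocRight (A := A) x (tmul B n m) = tmul B n (tmul A m x) := rfl

theorem assocRight_add (x y : X) (t : BalancedTensor B N M) :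
    assocRight (A := A) (x + y) t = assocRight (A := A) x t + assocRight (A := A) y t := by
  have : assocRight (A := A) (N := N) (B := B) (M := M) (x + y) = assocRight x + assocRight y :=
    hom_ext fun n m => by
      rw [AddMonoidHom.add_apply, assocRight_tmul, assocRight_tmul, assocRight_tmul, tmul_add,
        tmul_add]
  rw [this, AddMonoidHom.add_apply]

theorem assocRight_smul (a : A) (x : X) (t : BalancedTensor B N M) :
    assocRight (A := A) (a • x) t = assocRight (A := A) x (op a • t) := by
  have : assocRight (A := A) (N := N) (B := B) (M := M) (a • x) =
      (assocRight (A := A) x).comp (DistribSMul.toAddMonoidHom _ (op a)) :=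
    hom_ext fun n m => congrArg (tmul B n) (smul_tmul m a x).symm
  rw [this]
  rfl

theorem smul_assocRight [Module A N] [SMulCommClass A Bᵐᵒᵖ N] (a : A) (x : X)
    (t : BalancedTensor B N M) :
    assocRight (A := A) x (a • t) = a • assocRight (A := A) x t := by
  have : (assocRight (A := A) (N := N) (B := B) (M := M) x).comp
      (DistribSMul.toAddMonoidHom _ a) =
      (DistribSMul.toAddMonoidHom _ a).comp (assocRight x) :=
    hom_ext fun n m => rfl
  exact DFunLike.congr_fun this t

/-- The additive map out of a double tensor product defined by a family of additive maps. -/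
def liftDouble (f : X →+ BalancedTensor B N M →+ T)
    (hf : ∀ (a : A) x t, f (a • x) t = f x (op a • t)) :
    BalancedTensor B N (BalancedTensor A M X) →+ T :=
  lift (AddMonoidHom.mk' (fun n => lift
      (AddMonoidHom.mk' (fun m => f.flip (tmul B n m)) fun m m' => by
        rw [tmul_add, map_add])
      fun m a x => (hf a x (tmul B n m)).symm) fun n n' => hom_ext fun m x => by
        change f x (tmul B (n + n') m) = f x _ + f x _
        rw [add_tmul, map_add])
    fun n b z => by
      refine induction_on z (fun m x => ?_) ?_ fun y z hy hz => ?_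
      · exact congrArg (f x) (smul_tmul n b m)
      · rw [smul_zero, map_zero, map_zero]
      · rw [smul_add, map_add, map_add, hy, hz]

theorem liftDouble_assocRight (f : X →+ BalancedTensor B N M →+ T)
    (hf : ∀ (a : A) x t, f (a • x) t = f x (op a • t)) (x : X) (t : BalancedTensor B N M) :
    liftDouble f hf (assocRight x t) = f x t := by
  have : (liftDouble f hf).comp (assocRight x) = f x := hom_ext fun n m => rfl
  exact DFunLike.congr_fun this t

/-- With `liftDouble`, this gives `N ⊗ (M ⊗ X)` the universal property of `(N ⊗ M) ⊗ X`, with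
`assocRight x t` in the role of `t ⊗ x`. -/
theorem hom_ext_double {f g : BalancedTensor B N (BalancedTensor A M X) →+ T}
    (h : ∀ x t, f (assocRight x t) = g (assocRight x t)) : f = g :=
  hom_ext fun n z => by
    refine induction_on z (fun m x => h x (tmul B n m)) ?_ fun y z hy hz => ?_
    · rw [tmul_zero, map_zero, map_zero]
    · rw [tmul_add, map_add, map_add, hy, hz]

end

end BalancedTensor

end

noncomputable section

/-! ### The stable equivalence of Morita type splits off the identity -/

namespace BalancedTensor

section

variable {k : Type v} {A B N M X P : Type u} [Field k] [Ring A] [Ring B] [Algebra k A]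
  [AddCommGroup N] [Module A N] [Module Bᵐᵒᵖ N] [SMulCommClass A Bᵐᵒᵖ N]
  [AddCommGroup M] [Module B M] [Module Aᵐᵒᵖ M] [SMulCommClass B Aᵐᵒᵖ M] [AddCommGroup X]
  [Module A X] [AddCommGroup P] [Module (A ⊗[k] Aᵐᵒᵖ) P]
  (e : BalancedTensor B N M ≃+ A × P)
  (he : ∀ (a b : A) (t : BalancedTensor B N M),
    e (a • op b • t) = (a * (e t).1 * b, (a ⊗ₜ[k] op b) • (e t).2))

/-- The biadditive map `(x, t) ↦ (e t).1 x`. -/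
def fstSMul (X : Type u) [AddCommGroup X] [Module A X] : X →+ BalancedTensor B N M →+ X :=
  AddMonoidHom.mk' (fun x => ((AddMonoidHom.smul (R := A) (M := X)).flip x).comp
    ((AddMonoidHom.fst A P).comp e.toAddMonoidHom)) fun x y =>
      AddMonoidHom.ext fun t => smul_add (e t).1 x y

include he

theorem equiv_smul (a : A) (t : BalancedTensor B N M) :
    e (a • t) = (a * (e t).1, (a ⊗ₜ[k] (1 : Aᵐᵒᵖ)) • (e t).2) := by
  have h := he a 1 t
  rwa [op_one, one_smul, mul_one] at h

theorem equiv_op_smul (b : A) (t : BalancedTensor B N M) :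
    e (op b • t) = ((e t).1 * b, ((1 : A) ⊗ₜ[k] op b) • (e t).2) := by
  have h := he 1 b t
  rwa [one_smul, one_mul] at h

theorem equiv_symm_smul (a b : A) (x : A × P) :
    a • op b • e.symm x = e.symm (a * x.1 * b, (a ⊗ₜ[k] op b) • x.2) := by
  apply e.injective
  rw [he, e.apply_symm_apply, e.apply_symm_apply]

/-- Scalars act centrally on `A` and on any module over `A ⊗[k] Aᵐᵒᵖ`, and `e` carries this to `N ⊗
M`. -/
theorem algebraMap_smul_eq (c : k) (t : BalancedTensor B N M) :
    algebraMap k A c • t = op (algebraMap k A c) • t := by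
  apply e.injective
  rw [equiv_smul e he, equiv_op_smul e he, Algebra.commutes]
  have : (algebraMap k A c) ⊗ₜ[k] (1 : Aᵐᵒᵖ) = (1 : A) ⊗ₜ[k] op (algebraMap k A c) := by
    rw [Algebra.algebraMap_eq_smul_one, op_smul, op_one, TensorProduct.smul_tmul]
  rw [this]

theorem fstSMul_smul (a : A) (x : X) (t : BalancedTensor B N M) :
    fstSMul e X (a • x) t = fstSMul e X x (op a • t) := by
  change (e t).1 • a • x = (e (op a • t)).1 • x
  rw [equiv_op_smul e he, smul_smul]

/-- The projection `n ⊗ m ⊗ x ↦ (e (n ⊗ m)).1 x`. -/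
def projection (X : Type u) [AddCommGroup X] [Module A X] :
    BalancedTensor B N (BalancedTensor A M X) →ₗ[A] X :=
  { toFun := liftDouble (fstSMul e X) (fstSMul_smul e he)
    map_add' := map_add _
    map_smul' := fun a z => by
      have : (liftDouble (fstSMul e X) (fstSMul_smul e he)).comp
          (DistribSMul.toAddMonoidHom _ a) =
          (DistribSMul.toAddMonoidHom _ a).comp
            (liftDouble (fstSMul e X) (fstSMul_smul e he)) :=
        hom_ext_double fun x t => by
          change liftDouble (fstSMul e X) (fstSMul_smul e he) (a • assocRight x t) =
            a • liftDouble (fstSMul e X) (fstSMul_smul e he) (assocRight x t)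
          rw [← smul_assocRight, liftDouble_assocRight, liftDouble_assocRight]
          change (e (a • t)).1 • x = a • (e t).1 • x
          rw [equiv_smul e he, smul_smul]
      exact DFunLike.congr_fun this z }

theorem projection_assocRight (x : X) (t : BalancedTensor B N M) :
    projection e he X (assocRight x t) = (e t).1 • x :=
  liftDouble_assocRight (fstSMul e X) (fstSMul_smul e he) x t

theorem projection_surjective : Function.Surjective (projection (M := M) e he X) := fun x =>
  ⟨assocRight x (e.symm (1, 0)), by rw [projection_assocRight, e.apply_symm_apply, one_smul]⟩

theorem projection_naturality {Y : Type u} [AddCommGroup Y] [Module A Y] (g : X →ₗ[A] Y)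
    (z : BalancedTensor B N (BalancedTensor A M X)) :
    projection e he Y (lmap A N (lmap B M g) z) = g (projection e he X z) := by
  have : (projection e he Y).toAddMonoidHom.comp (lmap A N (lmap B M g)).toAddMonoidHom =
      g.toAddMonoidHom.comp (projection e he X).toAddMonoidHom :=
    hom_ext_double fun x t => by
      change projection e he Y (lmap A N (lmap B M g) (assocRight x t)) =
        g (projection e he X (assocRight x t))
      have h : lmap A N (lmap B M g) (assocRight x t) = assocRight (g x) t := by
        have h' : (lmap A N (lmap B M g)).toAddMonoidHom.comp (assocRight x) =
          assocRight (g x) := hom_ext fun n m => rfl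
        exact DFunLike.congr_fun h' t
      rw [h, projection_assocRight, projection_assocRight, map_smul]
  exact DFunLike.congr_fun this z

/-- The kernel is `P ⊗_A X`. As a bimodule `P` is a summand of a free one, and `(A ⊗ Aᵒᵖ) ⊗_A X` is
`A ⊗ X` over `k`, free over `A` because `k` is a field. The proof writes the kernel as a retract of
`P →₀ A ⊗[k] X` by explicit maps. -/
theorem projective_ker_projection [Module.Projective (A ⊗[k] Aᵐᵒᵖ) P] :
    Module.Projective A (LinearMap.ker (projection (M := M) e he X)) := by
  obtain ⟨s, hs⟩ := Module.projective_def'.1 (‹Module.Projective (A ⊗[k] Aᵐᵒᵖ) P›)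
  letI : Module k X := Module.compHom X (algebraMap k A)
  haveI : IsScalarTower k A X := ⟨fun c a x => by
    rw [Algebra.smul_def, mul_smul]
    rfl⟩
  let E := BalancedTensor B N (BalancedTensor A M X)
  letI : Module k E := Module.compHom E (algebraMap k A)
  haveI : IsScalarTower k A E := ⟨fun c a x => by
    rw [Algebra.smul_def, mul_smul]
    rfl⟩
  -- `act x r` is `r ⊗ x` under the identification of `(A ⊗ Aᵒᵖ) ⊗_A X` with `A ⊗ X`.
  let act : X → (A ⊗[k] Aᵐᵒᵖ →ₗ[A] A ⊗[k] X) := fun x =>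
    TensorProduct.AlgebraTensorModule.map LinearMap.id
      { toFun := fun b => b.unop • x
        map_add' := fun b c => by rw [MulOpposite.unop_add, add_smul]
        map_smul' := fun c b => by rw [MulOpposite.unop_smul, smul_assoc]; rfl }
  have act_tmul : ∀ x (a : A) (b : Aᵐᵒᵖ), act x (a ⊗ₜ b) = a ⊗ₜ (b.unop • x) := fun _ _ _ => rfl
  have act_add : ∀ x y r, act (x + y) r = act x r + act y r := fun x y r => by
    induction r with
    | zero => simp
    | tmul a b => rw [act_tmul, act_tmul, act_tmul, smul_add, TensorProduct.tmul_add]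
    | add r r' h h' => rw [map_add, map_add, map_add, h, h']; abel
  have act_smul : ∀ (a : A) x r, act (a • x) r = act x ((1 ⊗ₜ op a) * r) := fun a x r => by
    induction r with
    | zero => simp
    | tmul a' b =>
      rw [Algebra.TensorProduct.tmul_mul_tmul, act_tmul, act_tmul, one_mul, MulOpposite.unop_mul, unop_op,
        mul_smul]
    | add r r' h h' => rw [map_add, mul_add, map_add, h, h']
  have smul_act : ∀ (a : A) x r, a • act x r = act x ((a ⊗ₜ 1) * r) := fun a x r => by
    induction r with
    | zero => simp
    | tmul a' b =>
      rw [Algebra.TensorProduct.tmul_mul_tmul, act_tmul, act_tmul, one_mul]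
      rfl
    | add r r' h h' => rw [map_add, mul_add, map_add, smul_add, h, h']
  let U := P →₀ (A ⊗[k] X)
  letI : AddCommGroup (A ⊗[k] X) := inferInstance
  letI : AddCommGroup U := inferInstance
  -- The section `s` of the free cover of `P`, tensored with `X`, on the `P`-component of `e t`.
  let f₀ : X → BalancedTensor B N M →+ U := fun x =>
    (Finsupp.mapRange.addMonoidHom (act x).toAddMonoidHom).comp
      (s.toAddMonoidHom.comp ((AddMonoidHom.snd A P).comp e.toAddMonoidHom))
  have f₀_apply : ∀ x t, f₀ x t = Finsupp.mapRange (act x) (map_zero _) (s (e t).2) :=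
    fun _ _ => rfl
  let f : X →+ BalancedTensor B N M →+ U := AddMonoidHom.mk' f₀ fun x y =>
    AddMonoidHom.ext fun t => by
      rw [AddMonoidHom.add_apply, f₀_apply, f₀_apply, f₀_apply]
      exact Finsupp.ext fun q => act_add x y _
  have hf : ∀ (a : A) x t, f (a • x) t = f x (op a • t) := fun a x t => by
    change Finsupp.mapRange (act (a • x)) (map_zero _) (s (e t).2) =
      Finsupp.mapRange (act x) (map_zero _) (s (e (op a • t)).2)
    rw [equiv_op_smul e he, map_smul]
    exact Finsupp.ext fun q => act_smul a x _
  let τ₀ : E →+ U := liftDouble f hf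
  have τ₀_apply : ∀ x t, τ₀ (assocRight x t) =
      Finsupp.mapRange (act x) (map_zero _) (s (e t).2) := fun x t =>
    liftDouble_assocRight f hf x t
  let τ : E →ₗ[A] U :=
    { toFun := τ₀
      map_add' := map_add τ₀
      map_smul' := fun a z => by
        have : τ₀.comp (DistribSMul.toAddMonoidHom _ a) =
            (DistribSMul.toAddMonoidHom _ a).comp τ₀ :=
          hom_ext_double fun x t => by
            change τ₀ (a • assocRight x t) = a • τ₀ (assocRight x t)
            rw [← smul_assocRight, τ₀_apply, τ₀_apply, equiv_smul e he, map_smul]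
            ext q
            exact (smul_act a x _).symm
        exact DFunLike.congr_fun this z }
  -- Conversely, `a ⊗ x` at the basis element `q` goes to `a (q ⊗ x)`, with `q` embedded by
  -- `e.symm`. Linearity over `k` rests on `algebraMap_smul_eq`.
  let ρ₁ : P → (A ⊗[k] X →ₗ[A] E) := fun q => TensorProduct.AlgebraTensorModule.lift
    (LinearMap.toSpanSingleton A (X →ₗ[k] E)
      { toFun := fun x => assocRight x (e.symm (0, q))
        map_add' := fun x y => assocRight_add x y _
        map_smul' := fun c x => by
          change assocRight (A := A) (algebraMap k A c • x) (e.symm (0, q)) =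
            algebraMap k A c • assocRight (A := A) x (e.symm (0, q))
          rw [assocRight_smul, ← smul_assocRight, algebraMap_smul_eq e he] })
  have ρ₁_tmul : ∀ q a x, ρ₁ q (a ⊗ₜ x) = a • assocRight x (e.symm (0, q)) := fun q a x => rfl
  let ρ : U →ₗ[A] E := Finsupp.lsum ℕ ρ₁
  have ρ_single : ∀ q w, ρ (Finsupp.single q w) = ρ₁ q w := fun q w => Finsupp.lsum_single _ _ _ _
  have key₁ : ∀ x (r : P →₀ A ⊗[k] Aᵐᵒᵖ), ρ (Finsupp.mapRange (act x) (map_zero _) r) =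
      assocRight (A := A) x (e.symm (0, Finsupp.linearCombination (A ⊗[k] Aᵐᵒᵖ) id r)) := fun x r => by
    have symm_add : ∀ p q : P, e.symm (0, p + q) = e.symm (0, p) + e.symm (0, q) := fun p q => by
      rw [← map_add, Prod.mk_add_mk, add_zero]
    have symm_zero : e.symm ((0 : A), (0 : P)) = 0 := map_zero e.symm
    induction r using Finsupp.induction_linear with
    | zero => rw [Finsupp.mapRange_zero, map_zero, map_zero, symm_zero, map_zero]
    | add r r' h h' =>
      rw [Finsupp.mapRange_add (fun c d => map_add (act x) c d), map_add, map_add, symm_add,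
        map_add, h, h']
    | single q c =>
      rw [Finsupp.mapRange_single, ρ_single, Finsupp.linearCombination_single, id]
      induction c with
      | zero => rw [map_zero, map_zero, show (0 : A ⊗[k] Aᵐᵒᵖ) • q = 0 from zero_smul (A ⊗[k] Aᵐᵒᵖ) q, symm_zero, map_zero]
      | add c d h h' => rw [map_add, map_add, add_smul, symm_add, map_add, h, h']
      | tmul a b =>
        have h := equiv_symm_smul e he a b.unop (0, q)
        rw [mul_zero, zero_mul, op_unop] at h
        rw [act_tmul, ρ₁_tmul, ← h, smul_assocRight, assocRight_smul, op_unop]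
  -- Every `z` is the sum of its part in `P ⊗ X` and its part in `A ⊗ X = X`. On the kernel of the
  -- projection the second part vanishes, so `ρ` inverts `τ` there.
  have key₂ : ∀ z : E, ρ (τ z) + assocRight (projection e he X z) (e.symm (1, 0)) = z := by
    have : (ρ.toAddMonoidHom.comp τ₀) + (AddMonoidHom.mk'
        (fun x : X => (assocRight x (e.symm (1, 0)) : E)) fun x y => assocRight_add x y _).comp
          (projection e he X).toAddMonoidHom = AddMonoidHom.id E :=
      hom_ext_double fun x t => by
        change ρ (τ₀ (assocRight x t)) +
          assocRight (projection e he X (assocRight x t)) (e.symm (1, 0)) = assocRight x t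
        have h₁ : Finsupp.linearCombination (A ⊗[k] Aᵐᵒᵖ) id (s (e t).2) = (e t).2 :=
          LinearMap.congr_fun hs (e t).2
        have h₂ := equiv_symm_smul e he 1 (e t).1 (1, 0)
        rw [one_smul, one_mul, one_mul, smul_zero] at h₂
        rw [τ₀_apply, key₁, h₁, projection_assocRight, assocRight_smul, h₂, ← map_add, ← map_add,
          Prod.mk_add_mk, zero_add, add_zero, Prod.mk.eta, e.symm_apply_apply]
    exact fun z => DFunLike.congr_fun this z
  have key₃ : ∀ w, projection e he X (ρ w) = 0 := fun w => by
    induction w using Finsupp.induction_linear with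
    | zero => rw [map_zero, map_zero]
    | add w w' h h' => rw [map_add, map_add, h, h', add_zero]
    | single q c =>
      rw [ρ_single]
      induction c with
      | zero => rw [map_zero, map_zero]
      | add c d h h' => rw [map_add, map_add, h, h', add_zero]
      | tmul a x =>
        rw [ρ₁_tmul, map_smul, projection_assocRight, e.apply_symm_apply, zero_smul, smul_zero]
  haveI : Module.Projective A U := inferInstance
  refine Module.Projective.of_split (τ ∘ₗ Submodule.subtype _)
    (LinearMap.codRestrict (LinearMap.ker (projection (M := M) e he X)) ρ key₃)
    (LinearMap.ext fun z => Subtype.ext ?_)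
  have h := key₂ z.1
  have h₀ : (assocRight (0 : X) (e.symm (1, 0)) : E) = 0 := by
    rw [← zero_smul A (0 : X), assocRight_smul, MulOpposite.op_zero, zero_smul, map_zero]
  rw [LinearMap.mem_ker.1 z.2, h₀, add_zero] at h
  exact h

end

end BalancedTensor

end

noncomputable section

/-! ### Equivalences of localizations -/

section LocalizationEquivalence

variable {C D : Type*} [Category C] [Category D] {W : MorphismProperty C} {W' : MorphismProperty D}
  {F : C ⥤ D} {G : D ⥤ C} (hF : ∀ ⦃X Y⦄ (f : X ⟶ Y), W f → W' (F.map f))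
  (hG : ∀ ⦃X Y⦄ (f : X ⟶ Y), W' f → W (G.map f))

include hF in
theorem CategoryTheory.MorphismProperty.isInvertedBy_comp_Q : W.IsInvertedBy (F ⋙ W'.Q) :=
  fun _ _ f hf => Localization.inverts W'.Q W' _ (hF f hf)

/-- The functor between localizations induced by a functor preserving the inverted classes. -/
def localizedFunctor : W.Localization ⥤ W'.Localization :=
  Localization.lift (F ⋙ W'.Q) (MorphismProperty.isInvertedBy_comp_Q hF) W.Q

/-- The defining property of the localized functor. -/
def localizedFunctorIso : W.Q ⋙ localizedFunctor hF ≅ F ⋙ W'.Q :=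
  Localization.fac (F ⋙ W'.Q) (MorphismProperty.isInvertedBy_comp_Q hF) W.Q

/-- A natural transformation to the identity which is a pointwise weak equivalence makes the
localized functors inverse to each other. -/
def localizedFunctorCompIso (p : F ⋙ G ⟶ 𝟭 C) (hp : ∀ X, W (p.app X)) :
    localizedFunctor hF ⋙ localizedFunctor hG ≅ 𝟭 W.Localization :=
  letI : Localization.Lifting W.Q W ((F ⋙ G) ⋙ W.Q) (localizedFunctor hF ⋙ localizedFunctor hG) :=
    ⟨(Functor.associator _ _ _).symm ≪≫
      Functor.isoWhiskerRight (localizedFunctorIso hF) (localizedFunctor hG) ≪≫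
      Functor.associator _ _ _ ≪≫ Functor.isoWhiskerLeft F (localizedFunctorIso hG) ≪≫
      (Functor.associator _ _ _).symm⟩
  haveI : ∀ X, IsIso ((Functor.whiskerRight p W.Q).app X) := fun X =>
    Localization.inverts W.Q W _ (hp X)
  haveI : IsIso (Functor.whiskerRight p W.Q) := NatIso.isIso_of_isIso_app _
  Localization.liftNatIso W.Q W ((F ⋙ G) ⋙ W.Q) W.Q _ _
    (asIso (Functor.whiskerRight p W.Q) ≪≫ W.Q.leftUnitor)

/-- Functors which are inverse to each other up to pointwise weak equivalences induce an
equivalence of localizations. -/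
def localizedEquivalence (p : F ⋙ G ⟶ 𝟭 C) (hp : ∀ X, W (p.app X)) (q : G ⋙ F ⟶ 𝟭 D)
    (hq : ∀ X, W' (q.app X)) : W.Localization ≌ W'.Localization :=
  CategoryTheory.Equivalence.mk (localizedFunctor hF) (localizedFunctor hG)
    (localizedFunctorCompIso hF hG p hp).symm (localizedFunctorCompIso hG hF q hq)

include hG in
/-- The unit of an adjunction is inverted in the localization if the localized left adjoint is an
equivalence. -/
theorem CategoryTheory.Adjunction.isIso_map_unit_of_localized (adj : F ⊣ G)
    [(localizedFunctor hF).IsEquivalence] (X : C) : IsIso (W.Q.map (adj.unit.app X)) := by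
  letI : CatCommSq F W.Q W'.Q (localizedFunctor hF) := ⟨(localizedFunctorIso hF).symm⟩
  letI : CatCommSq G W'.Q W.Q (localizedFunctor hG) := ⟨(localizedFunctorIso hG).symm⟩
  -- The localized adjunction has invertible unit since its left adjoint is an equivalence; up to
  -- comparison isomorphisms this unit is the image of the unit of `adj`.
  let ψ := adj.localization W.Q W W'.Q W' (localizedFunctor hF) (localizedFunctor hG)
  have h : IsIso (ψ.unit.app (W.Q.obj X)) := inferInstance
  rw [Adjunction.localization_unit_app] at h
  exact IsIso.of_isIso_comp_right (W.Q.map (adj.unit.app X))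
    ((CatCommSq.iso G W'.Q W.Q (localizedFunctor hG)).hom.app (F.obj X) ≫
      (localizedFunctor hG).map ((CatCommSq.iso F W.Q W'.Q (localizedFunctor hF)).hom.app X))

end LocalizationEquivalence

/-! ### The splitting as a natural transformation -/

namespace BalancedTensor

variable {k : Type v} {A B N M P : Type u} [Field k] [Ring A] [Ring B] [Algebra k A]
  [AddCommGroup N] [Module A N] [Module Bᵐᵒᵖ N] [SMulCommClass A Bᵐᵒᵖ N] [Module.Finite A N]
  [AddCommGroup M] [Module B M] [Module Aᵐᵒᵖ M] [SMulCommClass B Aᵐᵒᵖ M] [Module.Finite B M]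

instance : (tensorFunctor A B M).Additive where
  map_add {X Y f g} := FGModuleCat.ext' fun z => DFunLike.congr_fun (hom_ext
    (f := (lmap B M (f + g).hom.hom).toAddMonoidHom)
    (g := (lmap B M f.hom.hom).toAddMonoidHom + (lmap B M g.hom.hom).toAddMonoidHom)
    fun m x => tmul_add m _ _) z

/-- If `N ⊗_B M` is the sum of `A` and a projective bimodule, then the projection onto the first
summand induces a natural epimorphism `N ⊗_B (M ⊗_A X) ⟶ X` with projective kernel. -/
theorem exists_natTrans [IsNoetherianRing A]
    (h : IsRegularPlusProjective k A (BalancedTensor B N M)) :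
    ∃ p : tensorFunctor A B M ⋙ tensorFunctor B A N ⟶ 𝟭 (FGModuleCat.{u} A),
      ∀ X, ∃ (K : FGModuleCat.{u} A) (i : K ⟶ (tensorFunctor B A N).obj
        ((tensorFunctor A B M).obj X)), IsShortExact i (p.app X) ∧ fgProjective A K := by
  obtain ⟨P, _, _, _, e, he⟩ := h
  refine ⟨{ app := fun X => FGModuleCat.ofHom (projection e he X)
            naturality := fun X Y g => FGModuleCat.ext' fun z =>
              projection_naturality e he g.hom.hom z }, fun X => ?_⟩
  haveI : IsNoetherian A (BalancedTensor B N (BalancedTensor A M X)) :=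
    isNoetherian_of_isNoetherianRing_of_finite A _
  haveI : Module.Finite A (LinearMap.ker (projection (M := M) e he X)) :=
    Module.IsNoetherian.finite A _
  exact ⟨FGModuleCat.of A (LinearMap.ker (projection (M := M) e he X)),
    FGModuleCat.ofHom (Submodule.subtype _), ⟨Subtype.val_injective,
      LinearMap.exact_subtype_ker_map _, projection_surjective e he⟩,
    projective_ker_projection e he⟩

end BalancedTensor

end

noncomputable section

/-! ### Biadjoint pairs which are inverse to each other up to projective modules -/

namespace IsBiadjoint

variable {A B : Type u} [Ring A] [Ring B] [IsNoetherianRing A] [IsNoetherianRing B]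
  {F : FGModuleCat.{u} A ⥤ FGModuleCat.{u} B} {G : FGModuleCat.{u} B ⥤ FGModuleCat.{u} A}
  (h : IsBiadjoint F G)

theorem _root_.GPFin.exists_natTrans_weq (hp : ∃ p : F ⋙ G ⟶ 𝟭 (FGModuleCat.{u} A),
    ∀ X, ∃ (K : FGModuleCat.{u} A) (i : K ⟶ G.obj (F.obj X)),
      IsShortExact i (p.app X) ∧ _root_.fgProjective A K) :
    ∃ p : h.restrict ⋙ h.symm.restrict ⟶ 𝟭 (GPFin A), ∀ X, (gpModel A).weq (p.app X) := by
  obtain ⟨p, hp⟩ := hp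
  refine ⟨{ app := fun X => ObjectProperty.homMk (p.app X.obj)
            naturality := fun X Y f => ObjectProperty.hom_ext _ (p.naturality f.hom) },
    fun X => ?_⟩
  obtain ⟨K, i, hi, hK⟩ := hp X.obj
  exact GPFin.weq_of_epi hi hK.finiteProjDim

variable (p : h.restrict ⋙ h.symm.restrict ⟶ 𝟭 (GPFin A)) (hp : ∀ X, (gpModel A).weq (p.app X))
  (q : h.symm.restrict ⋙ h.restrict ⟶ 𝟭 (GPFin B)) (hq : ∀ X, (gpModel B).weq (q.app X))

/-- The induced equivalence of homotopy categories. -/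
def hoEquiv : HoGP A ≌ HoGP B :=
  localizedEquivalence (fun _ _ f hf => h.weq f hf) (fun _ _ f hf => h.symm.weq f hf) p hp q hq

include p hp q hq in
-- The adjunct of `f` is the unit followed by the image of `f` under the right adjoint. The unit is
-- inverted in the homotopy category, and the right adjoint preserves weak equivalences and reflects
-- them, being an equivalence after localization.
theorem isQuillenEquivalence : (gpModel A).IsQuillenEquivalence (gpModel B)
    (restrictAdjunction h.left (fun _ hX => h.finiteGorensteinProjDim hX)
      (fun _ hY => h.symm.finiteGorensteinProjDim hY)) where
  map_cof f hf := h.cof f hf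
  map_tcof f hf hf' := ⟨h.cof f hf, h.weq f hf'⟩
  weq_iff X Y _ _ f := by
    haveI : (localizedFunctor fun _ _ f hf => h.weq f hf).IsEquivalence :=
      (h.hoEquiv p hp q hq).isEquivalence_functor
    haveI : (localizedFunctor fun _ _ f hf => h.symm.weq f hf).IsEquivalence :=
      (h.hoEquiv p hp q hq).isEquivalence_inverse
    haveI := Adjunction.isIso_map_unit_of_localized (fun _ _ f hf => h.weq f hf)
      (fun _ _ f hf => h.symm.weq f hf) (restrictAdjunction h.left
        (fun _ hX => h.finiteGorensteinProjDim hX)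
        (fun _ hY => h.symm.finiteGorensteinProjDim hY)) X
    refine ⟨fun hf => ?_, fun hf => ?_⟩
    · rw [GPFin.weq_iff_isIso_toHo, Adjunction.homEquiv_unit, Functor.map_comp]
      haveI := GPFin.weq_iff_isIso_toHo.1 (h.symm.weq f hf)
      exact IsIso.comp_isIso' inferInstance this
    · rw [GPFin.weq_iff_isIso_toHo, Adjunction.homEquiv_unit, Functor.map_comp] at hf
      have hf' := (isIso_comp_left_iff _ _).1 hf
      rw [GPFin.weq_iff_isIso_toHo]
      refine @isIso_of_reflects_iso _ _ _ _ _ _ _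
        (localizedFunctor fun _ _ f hf => h.symm.weq f hf) ?_ _
      exact (NatIso.isIso_map_iff (localizedFunctorIso fun _ _ f hf => h.symm.weq f hf) f).2 hf'

include p hp q hq in
-- Localization on the `B` side is isomorphic to the exact restriction of `G`, followed by
-- localization on the `A` side and the equivalence, so suspension sequences and standard triangles
-- are carried along.
theorem standardTriangulation [TriangulatedStructure (HoGP A)] [TriangulatedStructure (HoGP B)]
    (St : StandardTriangulation (_root_.finiteProjDim A) (gpModel A).toHo)
    (he : IsTriangleEquivalence (h.hoEquiv p hp q hq)) :
    Nonempty (StandardTriangulation (_root_.finiteProjDim B) (gpModel B).toHo) :=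
  haveI := h.symm.restrict_additive
  StandardTriangulation.transport h.symm.isExactFunctor St he
    ((Functor.rightUnitor _).symm ≪≫
      Functor.isoWhiskerLeft _ (h.hoEquiv p hp q hq).counitIso.symm ≪≫
      (Functor.associator _ _ _).symm ≪≫
      Functor.isoWhiskerRight (localizedFunctorIso fun _ _ f hf => h.symm.weq f hf) _ ≪≫
      Functor.associator _ _ _)
    (hasStandardTriangles_gpFin B)

end IsBiadjoint

end

theorem mainTheorem3 (k : Type v) (A B M N : Type u) [Field k] [Ring A] [Ring B] [Algebra k A] [Algebra k B]
    [Module.Finite k A] [Module.Finite k B]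
    [AddCommGroup M] [Module k M] [Module B M] [Module Aᵐᵒᵖ M] [SMulCommClass B Aᵐᵒᵖ M]
    [IsScalarTower k B M] [IsScalarTower k Aᵐᵒᵖ M] [Module.Finite B M]
    [AddCommGroup N] [Module k N] [Module A N] [Module Bᵐᵒᵖ N] [SMulCommClass A Bᵐᵒᵖ N]
    [IsScalarTower k A N] [IsScalarTower k Bᵐᵒᵖ N] [Module.Finite A N]
    (h : IsStableEquivalenceOfMoritaType k A B M N)
    (adj : tensorFunctor A B M ⊣ tensorFunctor B A N)
    (adj' : Nonempty (tensorFunctor B A N ⊣ tensorFunctor A B M)) :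
    -- the Gorenstein projective model structures
    (gpModel A).IsModelStructure ∧ (gpModel B).IsModelStructure ∧
    -- the restricted adjunction exists and is a Quillen equivalence
    ∃ (hM : ∀ X, finiteGorensteinProjDim A X →
        finiteGorensteinProjDim B ((tensorFunctor A B M).obj X))
      (hN : ∀ Y, finiteGorensteinProjDim B Y →
        finiteGorensteinProjDim A ((tensorFunctor B A N).obj Y)),
      (gpModel A).IsQuillenEquivalence (gpModel B) (restrictAdjunction adj hM hN) ∧
      -- the standard triangulated structures
      ∃ (_ : TriangulatedStructure (StableGP A)) (_ : TriangulatedStructure (HoGP A))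
        (_ : TriangulatedStructure (HoGP B)) (_ : TriangulatedStructure (StableGP B)),
        Nonempty (StandardTriangulation (fgProjective A) (StableGP.proj A)) ∧
        Nonempty (StandardTriangulation (finiteProjDim A) (gpModel A).toHo) ∧
        Nonempty (StandardTriangulation (finiteProjDim B) (gpModel B).toHo) ∧
        Nonempty (StandardTriangulation (fgProjective B) (StableGP.proj B)) ∧
        -- the triangle equivalences
        ∃ (eA : StableGP A ≌ HoGP A) (e : HoGP A ≌ HoGP B) (eB : HoGP B ≌ StableGP B),
          IsTriangleEquivalence eA ∧ IsTriangleEquivalence e ∧ IsTriangleEquivalence eB ∧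
          -- the outer ones are induced by the inclusions
          Nonempty (StableGP.proj A ⋙ eA.functor ≅ GP.incl A ⋙ (gpModel A).toHo) ∧
          Nonempty (StableGP.proj B ⋙ eB.inverse ≅ GP.incl B ⋙ (gpModel B).toHo) ∧
          -- the middle one consists of the derived functors of the Quillen equivalence
          (∃ α : (gpModel A).toHo ⋙ e.functor ⟶
              restrictFunctor (tensorFunctor A B M) hM ⋙ (gpModel B).toHo,
            e.functor.IsLeftDerivedFunctor α (gpModel A).weq) ∧
          (∃ β : restrictFunctor (tensorFunctor B A N) hN ⋙ (gpModel A).toHo ⟶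
              (gpModel B).toHo ⋙ e.inverse,
            e.inverse.IsRightDerivedFunctor β (gpModel B).weq) := by
  haveI : IsNoetherianRing A := IsNoetherianRing.of_finite k A
  haveI : IsNoetherianRing B := IsNoetherianRing.of_finite k B
  let H : IsBiadjoint (tensorFunctor A B M) (tensorFunctor B A N) :=
    ⟨inferInstance, inferInstance, adj, adj'.some⟩
  refine ⟨gpModel_isModelStructure A, gpModel_isModelStructure B,
    fun _ hX => H.finiteGorensteinProjDim hX, fun _ hY => H.symm.finiteGorensteinProjDim hY, ?_⟩
  obtain ⟨p, hp⟩ := GPFin.exists_natTrans_weq H (BalancedTensor.exists_natTrans h.tensor_NM)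
  obtain ⟨q, hq⟩ := GPFin.exists_natTrans_weq H.symm (BalancedTensor.exists_natTrans h.tensor_MN)
  refine ⟨H.isQuillenEquivalence p hp q hq, ?_⟩
  let e : HoGP A ≌ HoGP B := H.hoEquiv p hp q hq
  obtain ⟨_, ⟨St⟩⟩ := exists_standardTriangulation_hoGP A
  obtain ⟨_, hStA, hA, -⟩ := exists_standardTriangulation_stableGP A St
  -- `HoGP B` receives its triangulation through `e`, which makes `e` triangulated by construction;
  -- that this triangulation is standard is the next step.
  obtain ⟨_, he, he'⟩ := exists_triangulatedStructure e
  obtain ⟨StB⟩ := H.standardTriangulation p hp q hq St he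
  obtain ⟨_, hStB, -, hB⟩ := exists_standardTriangulation_stableGP B StB
  exact ⟨_, _, _, _, hStA, ⟨St⟩, ⟨StB⟩, hStB, GPFin.stableEquiv A, e, (GPFin.stableEquiv B).symm,
    hA, he, hB, ⟨GPFin.projStableToHo A⟩, ⟨GPFin.projStableToHo B⟩,
    -- The tensor functors preserve all weak equivalences, so the functors induced on localizations
    -- are their total derived functors.
    ⟨_, Functor.isLeftDerivedFunctor_of_inverts _ _
      (localizedFunctorIso fun _ _ f hf => H.weq f hf)⟩,
    ⟨_, Functor.isRightDerivedFunctor_of_inverts _ _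
      (localizedFunctorIso fun _ _ f hf => H.symm.weq f hf)⟩⟩
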